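/- Let $q>0$ be real, $q\neq 1$, let $N\ge 3$, and work over $\mathbb K=\mathbb R$ or $\mathbb C$. All indices run over $1,\dots,N$, repeated upper and lower indices are summed, $i'=N+1-i$, and a condition in parentheses equals $1$ if it holds and $0$ otherwise. Put $\varrho_i=\frac N2-i$ for $i<\frac{N+1}2$, $\varrho_i=0$ for $i=\frac{N+1}2$, $\varrho_i=\frac N2-i+1$ for $i>\frac{N+1}2$, and $$C^{ij}=C_{ij}=q^{-\varrho_i}(i=j'),\qquad K^{kl}_{ij}=C^{ij}C_{kl},\qquad I^{kl}_{ij}=(k=i)(l=j),$$ $$\hat R^{kl}_{ij}=q^{(k=l)-(k=l')}(i=l)(j=k)+(q-q^{-1})(i<l)\bigl((i=k)(j=l)-K^{kl}_{ij}\bigr),$$ $$\hat R^{-1}=\hat R-(q-q^{-1})I+(q-q^{-1})K .$$ Let $\mathrm O_q(N)$ be the algebra with generators $u^i_j$ and relations $\hat R^{ij}_{kl}u^k_mu^l_n=u^i_ku^j_l\hat R^{kl}_{mn}$, $C^{kl}u^i_ku^j_l=C^{ij}$, $C_{kl}u^k_iu^l_j=C_{ij}$. Let $X$ (the quantum Euclidean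 sphere) be the algebra with generators $x_1,\dots,x_N$ and relations $$(\hat R^{-1})^{kl}_{ij}x_kx_l=q^{-1}x_ix_j+\frac{q^{N-1}-q^{N-3}}{1+q^{N-2}}K^{kl}_{ij}x_kx_l,\qquad C^{kl}x_kx_l=1,$$ with the coaction $\Delta_R:X\to X\otimes \mathrm O_q(N)$, the algebra homomorphism with $x_k\mapsto x_i\otimes u^i_k$. Let $(\Gamma,\mathrm d)=(\Gamma_+,\mathrm d)$ be the first order differential calculus on $X$ (the $X$-bimodule generated by the differentials $\mathrm dy$, linear in $y\in X$, subject to the Leibniz rule) defined by the relations $$\mathrm dx_i\cdot x_j=(\hat R^{-1})^{kl}_{ij}x_k\mathrm dx_l+(q-1)x_i\mathrm dx_j+\frac{q^N-q^{N-2}}{1-q^{N-1}}K^{kl}_{ij}x_k\mathrm dx_l+\frac{(1-q)(1+q^{N-2})}{1-q^{N-1}}C^{kl}x_ix_jx_k\mathrm dx_l ,$$ with the coaction $\Phi_R:\Gamma\to\Gamma\otimes\mathrm O_q(N)$ determined by $\Phi_R(\mathrm dy)=(\mathrm d\otimes\mathrm{id})\Delta_R(y)$ and $\Phi_R(y\omega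 z)=\Delta_R(y)\Phi_R(\omega)\Delta_R(z)$. Put $\eta=C^{kl}x_k\mathrm dx_l$ and $$\gamma^+_i=\mathrm dx_i-\frac{1+q^{N-2}}{1-q^{N-1}}x_i\eta,\qquad \gamma^-_i=\mathrm dx_i+q\,\frac{1+q^{N-2}}{1-q^{N-1}}x_i\eta .$$ **Theorem.** Let either $\gamma_i=\gamma^+_i$ for all $i$, or $\gamma_i=\gamma^-_i$ for all $i$. Then $\gamma_1,\dots,\gamma_N$ is a basis of $\Gamma$ as a left $X$-module, and for every real number $\alpha$ there is a unique $X$-bimodule homomorphism $\sigma:\Gamma\otimes_X\Gamma\to\Gamma\otimes_X\Gamma$ with $$\sigma(\gamma_i\otimes_X\gamma_j)=\alpha\,(\hat R^{-1})^{kl}_{ij}\,\gamma_k\otimes_X\gamma_l\qquad\text{for all } i,j.$$ This $\sigma$ is covariant, i.e. $\Phi^{(2)}\circ\sigma=(\sigma\otimes\mathrm{id}_{\mathrm O_q(N)})\circ\Phi^{(2)}$, where $\Phi^{(2)}:\Gamma\otimes_X\Gamma\to(\Gamma\otimes_X\Gamma)\otimes\mathrm O_q(N)$ is $\Phi_R\otimes\Phi_R$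 followed by multiplication of the two components in $\mathrm O_q(N)$, and it satisfies the braid relation $$(\sigma\otimes\mathrm{id})(\mathrm{id}\otimes\sigma)(\sigma\otimes\mathrm{id})=(\mathrm{id}\otimes\sigma)(\sigma\otimes\mathrm{id})(\mathrm{id}\otimes\sigma)$$ on $\Gamma\otimes_X\Gamma\otimes_X\Gamma$. -/

import Mathlib

open scoped TensorProduct

namespace QSphere

/-! ### Bimodules over a (noncommutative) algebra `A`, as modules over `A ⊗ Aᵐᵒᵖ` -/

section Bimodules

/-- The enveloping algebra. An `A`-bimodule over `𝕜` is a module over `Env 𝕜 A`, where `a ⊗ op b`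
acts by `m ↦ a m b`; a bimodule homomorphism is an `Env 𝕜 A`-linear map. -/
abbrev Env (𝕜 A : Type*) [Field 𝕜] [Ring A] [Algebra 𝕜 A] : Type _ := A ⊗[𝕜] Aᵐᵒᵖ

variable (𝕜 : Type*) [Field 𝕜] {A : Type*} [Ring A] [Algebra 𝕜 A]
variable {M : Type*} [AddCommGroup M] [Module (Env 𝕜 A) M]

/-- The left product `a m` in a bimodule. -/
def lmul (a : A) (m : M) : M := (a ⊗ₜ[𝕜] (1 : Aᵐᵒᵖ)) • m

/-- The right product `m a` in a bimodule. -/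
def rmul (m : M) (a : A) : M := ((1 : A) ⊗ₜ[𝕜] MulOpposite.op a) • m

theorem env_smul_eq (a b : A) (m : M) :
    (a ⊗ₜ[𝕜] MulOpposite.op b) • m = lmul 𝕜 a (rmul 𝕜 m b) := by
  simp [lmul, rmul, smul_smul]

theorem lmul_rmul (a b : A) (m : M) : lmul 𝕜 a (rmul 𝕜 m b) = rmul 𝕜 (lmul 𝕜 a m) b := by
  simp [lmul, rmul, smul_smul]

theorem lmul_lmul (a b : A) (m : M) : lmul 𝕜 a (lmul 𝕜 b m) = lmul 𝕜 (a * b) m := by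
  simp [lmul, smul_smul]

theorem rmul_rmul (a b : A) (m : M) : rmul 𝕜 (rmul 𝕜 m a) b = rmul 𝕜 m (a * b) := by
  simp [rmul, smul_smul]

theorem one_lmul (m : M) : lmul 𝕜 (1 : A) m = m := by
  simp [lmul, ← Algebra.TensorProduct.one_def]

theorem rmul_one (m : M) : rmul 𝕜 m (1 : A) = m := by
  simp [rmul, ← Algebra.TensorProduct.one_def]

theorem lmul_zero (a : A) : lmul 𝕜 a (0 : M) = 0 := smul_zero _

theorem zero_rmul (a : A) : rmul 𝕜 (0 : M) a = 0 := smul_zero _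

theorem lmul_add (a : A) (m n : M) : lmul 𝕜 a (m + n) = lmul 𝕜 a m + lmul 𝕜 a n :=
  smul_add _ _ _

theorem add_rmul (a : A) (m n : M) : rmul 𝕜 (m + n) a = rmul 𝕜 m a + rmul 𝕜 n a :=
  smul_add _ _ _

variable (A M)
variable [Module 𝕜 M] [IsScalarTower 𝕜 (Env 𝕜 A) M]

/-- The left action of `A` on a bimodule. -/
noncomputable def lact : A →ₐ[𝕜] Module.End 𝕜 M :=
  (Algebra.lsmul 𝕜 𝕜 M).comp (Algebra.TensorProduct.includeLeft : A →ₐ[𝕜] Env 𝕜 A)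

/-- The right action of `A` on a bimodule. -/
noncomputable def ract : Aᵐᵒᵖ →ₐ[𝕜] Module.End 𝕜 M :=
  (Algebra.lsmul 𝕜 𝕜 M).comp (Algebra.TensorProduct.includeRight : Aᵐᵒᵖ →ₐ[𝕜] Env 𝕜 A)

variable {A M}

@[simp] theorem lact_apply (a : A) (m : M) : lact 𝕜 A M a m = lmul 𝕜 a m := rfl

@[simp] theorem ract_apply (a : A) (m : M) :
    ract 𝕜 A M (MulOpposite.op a) m = rmul 𝕜 m a := rfl

variable (A M)
variable (N : Type*) [AddCommGroup N] [Module 𝕜 N] [Module (Env 𝕜 A) N]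
  [IsScalarTower 𝕜 (Env 𝕜 A) N]
variable (P : Type*) [AddCommGroup P] [Module 𝕜 P] [Module (Env 𝕜 A) P]
  [IsScalarTower 𝕜 (Env 𝕜 A) P]

/-- The bimodule structure `a (m ⊗ n) b = (a m) ⊗ (n b)` on the tensor product over `𝕜`. -/
noncomputable def outerAct : Env 𝕜 A →ₐ[𝕜] Module.End 𝕜 (M ⊗[𝕜] N) :=
  Algebra.TensorProduct.lift
    ((Module.End.rTensorAlgHom 𝕜 M N).comp (lact 𝕜 A M))
    ((Module.End.lTensorAlgHom 𝕜 N M).comp (ract 𝕜 A N))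
    (fun _ _ => (commute_iff_eq _ _).2 (TensorProduct.ext' fun _ _ => rfl))

theorem outerAct_tmul (a b : A) (m : M) (n : N) :
    outerAct 𝕜 A M N (a ⊗ₜ[𝕜] MulOpposite.op b) (m ⊗ₜ[𝕜] n) = lmul 𝕜 a m ⊗ₜ[𝕜] rmul 𝕜 n b := by
  rw [outerAct, Algebra.TensorProduct.lift_tmul]
  rfl

/-- `M ⊗ N` over `𝕜` as a bimodule: left product on `M`, right product on `N`. -/
def OuterTensor : Type _ :=
  let _ := A
  M ⊗[𝕜] N

noncomputable instance : AddCommGroup (OuterTensor 𝕜 A M N) :=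
  inferInstanceAs (AddCommGroup (M ⊗[𝕜] N))

noncomputable instance : Module 𝕜 (OuterTensor 𝕜 A M N) :=
  inferInstanceAs (Module 𝕜 (M ⊗[𝕜] N))

noncomputable instance : Module (Env 𝕜 A) (OuterTensor 𝕜 A M N) :=
  Module.compHom (M ⊗[𝕜] N) (outerAct 𝕜 A M N).toRingHom

instance : IsScalarTower 𝕜 (Env 𝕜 A) (OuterTensor 𝕜 A M N) where
  smul_assoc c e t := by
    change outerAct 𝕜 A M N (c • e) _ = c • outerAct 𝕜 A M N e _
    rw [map_smul]
    rfl

variable {M N P}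

/-- The pure tensor `m ⊗ n` in `M ⊗ N` over `𝕜`. -/
def otmul (m : M) (n : N) : OuterTensor 𝕜 A M N := m ⊗ₜ[𝕜] n

theorem smul_otmul (a b : A) (m : M) (n : N) :
    (a ⊗ₜ[𝕜] MulOpposite.op b : Env 𝕜 A) • otmul 𝕜 A m n
      = otmul 𝕜 A (lmul 𝕜 a m) (rmul 𝕜 n b) :=
  outerAct_tmul 𝕜 A M N a b m n

/-- The elements `m a ⊗ n - m ⊗ a n`. -/
def balancedSet (M N : Type*) [AddCommGroup M] [Module 𝕜 M] [Module (Env 𝕜 A) M]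
    [AddCommGroup N] [Module 𝕜 N] [Module (Env 𝕜 A) N] [IsScalarTower 𝕜 (Env 𝕜 A) M]
    [IsScalarTower 𝕜 (Env 𝕜 A) N] : Set (OuterTensor 𝕜 A M N) :=
  {t | ∃ (m : M) (a : A) (n : N),
    t = otmul 𝕜 A (rmul 𝕜 m a) n - otmul 𝕜 A m (lmul 𝕜 a n)}

variable (M N)

/-- The tensor product `M ⊗_A N` of two `A`-bimodules, with its bimodule structure: the quotient of
`M ⊗ N` over `𝕜` by the sub-bimodule generated by all `m a ⊗ n - m ⊗ a n`. -/
def BTensor : Type _ :=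
  OuterTensor 𝕜 A M N ⧸ Submodule.span (Env 𝕜 A) (balancedSet 𝕜 A M N)

noncomputable instance : AddCommGroup (BTensor 𝕜 A M N) :=
  inferInstanceAs (AddCommGroup (_ ⧸ Submodule.span (Env 𝕜 A) (balancedSet 𝕜 A M N)))

noncomputable instance : Module (Env 𝕜 A) (BTensor 𝕜 A M N) :=
  inferInstanceAs (Module (Env 𝕜 A) (_ ⧸ Submodule.span (Env 𝕜 A) (balancedSet 𝕜 A M N)))

noncomputable instance : Module 𝕜 (BTensor 𝕜 A M N) :=
  inferInstanceAs (Module 𝕜 (_ ⧸ Submodule.span (Env 𝕜 A) (balancedSet 𝕜 A M N)))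

instance : IsScalarTower 𝕜 (Env 𝕜 A) (BTensor 𝕜 A M N) :=
  inferInstanceAs (IsScalarTower 𝕜 (Env 𝕜 A)
    (_ ⧸ Submodule.span (Env 𝕜 A) (balancedSet 𝕜 A M N)))

/-- The bilinear map `(m, n) ↦ m ⊗_A n`. -/
noncomputable def bmk : M →ₗ[𝕜] N →ₗ[𝕜] BTensor 𝕜 A M N :=
  (TensorProduct.mk 𝕜 M N).compr₂
    ((Submodule.mkQ (Submodule.span (Env 𝕜 A) (balancedSet 𝕜 A M N))).restrictScalars 𝕜 :
      OuterTensor 𝕜 A M N →ₗ[𝕜] BTensor 𝕜 A M N)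

variable {M N}

/-- The pure tensor `m ⊗_A n`. -/
noncomputable def btmul (m : M) (n : N) : BTensor 𝕜 A M N := bmk 𝕜 A M N m n

variable {A}

theorem rmul_btmul (m : M) (a : A) (n : N) :
    btmul 𝕜 A (rmul 𝕜 m a) n = btmul 𝕜 A m (lmul 𝕜 a n) :=
  (Submodule.Quotient.eq (Submodule.span (Env 𝕜 A) (balancedSet 𝕜 A M N))).2
    (Submodule.subset_span ⟨m, a, n, rfl⟩)

theorem lmul_btmul (a : A) (m : M) (n : N) :
    lmul 𝕜 a (btmul 𝕜 A m n) = btmul 𝕜 A (lmul 𝕜 a m) n := by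
  have h := smul_otmul 𝕜 A a 1 m n
  rw [rmul_one] at h
  exact congrArg (Submodule.Quotient.mk (p := Submodule.span (Env 𝕜 A) (balancedSet 𝕜 A M N))) h

theorem btmul_rmul (a : A) (m : M) (n : N) :
    rmul 𝕜 (btmul 𝕜 A m n) a = btmul 𝕜 A m (rmul 𝕜 n a) := by
  have h := smul_otmul 𝕜 A 1 a m n
  rw [one_lmul] at h
  exact congrArg (Submodule.Quotient.mk (p := Submodule.span (Env 𝕜 A) (balancedSet 𝕜 A M N))) h

theorem tmul_smul_mem (a b : A) {t : OuterTensor 𝕜 A M N}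
    (ht : t ∈ Submodule.span 𝕜 (balancedSet 𝕜 A M N)) :
    (a ⊗ₜ[𝕜] MulOpposite.op b : Env 𝕜 A) • t ∈ Submodule.span 𝕜 (balancedSet 𝕜 A M N) := by
  induction ht using Submodule.span_induction with
  | mem t ht =>
    obtain ⟨m, c, n, rfl⟩ := ht
    refine Submodule.subset_span ⟨lmul 𝕜 a m, c, rmul 𝕜 n b, ?_⟩
    rw [smul_sub, smul_otmul, smul_otmul, lmul_rmul, lmul_rmul]
  | zero => rw [smul_zero]; exact Submodule.zero_mem _
  | add s t _ _ hs ht => rw [smul_add]; exact Submodule.add_mem _ hs ht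
  | smul c t _ ht =>
    have : (a ⊗ₜ[𝕜] MulOpposite.op b : Env 𝕜 A) • (c • t)
        = c • ((a ⊗ₜ[𝕜] MulOpposite.op b : Env 𝕜 A) • t) :=
      LinearMap.map_smul (outerAct 𝕜 A M N (a ⊗ₜ[𝕜] MulOpposite.op b)) c t
    rw [this]
    exact Submodule.smul_mem _ c ht

/-- The sub-bimodule generated by the balancing relations is already their linear span. -/
theorem mem_span_of_balanced {t : OuterTensor 𝕜 A M N}
    (ht : t ∈ Submodule.span (Env 𝕜 A) (balancedSet 𝕜 A M N)) :
    t ∈ Submodule.span 𝕜 (balancedSet 𝕜 A M N) := by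
  induction ht using Submodule.span_induction with
  | mem t ht => exact Submodule.subset_span ht
  | zero => exact Submodule.zero_mem _
  | add s t _ _ hs ht => exact Submodule.add_mem _ hs ht
  | smul e t _ ht =>
    induction e using TensorProduct.induction_on with
    | zero =>
      rw [← TensorProduct.zero_tmul A (MulOpposite.op (0 : A))]
      exact tmul_smul_mem 𝕜 0 0 ht
    | add e f he hf => rw [add_smul]; exact Submodule.add_mem _ he hf
    | tmul a b =>
      obtain ⟨b, rfl⟩ := MulOpposite.op_surjective b
      exact tmul_smul_mem 𝕜 a b ht

/-- The linear map on `M ⊗ N` induced by a bilinear map. -/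
noncomputable def olift {Q : Type*} [AddCommGroup Q] [Module 𝕜 Q] (f : M →ₗ[𝕜] N →ₗ[𝕜] Q) :
    OuterTensor 𝕜 A M N →ₗ[𝕜] Q := TensorProduct.lift f

theorem olift_balanced {Q : Type*} [AddCommGroup Q] [Module 𝕜 Q] (f : M →ₗ[𝕜] N →ₗ[𝕜] Q)
    (hf : ∀ (m : M) (a : A) (n : N), f (rmul 𝕜 m a) n = f m (lmul 𝕜 a n)) :
    (Submodule.span (Env 𝕜 A) (balancedSet 𝕜 A M N)).restrictScalars 𝕜
      ≤ LinearMap.ker (olift 𝕜 f) := by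
  intro t ht
  have hle : Submodule.span 𝕜 (balancedSet 𝕜 A M N) ≤ LinearMap.ker (olift 𝕜 f) := by
    rw [Submodule.span_le]
    rintro _ ⟨m, a, n, rfl⟩
    rw [SetLike.mem_coe, LinearMap.mem_ker, map_sub, sub_eq_zero]
    exact hf m a n
  exact hle (mem_span_of_balanced 𝕜 ht)

/-- The linear map on `M ⊗_A N` induced by an `A`-balanced bilinear map. -/
noncomputable def blift {Q : Type*} [AddCommGroup Q] [Module 𝕜 Q] (f : M →ₗ[𝕜] N →ₗ[𝕜] Q)
    (hf : ∀ (m : M) (a : A) (n : N), f (rmul 𝕜 m a) n = f m (lmul 𝕜 a n)) :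
    BTensor 𝕜 A M N →ₗ[𝕜] Q :=
  (Submodule.liftQ _ (olift 𝕜 f) (olift_balanced 𝕜 f hf)).comp
    (Submodule.Quotient.restrictScalarsEquiv 𝕜
      (Submodule.span (Env 𝕜 A) (balancedSet 𝕜 A M N))).symm.toLinearMap

@[simp] theorem blift_btmul {Q : Type*} [AddCommGroup Q] [Module 𝕜 Q]
    (f : M →ₗ[𝕜] N →ₗ[𝕜] Q)
    (hf : ∀ (m : M) (a : A) (n : N), f (rmul 𝕜 m a) n = f m (lmul 𝕜 a n)) (m : M) (n : N) :
    blift 𝕜 f hf (btmul 𝕜 A m n) = f m n := rfl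

theorem btmul_add_left (m m' : M) (n : N) :
    btmul 𝕜 A (m + m') n = btmul 𝕜 A m n + btmul 𝕜 A m' n :=
  LinearMap.map_add₂ _ _ _ _

theorem btmul_add_right (m : M) (n n' : N) :
    btmul 𝕜 A m (n + n') = btmul 𝕜 A m n + btmul 𝕜 A m n' :=
  map_add _ _ _

theorem zero_btmul (n : N) : btmul 𝕜 A (0 : M) n = 0 := LinearMap.map_zero₂ _ _

theorem btmul_zero (m : M) : btmul 𝕜 A m (0 : N) = 0 := map_zero _

theorem bTensor_induction {p : BTensor 𝕜 A M N → Prop} (h0 : p 0)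
    (h1 : ∀ m n, p (btmul 𝕜 A m n)) (h2 : ∀ s t, p s → p t → p (s + t)) (t) : p t := by
  obtain ⟨t, rfl⟩ := Submodule.Quotient.mk_surjective _ t
  induction t using TensorProduct.induction_on with
  | zero => exact h0
  | tmul m n => exact h1 m n
  | add s t hs ht => exact h2 _ _ hs ht

/-- Two linear maps on `M ⊗_A N` that agree on pure tensors are equal. -/
theorem bTensor_ext {Q : Type*} [AddCommGroup Q] [Module 𝕜 Q] {f g : BTensor 𝕜 A M N →ₗ[𝕜] Q}
    (h : ∀ m n, f (btmul 𝕜 A m n) = g (btmul 𝕜 A m n)) : f = g := by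
  refine LinearMap.ext fun t => ?_
  induction t using bTensor_induction with
  | h0 => simp
  | h1 m n => exact h m n
  | h2 s t hs ht => rw [map_add, map_add, hs, ht]

section Map

variable {M' N' : Type*} [AddCommGroup M'] [Module 𝕜 M'] [Module (Env 𝕜 A) M']
  [IsScalarTower 𝕜 (Env 𝕜 A) M'] [AddCommGroup N'] [Module 𝕜 N'] [Module (Env 𝕜 A) N']
  [IsScalarTower 𝕜 (Env 𝕜 A) N']

/-- The map `f ⊗_A g` for bimodule homomorphisms `f` and `g`. -/
noncomputable def bmap (f : M →ₗ[Env 𝕜 A] M') (g : N →ₗ[Env 𝕜 A] N') :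
    BTensor 𝕜 A M N →ₗ[𝕜] BTensor 𝕜 A M' N' :=
  blift 𝕜 ((bmk 𝕜 A M' N').compl₁₂ (f.restrictScalars 𝕜) (g.restrictScalars 𝕜))
    (fun m a n => by
      have h1 : f (rmul 𝕜 m a) = rmul 𝕜 (f m) a := f.map_smul _ _
      have h2 : g (lmul 𝕜 a n) = lmul 𝕜 a (g n) := g.map_smul _ _
      change btmul 𝕜 A (f (rmul 𝕜 m a)) (g n) = btmul 𝕜 A (f m) (g (lmul 𝕜 a n))
      rw [h1, h2, rmul_btmul])

@[simp] theorem bmap_btmul (f : M →ₗ[Env 𝕜 A] M') (g : N →ₗ[Env 𝕜 A] N') (m : M) (n : N) :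
    bmap 𝕜 f g (btmul 𝕜 A m n) = btmul 𝕜 A (f m) (g n) := rfl

end Map

variable (A M N P)

/-- The map `m, n ↦ (p ↦ m ⊗ (n ⊗ p))`. -/
noncomputable def assocAux₁ : M →ₗ[𝕜] N →ₗ[𝕜] P →ₗ[𝕜] BTensor 𝕜 A M (BTensor 𝕜 A N P) :=
  (LinearMap.llcomp 𝕜 P (BTensor 𝕜 A N P) (BTensor 𝕜 A M (BTensor 𝕜 A N P))).compl₁₂
    (bmk 𝕜 A M (BTensor 𝕜 A N P)) (bmk 𝕜 A N P)

theorem assocAux₁_apply (m : M) (n : N) (p : P) :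
    assocAux₁ 𝕜 A M N P m n p = btmul 𝕜 A m (btmul 𝕜 A n p) := rfl

/-- The map `m ⊗ n ↦ (p ↦ m ⊗ (n ⊗ p))`. -/
noncomputable def assocAux₂ :
    BTensor 𝕜 A M N →ₗ[𝕜] P →ₗ[𝕜] BTensor 𝕜 A M (BTensor 𝕜 A N P) :=
  blift 𝕜 (assocAux₁ 𝕜 A M N P) (fun m a n => LinearMap.ext fun p => by
    rw [assocAux₁_apply, assocAux₁_apply, rmul_btmul, lmul_btmul])

theorem assocAux₂_apply (m : M) (n : N) (p : P) :
    assocAux₂ 𝕜 A M N P (btmul 𝕜 A m n) p = btmul 𝕜 A m (btmul 𝕜 A n p) := rfl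

/-- The map `(M ⊗_A N) ⊗_A P → M ⊗_A (N ⊗_A P)`. -/
noncomputable def bassocHom :
    BTensor 𝕜 A (BTensor 𝕜 A M N) P →ₗ[𝕜] BTensor 𝕜 A M (BTensor 𝕜 A N P) :=
  blift 𝕜 (assocAux₂ 𝕜 A M N P) (fun t a p => by
      induction t using bTensor_induction with
      | h0 => rw [zero_rmul, map_zero, LinearMap.zero_apply, LinearMap.zero_apply]
      | h1 m n => rw [btmul_rmul, assocAux₂_apply, assocAux₂_apply, rmul_btmul]
      | h2 s t hs ht =>
        rw [add_rmul, map_add, map_add, LinearMap.add_apply, LinearMap.add_apply, hs, ht])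

/-- The map `n, p ↦ (m ↦ (m ⊗ n) ⊗ p)`. -/
noncomputable def assocAux₃ : N →ₗ[𝕜] P →ₗ[𝕜] M →ₗ[𝕜] BTensor 𝕜 A (BTensor 𝕜 A M N) P :=
  ((LinearMap.llcomp 𝕜 M (BTensor 𝕜 A M N) (BTensor 𝕜 A (BTensor 𝕜 A M N) P)).compl₁₂
    (bmk 𝕜 A (BTensor 𝕜 A M N) P).flip (bmk 𝕜 A M N).flip).flip

theorem assocAux₃_apply (m : M) (n : N) (p : P) :
    assocAux₃ 𝕜 A M N P n p m = btmul 𝕜 A (btmul 𝕜 A m n) p := rfl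

/-- The map `m ↦ (n ⊗ p ↦ (m ⊗ n) ⊗ p)`. -/
noncomputable def assocAux₄ :
    M →ₗ[𝕜] BTensor 𝕜 A N P →ₗ[𝕜] BTensor 𝕜 A (BTensor 𝕜 A M N) P :=
  (blift 𝕜 (assocAux₃ 𝕜 A M N P) (fun n a p => LinearMap.ext fun m => by
    rw [assocAux₃_apply, assocAux₃_apply, ← btmul_rmul, rmul_btmul])).flip

theorem assocAux₄_apply (m : M) (n : N) (p : P) :
    assocAux₄ 𝕜 A M N P m (btmul 𝕜 A n p) = btmul 𝕜 A (btmul 𝕜 A m n) p := rfl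

/-- The map `M ⊗_A (N ⊗_A P) → (M ⊗_A N) ⊗_A P`. -/
noncomputable def bassocInv :
    BTensor 𝕜 A M (BTensor 𝕜 A N P) →ₗ[𝕜] BTensor 𝕜 A (BTensor 𝕜 A M N) P :=
  blift 𝕜 (assocAux₄ 𝕜 A M N P) (fun m a t => by
      induction t using bTensor_induction with
      | h0 => rw [lmul_zero, map_zero, map_zero]
      | h1 n p => rw [lmul_btmul, assocAux₄_apply, assocAux₄_apply, rmul_btmul]
      | h2 s t hs ht => rw [lmul_add, map_add, map_add, hs, ht])

theorem bassocHom_btmul (m : M) (n : N) (p : P) :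
    bassocHom 𝕜 A M N P (btmul 𝕜 A (btmul 𝕜 A m n) p) = btmul 𝕜 A m (btmul 𝕜 A n p) := rfl

theorem bassocInv_btmul (m : M) (n : N) (p : P) :
    bassocInv 𝕜 A M N P (btmul 𝕜 A m (btmul 𝕜 A n p)) = btmul 𝕜 A (btmul 𝕜 A m n) p := rfl

/-- The associativity isomorphism `(M ⊗_A N) ⊗_A P ≅ M ⊗_A (N ⊗_A P)`. -/
noncomputable def bassoc :
    BTensor 𝕜 A (BTensor 𝕜 A M N) P ≃ₗ[𝕜] BTensor 𝕜 A M (BTensor 𝕜 A N P) :=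
  LinearEquiv.ofLinearMap (bassocHom 𝕜 A M N P) (bassocInv 𝕜 A M N P)
    (bTensor_ext 𝕜 fun m t => by
      induction t using bTensor_induction with
      | h0 => rw [btmul_zero, map_zero, map_zero]
      | h1 n p =>
        rw [LinearMap.comp_apply, bassocInv_btmul, bassocHom_btmul, LinearMap.id_apply]
      | h2 s t hs ht => rw [btmul_add_right, map_add, map_add, hs, ht])
    (bTensor_ext 𝕜 fun t p => by
      induction t using bTensor_induction with
      | h0 => rw [zero_btmul, map_zero, map_zero]
      | h1 m n =>
        rw [LinearMap.comp_apply, bassocHom_btmul, bassocInv_btmul, LinearMap.id_apply]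
      | h2 s t hs ht => rw [btmul_add_left, map_add, map_add, hs, ht])

theorem bassoc_btmul (m : M) (n : N) (p : P) :
    bassoc 𝕜 A M N P (btmul 𝕜 A (btmul 𝕜 A m n) p) = btmul 𝕜 A m (btmul 𝕜 A n p) := rfl

variable {A M}

/-- The braid relation
`(σ ⊗ id)(id ⊗ σ)(σ ⊗ id) = (id ⊗ σ)(σ ⊗ id)(id ⊗ σ)` on `M ⊗_A M ⊗_A M`. -/
def IsBraiding (σ : BTensor 𝕜 A M M →ₗ[Env 𝕜 A] BTensor 𝕜 A M M) : Prop :=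
  let σ₁ : BTensor 𝕜 A (BTensor 𝕜 A M M) M →ₗ[𝕜] BTensor 𝕜 A (BTensor 𝕜 A M M) M :=
    bmap 𝕜 σ LinearMap.id
  let σ₂ : BTensor 𝕜 A (BTensor 𝕜 A M M) M →ₗ[𝕜] BTensor 𝕜 A (BTensor 𝕜 A M M) M :=
    (bassoc 𝕜 A M M M).symm.toLinearMap ∘ₗ bmap 𝕜 LinearMap.id σ ∘ₗ
      (bassoc 𝕜 A M M M).toLinearMap
  σ₁ ∘ₗ σ₂ ∘ₗ σ₁ = σ₂ ∘ₗ σ₁ ∘ₗ σ₂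

end Bimodules


/-! ### The R-matrix of `O_q(N)`

The indices `1, …, N` are the elements of `Fin N`, where `i : Fin N` stands for `i + 1`; the
involution `i ↦ i' = N + 1 - i` is `Fin.rev`. -/

section RMatrix

/-- The constants `ρ_i`. -/
noncomputable def rho {N : ℕ} (i : Fin N) : ℝ :=
  if 2 * ((i : ℕ) + 1) < N + 1 then (N : ℝ) / 2 - ((i : ℕ) + 1)
  else if 2 * ((i : ℕ) + 1) = N + 1 then 0
  else (N : ℝ) / 2 - ((i : ℕ) + 1) + 1

/-- The metric `C^{ij} = C_{ij} = q^{-ρ_i} (i = j')`. -/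
noncomputable def metric (q : ℝ) {N : ℕ} (i j : Fin N) : ℝ :=
  if i = j.rev then q ^ (-rho i) else 0

/-- `K^{kl}_{ij} = C^{ij} C_{kl}`. -/
noncomputable def Kmat (q : ℝ) {N : ℕ} (k l i j : Fin N) : ℝ := metric q i j * metric q k l

/-- The identity `I^{kl}_{ij}`. -/
def Imat {N : ℕ} (k l i j : Fin N) : ℝ := if k = i ∧ l = j then 1 else 0

/-- The R-matrix
`R^{kl}_{ij} = q^{(k=l)-(k=l')} (i=l)(j=k) + (q - q⁻¹) (i<l) ((i=k)(j=l) - K^{kl}_{ij})`. -/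
noncomputable def Rmat (q : ℝ) {N : ℕ} (k l i j : Fin N) : ℝ :=
  (if i = l ∧ j = k then
    q ^ ((if k = l then 1 else 0) - (if k = l.rev then 1 else 0) : ℤ) else 0)
  + (q - q⁻¹) * (if i < l then Imat k l i j - Kmat q k l i j else 0)

/-- The inverse `R⁻¹ = R - (q - q⁻¹) I + (q - q⁻¹) K` of the R-matrix. -/
noncomputable def Rinv (q : ℝ) {N : ℕ} (k l i j : Fin N) : ℝ :=
  Rmat q k l i j - (q - q⁻¹) * Imat k l i j + (q - q⁻¹) * Kmat q k l i j

end RMatrix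

/-! ### The quantum group `O_q(N)` and the quantum Euclidean sphere -/

section Algebras

variable (𝕜 : Type*) [RCLike 𝕜] (q : ℝ) (N : ℕ)

/-- The generator `u^i_j` in the free algebra. -/
def fu {N : ℕ} (i j : Fin N) : FreeAlgebra 𝕜 (Fin N × Fin N) := FreeAlgebra.ι 𝕜 (i, j)

/-- The defining relations of the coordinate algebra of `O_q(N)`:
`R^{ij}_{kl} u^k_m u^l_n = u^i_k u^j_l R^{kl}_{mn}` and
`C^{kl} u^i_k u^j_l = C^{ij}`, `C_{kl} u^k_i u^l_j = C_{ij}`. -/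
inductive OqRel : FreeAlgebra 𝕜 (Fin N × Fin N) → FreeAlgebra 𝕜 (Fin N × Fin N) → Prop
  | rtt (i j m n : Fin N) : OqRel
      (∑ k, ∑ l, ((Rmat q i j k l : ℝ) : 𝕜) • (fu 𝕜 k m * fu 𝕜 l n))
      (∑ k, ∑ l, ((Rmat q k l m n : ℝ) : 𝕜) • (fu 𝕜 i k * fu 𝕜 j l))
  | metric_upper (i j : Fin N) : OqRel
      (∑ k, ∑ l, ((metric q k l : ℝ) : 𝕜) • (fu 𝕜 i k * fu 𝕜 j l))
      (algebraMap 𝕜 _ ((metric q i j : ℝ) : 𝕜))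
  | metric_lower (i j : Fin N) : OqRel
      (∑ k, ∑ l, ((metric q k l : ℝ) : 𝕜) • (fu 𝕜 k i * fu 𝕜 l j))
      (algebraMap 𝕜 _ ((metric q i j : ℝ) : 𝕜))

/-- The coordinate algebra of the quantum group `O_q(N)`. -/
def Oq : Type _ := RingQuot (OqRel 𝕜 q N)

noncomputable instance : Ring (Oq 𝕜 q N) := inferInstanceAs (Ring (RingQuot (OqRel 𝕜 q N)))

noncomputable instance : Algebra 𝕜 (Oq 𝕜 q N) :=
  inferInstanceAs (Algebra 𝕜 (RingQuot (OqRel 𝕜 q N)))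

/-- The quotient map onto `O_q(N)`. -/
noncomputable def oqMk : FreeAlgebra 𝕜 (Fin N × Fin N) →ₐ[𝕜] Oq 𝕜 q N :=
  RingQuot.mkAlgHom 𝕜 (OqRel 𝕜 q N)

variable {N} in
/-- The matrix element `u^i_j`. -/
noncomputable def ugen (i j : Fin N) : Oq 𝕜 q N := oqMk 𝕜 q N (fu 𝕜 i j)

/-- The generator `x_i` in the free algebra. -/
def fx {N : ℕ} (i : Fin N) : FreeAlgebra 𝕜 (Fin N) := FreeAlgebra.ι 𝕜 i

/-- The defining relations of the quantum Euclidean sphere. -/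
inductive SphereRel : FreeAlgebra 𝕜 (Fin N) → FreeAlgebra 𝕜 (Fin N) → Prop
  | comm (i j : Fin N) : SphereRel
      (∑ k, ∑ l, ((Rinv q k l i j : ℝ) : 𝕜) • (fx 𝕜 k * fx 𝕜 l))
      (((q⁻¹ : ℝ) : 𝕜) • (fx 𝕜 i * fx 𝕜 j)
        + (((q ^ ((N : ℤ) - 1) - q ^ ((N : ℤ) - 3)) / (1 + q ^ ((N : ℤ) - 2)) : ℝ) : 𝕜) •
          ∑ k, ∑ l, ((Kmat q k l i j : ℝ) : 𝕜) • (fx 𝕜 k * fx 𝕜 l))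
  | sphere : SphereRel
      (∑ k, ∑ l, ((metric q k l : ℝ) : 𝕜) • (fx 𝕜 k * fx 𝕜 l)) 1

/-- The coordinate algebra `X` of the quantum Euclidean sphere. -/
def Sphere : Type _ := RingQuot (SphereRel 𝕜 q N)

noncomputable instance : Ring (Sphere 𝕜 q N) :=
  inferInstanceAs (Ring (RingQuot (SphereRel 𝕜 q N)))

noncomputable instance : Algebra 𝕜 (Sphere 𝕜 q N) :=
  inferInstanceAs (Algebra 𝕜 (RingQuot (SphereRel 𝕜 q N)))

/-- The quotient map onto `X`. -/
noncomputable def sphereMk : FreeAlgebra 𝕜 (Fin N) →ₐ[𝕜] Sphere 𝕜 q N :=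
  RingQuot.mkAlgHom 𝕜 (SphereRel 𝕜 q N)

variable {N}

/-- The generator `x_i` of `X`. -/
noncomputable def xgen (i : Fin N) : Sphere 𝕜 q N := sphereMk 𝕜 q N (fx 𝕜 i)

theorem oqMk_fu (i j : Fin N) : oqMk 𝕜 q N (fu 𝕜 i j) = ugen 𝕜 q i j := rfl

theorem sphereMk_fx (i : Fin N) : sphereMk 𝕜 q N (fx 𝕜 i) = xgen 𝕜 q i := rfl

theorem oqMk_rel {a b} (h : OqRel 𝕜 q N a b) : oqMk 𝕜 q N a = oqMk 𝕜 q N b :=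
  RingQuot.mkAlgHom_rel 𝕜 h

theorem sphereMk_rel {a b} (h : SphereRel 𝕜 q N a b) : sphereMk 𝕜 q N a = sphereMk 𝕜 q N b :=
  RingQuot.mkAlgHom_rel 𝕜 h

theorem oq_rtt (i j m n : Fin N) :
    ∑ k, ∑ l, ((Rmat q i j k l : ℝ) : 𝕜) • (ugen 𝕜 q k m * ugen 𝕜 q l n)
      = ∑ k, ∑ l, ((Rmat q k l m n : ℝ) : 𝕜) • (ugen 𝕜 q i k * ugen 𝕜 q j l) := by
  have h := oqMk_rel 𝕜 q (OqRel.rtt (𝕜 := 𝕜) (q := q) i j m n)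
  simpa only [map_sum, map_smul, map_mul, oqMk_fu, sphereMk_fx] using h

theorem oq_metric_upper (i j : Fin N) :
    ∑ k, ∑ l, ((metric q k l : ℝ) : 𝕜) • (ugen 𝕜 q i k * ugen 𝕜 q j l)
      = ((metric q i j : ℝ) : 𝕜) • (1 : Oq 𝕜 q N) := by
  have h := oqMk_rel 𝕜 q (OqRel.metric_upper (𝕜 := 𝕜) (q := q) i j)
  rw [AlgHom.commutes, Algebra.algebraMap_eq_smul_one] at h
  simpa only [map_sum, map_smul, map_mul, oqMk_fu, sphereMk_fx] using h

theorem oq_metric_lower (i j : Fin N) :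
    ∑ k, ∑ l, ((metric q k l : ℝ) : 𝕜) • (ugen 𝕜 q k i * ugen 𝕜 q l j)
      = ((metric q i j : ℝ) : 𝕜) • (1 : Oq 𝕜 q N) := by
  have h := oqMk_rel 𝕜 q (OqRel.metric_lower (𝕜 := 𝕜) (q := q) i j)
  rw [AlgHom.commutes, Algebra.algebraMap_eq_smul_one] at h
  simpa only [map_sum, map_smul, map_mul, oqMk_fu, sphereMk_fx] using h

theorem oq_K (i j m n : Fin N) :
    ∑ k, ∑ l, ((Kmat q i j k l : ℝ) : 𝕜) • (ugen 𝕜 q k m * ugen 𝕜 q l n)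
      = ∑ k, ∑ l, ((Kmat q k l m n : ℝ) : 𝕜) • (ugen 𝕜 q i k * ugen 𝕜 q j l) := by
  have h1 := congrArg (fun t => ((metric q i j : ℝ) : 𝕜) • t) (oq_metric_lower 𝕜 q m n)
  have h2 := congrArg (fun t => ((metric q m n : ℝ) : 𝕜) • t) (oq_metric_upper 𝕜 q i j)
  simp only [Finset.smul_sum, smul_smul] at h1 h2
  simp only [Kmat, RCLike.ofReal_mul]
  rw [h2]
  simp only [mul_comm _ ((metric q i j : ℝ) : 𝕜)] at h1 ⊢
  exact h1

theorem oq_I (i j m n : Fin N) :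
    ∑ k, ∑ l, ((Imat i j k l : ℝ) : 𝕜) • (ugen 𝕜 q k m * ugen 𝕜 q l n)
      = ∑ k, ∑ l, ((Imat k l m n : ℝ) : 𝕜) • (ugen 𝕜 q i k * ugen 𝕜 q j l) := by
  simp [Imat, ite_and, apply_ite, ite_smul]

theorem oq_Rinv (i j m n : Fin N) :
    ∑ k, ∑ l, ((Rinv q i j k l : ℝ) : 𝕜) • (ugen 𝕜 q k m * ugen 𝕜 q l n)
      = ∑ k, ∑ l, ((Rinv q k l m n : ℝ) : 𝕜) • (ugen 𝕜 q i k * ugen 𝕜 q j l) := by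
  simp only [Rinv, RCLike.ofReal_add, RCLike.ofReal_sub, RCLike.ofReal_mul, add_smul, sub_smul,
    mul_smul, Finset.sum_add_distrib, Finset.sum_sub_distrib, ← Finset.smul_sum,
    oq_rtt, oq_K, oq_I]

theorem sphere_comm (i j : Fin N) :
    ∑ k, ∑ l, ((Rinv q k l i j : ℝ) : 𝕜) • (xgen 𝕜 q k * xgen 𝕜 q l)
      = ((q⁻¹ : ℝ) : 𝕜) • (xgen 𝕜 q i * xgen 𝕜 q j)
        + (((q ^ ((N : ℤ) - 1) - q ^ ((N : ℤ) - 3)) / (1 + q ^ ((N : ℤ) - 2)) : ℝ) : 𝕜) •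
          ∑ k, ∑ l, ((Kmat q k l i j : ℝ) : 𝕜) • (xgen 𝕜 q k * xgen 𝕜 q l) := by
  have h := sphereMk_rel 𝕜 q (SphereRel.comm (𝕜 := 𝕜) (q := q) i j)
  simpa only [map_sum, map_smul, map_mul, oqMk_fu, sphereMk_fx, map_add] using h

theorem sphere_sphere :
    ∑ k, ∑ l, ((metric q k l : ℝ) : 𝕜) • (xgen 𝕜 q k * xgen 𝕜 q l) = (1 : Sphere 𝕜 q N) := by
  have h := sphereMk_rel 𝕜 q (SphereRel.sphere (𝕜 := 𝕜) (q := q) (N := N))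
  simpa only [map_sum, map_smul, map_mul, oqMk_fu, sphereMk_fx, map_one] using h

theorem sum_comm₄ {V : Type*} [AddCommMonoid V] (f : Fin N → Fin N → Fin N → Fin N → V) :
    ∑ k, ∑ l, ∑ a, ∑ b, f k l a b = ∑ a, ∑ b, ∑ k, ∑ l, f k l a b := by
  calc ∑ k, ∑ l, ∑ a, ∑ b, f k l a b
      = ∑ p : Fin N × Fin N, ∑ r : Fin N × Fin N, f p.1 p.2 r.1 r.2 := by
        simp only [Fintype.sum_prod_type]
    _ = ∑ r : Fin N × Fin N, ∑ p : Fin N × Fin N, f p.1 p.2 r.1 r.2 := Finset.sum_comm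
    _ = _ := by simp only [Fintype.sum_prod_type]

/-- Moving an intertwining tensor through a corepresentation matrix. -/
theorem sum_intertwine {V : Type*} [AddCommGroup V] [Module 𝕜 V]
    (T : Fin N → Fin N → Fin N → Fin N → 𝕜)
    (hT : ∀ i j m n, ∑ k, ∑ l, T i j k l • (ugen 𝕜 q k m * ugen 𝕜 q l n)
      = ∑ k, ∑ l, T k l m n • (ugen 𝕜 q i k * ugen 𝕜 q j l))
    (v : Fin N → Fin N → V) (m n : Fin N) :
    ∑ k, ∑ l, T k l m n • ∑ a, ∑ b, v a b ⊗ₜ[𝕜] (ugen 𝕜 q a k * ugen 𝕜 q b l)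
      = ∑ k, ∑ l, (∑ a, ∑ b, T a b k l • v a b) ⊗ₜ[𝕜] (ugen 𝕜 q k m * ugen 𝕜 q l n) := by
  simp only [Finset.smul_sum, TensorProduct.sum_tmul]
  rw [sum_comm₄, sum_comm₄ (fun k l a b => (T a b k l • v a b) ⊗ₜ[𝕜] _)]
  refine Finset.sum_congr rfl fun a _ => Finset.sum_congr rfl fun b _ => ?_
  simp only [← TensorProduct.tmul_smul, TensorProduct.smul_tmul, ← TensorProduct.tmul_sum]
  rw [hT]

theorem sum_metric {V : Type*} [AddCommGroup V] [Module 𝕜 V] (v : Fin N → Fin N → V) :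
    ∑ k, ∑ l, ((metric q k l : ℝ) : 𝕜) • ∑ a, ∑ b, v a b ⊗ₜ[𝕜] (ugen 𝕜 q a k * ugen 𝕜 q b l)
      = (∑ a, ∑ b, ((metric q a b : ℝ) : 𝕜) • v a b) ⊗ₜ[𝕜] (1 : Oq 𝕜 q N) := by
  simp only [Finset.smul_sum, TensorProduct.sum_tmul]
  rw [sum_comm₄]
  refine Finset.sum_congr rfl fun a _ => Finset.sum_congr rfl fun b _ => ?_
  simp only [← TensorProduct.tmul_smul, TensorProduct.smul_tmul, ← TensorProduct.tmul_sum]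
  rw [oq_metric_upper]

/-- `x_k ↦ x_i ⊗ u^i_k` on the free algebra. -/
noncomputable def preCoactX : FreeAlgebra 𝕜 (Fin N) →ₐ[𝕜] Sphere 𝕜 q N ⊗[𝕜] Oq 𝕜 q N :=
  FreeAlgebra.lift 𝕜 fun k => ∑ i, xgen 𝕜 q i ⊗ₜ[𝕜] ugen 𝕜 q i k

theorem preCoactX_mul (k l : Fin N) : preCoactX 𝕜 q (fx 𝕜 k * fx 𝕜 l)
    = ∑ a, ∑ b, (xgen 𝕜 q a * xgen 𝕜 q b) ⊗ₜ[𝕜] (ugen 𝕜 q a k * ugen 𝕜 q b l) := by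
  rw [map_mul, preCoactX, fx, fx, FreeAlgebra.lift_ι_apply, FreeAlgebra.lift_ι_apply,
    Finset.sum_mul_sum]
  simp only [Algebra.TensorProduct.tmul_mul_tmul]

theorem preCoactX_rel {a b} (h : SphereRel 𝕜 q N a b) :
    preCoactX 𝕜 q a = preCoactX 𝕜 q b := by
  cases h with
  | comm i j =>
    simp only [map_sum, map_smul, map_add, preCoactX_mul]
    rw [sum_intertwine 𝕜 q (fun k l i j => ((Rinv q k l i j : ℝ) : 𝕜)) (oq_Rinv 𝕜 q),
      sum_intertwine 𝕜 q (fun k l i j => ((Kmat q k l i j : ℝ) : 𝕜)) (oq_K 𝕜 q)]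
    simp only [sphere_comm, TensorProduct.add_tmul, Finset.sum_add_distrib, Finset.smul_sum,
      TensorProduct.smul_tmul']
  | sphere =>
    simp only [map_sum, map_smul, map_one, preCoactX_mul]
    rw [sum_metric, sphere_sphere, Algebra.TensorProduct.one_def]

/-- The coaction `Δ_R : X → X ⊗ O_q(N)`, `x_k ↦ x_i ⊗ u^i_k`, an algebra homomorphism. -/
noncomputable def coactX : Sphere 𝕜 q N →ₐ[𝕜] Sphere 𝕜 q N ⊗[𝕜] Oq 𝕜 q N :=
  RingQuot.liftAlgHom 𝕜 ⟨preCoactX 𝕜 q, fun _ _ h => preCoactX_rel 𝕜 q h⟩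

theorem coactX_x (k : Fin N) : coactX 𝕜 q (xgen 𝕜 q k) = ∑ i, xgen 𝕜 q i ⊗ₜ[𝕜] ugen 𝕜 q i k := by
  have h : coactX 𝕜 q (xgen 𝕜 q k) = preCoactX 𝕜 q (fx 𝕜 k) :=
    RingQuot.liftAlgHom_mkAlgHom_apply _ _ _ _
  rw [h, preCoactX, fx, FreeAlgebra.lift_ι_apply]

end Algebras

/-! ### The first order differential calculus `Γ₊` -/

section Calculus

variable (𝕜 : Type*) [RCLike 𝕜] (q : ℝ) {N : ℕ}

/-- For a map `δ : X → M` to a bimodule: the difference of the two sides of the relation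
`δx_i x_j = R⁻¹^{kl}_{ij} x_k δx_l + (q - 1) x_i δx_j
  + (q^N - q^{N-2}) / (1 - q^{N-1}) K^{kl}_{ij} x_k δx_l
  + (1 - q) (1 + q^{N-2}) / (1 - q^{N-1}) C^{kl} x_i x_j x_k δx_l`. -/
noncomputable def plusDefect {M : Type*} [AddCommGroup M] [Module 𝕜 M]
    [Module (Env 𝕜 (Sphere 𝕜 q N)) M] (δ : Sphere 𝕜 q N → M) (i j : Fin N) : M :=
  rmul 𝕜 (δ (xgen 𝕜 q i)) (xgen 𝕜 q j)
  - (∑ k, ∑ l, ((Rinv q k l i j : ℝ) : 𝕜) • lmul 𝕜 (xgen 𝕜 q k) (δ (xgen 𝕜 q l))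
    + ((q - 1 : ℝ) : 𝕜) • lmul 𝕜 (xgen 𝕜 q i) (δ (xgen 𝕜 q j))
    + (((q ^ (N : ℤ) - q ^ ((N : ℤ) - 2)) / (1 - q ^ ((N : ℤ) - 1)) : ℝ) : 𝕜) •
      ∑ k, ∑ l, ((Kmat q k l i j : ℝ) : 𝕜) • lmul 𝕜 (xgen 𝕜 q k) (δ (xgen 𝕜 q l))
    + (((1 - q) * (1 + q ^ ((N : ℤ) - 2)) / (1 - q ^ ((N : ℤ) - 1)) : ℝ) : 𝕜) •
      ∑ k, ∑ l, ((metric q k l : ℝ) : 𝕜) •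
        lmul 𝕜 (xgen 𝕜 q i * xgen 𝕜 q j * xgen 𝕜 q k) (δ (xgen 𝕜 q l)))

variable (N) in
/-- The free bimodule generated by symbols `dy` depending linearly on `y ∈ X`. -/
def FreeForms : Type _ := Env 𝕜 (Sphere 𝕜 q N) ⊗[𝕜] Sphere 𝕜 q N

noncomputable instance : AddCommGroup (FreeForms 𝕜 q N) :=
  inferInstanceAs (AddCommGroup (Env 𝕜 (Sphere 𝕜 q N) ⊗[𝕜] Sphere 𝕜 q N))

noncomputable instance : Module (Env 𝕜 (Sphere 𝕜 q N)) (FreeForms 𝕜 q N) :=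
  inferInstanceAs (Module (Env 𝕜 (Sphere 𝕜 q N)) (Env 𝕜 (Sphere 𝕜 q N) ⊗[𝕜] Sphere 𝕜 q N))

noncomputable instance : Module 𝕜 (FreeForms 𝕜 q N) :=
  inferInstanceAs (Module 𝕜 (Env 𝕜 (Sphere 𝕜 q N) ⊗[𝕜] Sphere 𝕜 q N))

instance : IsScalarTower 𝕜 (Env 𝕜 (Sphere 𝕜 q N)) (FreeForms 𝕜 q N) :=
  inferInstanceAs (IsScalarTower 𝕜 (Env 𝕜 (Sphere 𝕜 q N))
    (Env 𝕜 (Sphere 𝕜 q N) ⊗[𝕜] Sphere 𝕜 q N))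

variable (N) in
/-- The linear map `y ↦ dy` into the free bimodule. -/
noncomputable def fdLin : Sphere 𝕜 q N →ₗ[𝕜] FreeForms 𝕜 q N :=
  TensorProduct.mk 𝕜 (Env 𝕜 (Sphere 𝕜 q N)) (Sphere 𝕜 q N) 1

/-- The symbol `dy`. -/
noncomputable def fd (y : Sphere 𝕜 q N) : FreeForms 𝕜 q N := fdLin 𝕜 q N y

variable (N) in
/-- The defining relations of `Γ₊`: the Leibniz rule and the commutation rule between
the differentials `dx_i` and the generators `x_j`. -/
def gammaRel : Set (FreeForms 𝕜 q N) :=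
  {t | ∃ y z : Sphere 𝕜 q N, t = fd 𝕜 q (y * z) - (rmul 𝕜 (fd 𝕜 q y) z + lmul 𝕜 y (fd 𝕜 q z))}
  ∪ {t | ∃ i j : Fin N, t = plusDefect 𝕜 q (fd 𝕜 q) i j}

variable (N) in
/-- The bimodule `Γ₊` of one-forms. -/
def Gam : Type _ := FreeForms 𝕜 q N ⧸ Submodule.span (Env 𝕜 (Sphere 𝕜 q N)) (gammaRel 𝕜 q N)

noncomputable instance : AddCommGroup (Gam 𝕜 q N) :=
  inferInstanceAs (AddCommGroup (_ ⧸ Submodule.span (Env 𝕜 (Sphere 𝕜 q N)) (gammaRel 𝕜 q N)))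

noncomputable instance : Module (Env 𝕜 (Sphere 𝕜 q N)) (Gam 𝕜 q N) :=
  inferInstanceAs (Module (Env 𝕜 (Sphere 𝕜 q N))
    (_ ⧸ Submodule.span (Env 𝕜 (Sphere 𝕜 q N)) (gammaRel 𝕜 q N)))

noncomputable instance : Module 𝕜 (Gam 𝕜 q N) :=
  inferInstanceAs (Module 𝕜 (_ ⧸ Submodule.span (Env 𝕜 (Sphere 𝕜 q N)) (gammaRel 𝕜 q N)))

instance : IsScalarTower 𝕜 (Env 𝕜 (Sphere 𝕜 q N)) (Gam 𝕜 q N) :=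
  inferInstanceAs (IsScalarTower 𝕜 (Env 𝕜 (Sphere 𝕜 q N))
    (_ ⧸ Submodule.span (Env 𝕜 (Sphere 𝕜 q N)) (gammaRel 𝕜 q N)))

variable (N) in
/-- The quotient map onto `Γ₊`. -/
noncomputable def gamMk : FreeForms 𝕜 q N →ₗ[Env 𝕜 (Sphere 𝕜 q N)] Gam 𝕜 q N :=
  Submodule.mkQ _

variable (N) in
/-- The differentiation map `d : X → Γ₊`. -/
noncomputable def dif : Sphere 𝕜 q N →ₗ[𝕜] Gam 𝕜 q N :=
  ((gamMk 𝕜 q N).restrictScalars 𝕜).comp (fdLin 𝕜 q N)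

theorem gamMk_fd (y : Sphere 𝕜 q N) : gamMk 𝕜 q N (fd 𝕜 q y) = dif 𝕜 q N y := rfl

theorem gamMk_lmul (y : Sphere 𝕜 q N) (t) :
    gamMk 𝕜 q N (lmul 𝕜 y t) = lmul 𝕜 y (gamMk 𝕜 q N t) := map_smul _ _ _

theorem gamMk_rmul (y : Sphere 𝕜 q N) (t) :
    gamMk 𝕜 q N (rmul 𝕜 t y) = rmul 𝕜 (gamMk 𝕜 q N t) y := map_smul _ _ _

theorem gamMk_smul (c : 𝕜) (t) : gamMk 𝕜 q N (c • t) = c • gamMk 𝕜 q N t :=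
  ((gamMk 𝕜 q N).restrictScalars 𝕜).map_smul c t

theorem gamMk_rel {t} (ht : t ∈ gammaRel 𝕜 q N) : gamMk 𝕜 q N t = 0 :=
  (Submodule.Quotient.mk_eq_zero _).2 (Submodule.subset_span ht)

/-- The Leibniz rule. -/
theorem dif_mul (y z : Sphere 𝕜 q N) :
    dif 𝕜 q N (y * z) = rmul 𝕜 (dif 𝕜 q N y) z + lmul 𝕜 y (dif 𝕜 q N z) := by
  have h := gamMk_rel 𝕜 q (Or.inl ⟨y, z, rfl⟩)
  rwa [map_sub, map_add, gamMk_fd, gamMk_rmul, gamMk_lmul, gamMk_fd, gamMk_fd, sub_eq_zero] at h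

/-- The commutation rule between one-forms `dx_i` and generators `x_j` in `Γ₊`. -/
theorem plusDefect_dif (i j : Fin N) : plusDefect 𝕜 q (dif 𝕜 q N) i j = 0 := by
  have h := gamMk_rel 𝕜 q (Or.inr ⟨i, j, rfl⟩)
  simpa only [plusDefect, map_sub, map_add, map_sum, gamMk_smul, gamMk_fd, gamMk_rmul,
    gamMk_lmul] using h

variable (N) in
/-- The invariant one-form `η = C^{kl} x_k dx_l`. -/
noncomputable def eta : Gam 𝕜 q N :=
  ∑ k, ∑ l, ((metric q k l : ℝ) : 𝕜) • lmul 𝕜 (xgen 𝕜 q k) (dif 𝕜 q N (xgen 𝕜 q l))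

/-- `γ⁺_i = dx_i - (1 + q^{N-2}) / (1 - q^{N-1}) x_i η`. -/
noncomputable def gammaPlus (i : Fin N) : Gam 𝕜 q N :=
  dif 𝕜 q N (xgen 𝕜 q i)
    + ((-((1 + q ^ ((N : ℤ) - 2)) / (1 - q ^ ((N : ℤ) - 1))) : ℝ) : 𝕜) •
      lmul 𝕜 (xgen 𝕜 q i) (eta 𝕜 q N)

/-- `γ⁻_i = dx_i + q (1 + q^{N-2}) / (1 - q^{N-1}) x_i η`. -/
noncomputable def gammaMinus (i : Fin N) : Gam 𝕜 q N :=
  dif 𝕜 q N (xgen 𝕜 q i)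
    + ((q * ((1 + q ^ ((N : ℤ) - 2)) / (1 - q ^ ((N : ℤ) - 1))) : ℝ) : 𝕜) •
      lmul 𝕜 (xgen 𝕜 q i) (eta 𝕜 q N)

end Calculus

/-! ### Coactions -/

section Coactions

variable (𝕜 : Type*) [RCLike 𝕜] (q : ℝ) {N : ℕ}

section General

variable (M : Type*) [AddCommGroup M] [Module 𝕜 M] [Module (Env 𝕜 (Sphere 𝕜 q N)) M]
  [IsScalarTower 𝕜 (Env 𝕜 (Sphere 𝕜 q N)) M]

/-- The left product of `X ⊗ O_q(N)` on `M ⊗ O_q(N)`: `(y ⊗ a) (m ⊗ b) = y m ⊗ a b`. -/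
noncomputable def coLeft :
    Sphere 𝕜 q N ⊗[𝕜] Oq 𝕜 q N →ₐ[𝕜] Module.End 𝕜 (M ⊗[𝕜] Oq 𝕜 q N) :=
  Algebra.TensorProduct.lift
    ((Module.End.rTensorAlgHom 𝕜 M (Oq 𝕜 q N)).comp (lact 𝕜 (Sphere 𝕜 q N) M))
    ((Module.End.lTensorAlgHom 𝕜 (Oq 𝕜 q N) M).comp (Algebra.lmul 𝕜 (Oq 𝕜 q N)))
    (fun _ _ => (commute_iff_eq _ _).2 (TensorProduct.ext' fun _ _ => rfl))

/-- The right product of `X ⊗ O_q(N)` on `M ⊗ O_q(N)`: `(m ⊗ b) (y ⊗ a) = m y ⊗ b a`. -/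
noncomputable def coRight :
    (Sphere 𝕜 q N ⊗[𝕜] Oq 𝕜 q N)ᵐᵒᵖ →ₐ[𝕜] Module.End 𝕜 (M ⊗[𝕜] Oq 𝕜 q N) :=
  (Algebra.TensorProduct.lift
    ((Module.End.rTensorAlgHom 𝕜 M (Oq 𝕜 q N)).comp (ract 𝕜 (Sphere 𝕜 q N) M))
    ((Module.End.lTensorAlgHom 𝕜 (Oq 𝕜 q N) M).comp
      (Algebra.lsmul 𝕜 𝕜 (Oq 𝕜 q N) : (Oq 𝕜 q N)ᵐᵒᵖ →ₐ[𝕜] _))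
    (fun _ _ => (commute_iff_eq _ _).2 (TensorProduct.ext' fun _ _ => rfl))).comp
  (Algebra.TensorProduct.opAlgEquiv 𝕜 𝕜 (Sphere 𝕜 q N) (Oq 𝕜 q N)).symm.toAlgHom

variable {M}

theorem coLeft_tmul (y : Sphere 𝕜 q N) (a b : Oq 𝕜 q N) (m : M) :
    coLeft 𝕜 q M (y ⊗ₜ a) (m ⊗ₜ b) = lmul 𝕜 y m ⊗ₜ (a * b) := by
  rw [coLeft, Algebra.TensorProduct.lift_tmul]
  rfl

theorem coRight_tmul (y : Sphere 𝕜 q N) (a b : Oq 𝕜 q N) (m : M) :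
    coRight 𝕜 q M (MulOpposite.op (y ⊗ₜ a)) (m ⊗ₜ b) = rmul 𝕜 m y ⊗ₜ (b * a) := by
  have h : coRight 𝕜 q M (MulOpposite.op (y ⊗ₜ a)) =
    Algebra.TensorProduct.lift
    ((Module.End.rTensorAlgHom 𝕜 M (Oq 𝕜 q N)).comp (ract 𝕜 (Sphere 𝕜 q N) M))
    ((Module.End.lTensorAlgHom 𝕜 (Oq 𝕜 q N) M).comp
      (Algebra.lsmul 𝕜 𝕜 (Oq 𝕜 q N) : (Oq 𝕜 q N)ᵐᵒᵖ →ₐ[𝕜] _))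
    (fun _ _ => (commute_iff_eq _ _).2 (TensorProduct.ext' fun _ _ => rfl))
      (MulOpposite.op y ⊗ₜ MulOpposite.op a) := rfl
  rw [h, Algebra.TensorProduct.lift_tmul]
  rfl

variable (M) in
theorem coLeft_coRight_commute (s t : Sphere 𝕜 q N ⊗[𝕜] Oq 𝕜 q N) :
    Commute (coLeft 𝕜 q M s) (coRight 𝕜 q M (MulOpposite.op t)) := by
  induction s using TensorProduct.induction_on with
  | zero => rw [map_zero]; exact Commute.zero_left _
  | add s s' hs hs' => rw [map_add]; exact hs.add_left hs'
  | tmul y a =>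
    induction t using TensorProduct.induction_on with
    | zero => rw [MulOpposite.op_zero, map_zero]; exact Commute.zero_right _
    | add t t' ht ht' => rw [MulOpposite.op_add, map_add]; exact ht.add_right ht'
    | tmul z b =>
      refine (commute_iff_eq _ _).2 (TensorProduct.ext' fun m c => ?_)
      rw [Module.End.mul_apply, Module.End.mul_apply, coRight_tmul, coLeft_tmul, coLeft_tmul,
        coRight_tmul, lmul_rmul, mul_assoc]

variable (M) in
theorem coEnv_commute (y : Sphere 𝕜 q N) (z : (Sphere 𝕜 q N)ᵐᵒᵖ) :
    Commute (((coLeft 𝕜 q M).comp (coactX 𝕜 q)) y)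
      (((coRight 𝕜 q M).comp (AlgHom.op (coactX 𝕜 q))) z) :=
  coLeft_coRight_commute 𝕜 q M (coactX 𝕜 q y) (coactX 𝕜 q z.unop)

variable (M) in
/-- `M ⊗ O_q(N)` as an `X`-bimodule through `Δ_R`: `y ω z = Δ_R(y) ω Δ_R(z)`. -/
noncomputable def coEnv : Env 𝕜 (Sphere 𝕜 q N) →ₐ[𝕜] Module.End 𝕜 (M ⊗[𝕜] Oq 𝕜 q N) :=
  Algebra.TensorProduct.lift
    ((coLeft 𝕜 q M).comp (coactX 𝕜 q))
    ((coRight 𝕜 q M).comp (AlgHom.op (coactX 𝕜 q)))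
    (coEnv_commute 𝕜 q M)

theorem coEnv_left (y : Sphere 𝕜 q N) (t : M ⊗[𝕜] Oq 𝕜 q N) :
    coEnv 𝕜 q M (y ⊗ₜ 1) t = coLeft 𝕜 q M (coactX 𝕜 q y) t := by
  rw [coEnv, Algebra.TensorProduct.lift_tmul, map_one, mul_one]
  rfl

theorem coEnv_right (y : Sphere 𝕜 q N) (t : M ⊗[𝕜] Oq 𝕜 q N) :
    coEnv 𝕜 q M (1 ⊗ₜ MulOpposite.op y) t
      = coRight 𝕜 q M (MulOpposite.op (coactX 𝕜 q y)) t := by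
  rw [coEnv, Algebra.TensorProduct.lift_tmul, map_one, one_mul]
  rfl

end General

variable (N) in
/-- `y ↦ (d ⊗ id) (Δ_R y)`. -/
noncomputable def dcoact : Sphere 𝕜 q N →ₗ[𝕜] Gam 𝕜 q N ⊗[𝕜] Oq 𝕜 q N :=
  ((dif 𝕜 q N).rTensor (Oq 𝕜 q N)).comp (coactX 𝕜 q).toLinearMap

theorem dcoact_x (k : Fin N) : dcoact 𝕜 q N (xgen 𝕜 q k)
    = ∑ i, dif 𝕜 q N (xgen 𝕜 q i) ⊗ₜ ugen 𝕜 q i k := by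
  rw [dcoact, LinearMap.comp_apply, AlgHom.toLinearMap_apply, coactX_x, map_sum]
  rfl

theorem rTensor_dif_mul (s t : Sphere 𝕜 q N ⊗[𝕜] Oq 𝕜 q N) :
    (dif 𝕜 q N).rTensor (Oq 𝕜 q N) (s * t)
      = coRight 𝕜 q _ (MulOpposite.op t) ((dif 𝕜 q N).rTensor (Oq 𝕜 q N) s)
        + coLeft 𝕜 q _ s ((dif 𝕜 q N).rTensor (Oq 𝕜 q N) t) := by
  induction s using TensorProduct.induction_on with
  | zero => simp
  | add s s' hs hs' =>
    rw [add_mul, map_add, map_add, map_add, map_add, LinearMap.add_apply, hs, hs']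
    abel
  | tmul y a =>
    induction t using TensorProduct.induction_on with
    | zero => simp
    | add t t' ht ht' =>
      rw [mul_add, map_add, map_add, map_add, MulOpposite.op_add, map_add, LinearMap.add_apply,
        ht, ht']
      abel
    | tmul z b =>
      rw [Algebra.TensorProduct.tmul_mul_tmul, LinearMap.rTensor_tmul, LinearMap.rTensor_tmul,
        LinearMap.rTensor_tmul, coRight_tmul, coLeft_tmul, dif_mul, TensorProduct.add_tmul]

variable (N) in
/-- `y dz w ↦ Δ_R(y) (d ⊗ id)(Δ_R z) Δ_R(w)` on the free bimodule. -/
noncomputable def preCoact : FreeForms 𝕜 q N →ₗ[𝕜] Gam 𝕜 q N ⊗[𝕜] Oq 𝕜 q N :=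
  TensorProduct.lift
    ((LinearMap.lcomp 𝕜 (Gam 𝕜 q N ⊗[𝕜] Oq 𝕜 q N) (dcoact 𝕜 q N)).comp
      (coEnv 𝕜 q (Gam 𝕜 q N)).toLinearMap)

theorem freeForms_induction {p : FreeForms 𝕜 q N → Prop} (h0 : p 0)
    (h1 : ∀ (f : Env 𝕜 (Sphere 𝕜 q N)) (y : Sphere 𝕜 q N), p (f • fd 𝕜 q y))
    (h2 : ∀ s t, p s → p t → p (s + t)) (t : FreeForms 𝕜 q N) : p t := by
  induction t using TensorProduct.induction_on with
  | zero => exact h0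
  | tmul f y =>
    have h : f • fd 𝕜 q y = (f * 1) ⊗ₜ[𝕜] y := rfl
    rw [mul_one] at h
    exact h ▸ h1 f y
  | add s t hs ht => exact h2 s t hs ht

theorem preCoact_smul_fd (f : Env 𝕜 (Sphere 𝕜 q N)) (y : Sphere 𝕜 q N) :
    preCoact 𝕜 q N (f • fd 𝕜 q y) = coEnv 𝕜 q _ f (dcoact 𝕜 q N y) := by
  change coEnv 𝕜 q _ (f * 1) (dcoact 𝕜 q N y) = _
  rw [mul_one]

theorem preCoact_smul (e : Env 𝕜 (Sphere 𝕜 q N)) (t : FreeForms 𝕜 q N) :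
    preCoact 𝕜 q N (e • t) = coEnv 𝕜 q _ e (preCoact 𝕜 q N t) := by
  induction t using freeForms_induction with
  | h0 => rw [smul_zero, map_zero, map_zero]
  | h1 f y => rw [smul_smul, preCoact_smul_fd, preCoact_smul_fd, map_mul, Module.End.mul_apply]
  | h2 s t hs ht => rw [smul_add, map_add, map_add, map_add, hs, ht]

theorem preCoact_fd (y : Sphere 𝕜 q N) : preCoact 𝕜 q N (fd 𝕜 q y) = dcoact 𝕜 q N y := by
  change coEnv 𝕜 q _ 1 (dcoact 𝕜 q N y) = _
  rw [map_one]
  rfl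

theorem preCoact_lmul (y : Sphere 𝕜 q N) (t : FreeForms 𝕜 q N) :
    preCoact 𝕜 q N (lmul 𝕜 y t) = coLeft 𝕜 q _ (coactX 𝕜 q y) (preCoact 𝕜 q N t) := by
  rw [lmul, preCoact_smul, coEnv_left]

theorem preCoact_rmul (y : Sphere 𝕜 q N) (t : FreeForms 𝕜 q N) :
    preCoact 𝕜 q N (rmul 𝕜 t y)
      = coRight 𝕜 q _ (MulOpposite.op (coactX 𝕜 q y)) (preCoact 𝕜 q N t) := by
  rw [rmul, preCoact_smul, coEnv_right]

theorem preCoact_lmul_fd (k l : Fin N) :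
    preCoact 𝕜 q N (lmul 𝕜 (xgen 𝕜 q k) (fd 𝕜 q (xgen 𝕜 q l)))
      = ∑ a, ∑ b, lmul 𝕜 (xgen 𝕜 q a) (dif 𝕜 q N (xgen 𝕜 q b)) ⊗ₜ[𝕜]
          (ugen 𝕜 q a k * ugen 𝕜 q b l) := by
  rw [preCoact_lmul, preCoact_fd, dcoact_x, coactX_x]
  simp only [map_sum, LinearMap.sum_apply, coLeft_tmul]
  exact Finset.sum_comm

theorem preCoact_rmul_fd (k l : Fin N) :
    preCoact 𝕜 q N (rmul 𝕜 (fd 𝕜 q (xgen 𝕜 q k)) (xgen 𝕜 q l))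
      = ∑ a, ∑ b, rmul 𝕜 (dif 𝕜 q N (xgen 𝕜 q a)) (xgen 𝕜 q b) ⊗ₜ[𝕜]
          (ugen 𝕜 q a k * ugen 𝕜 q b l) := by
  rw [preCoact_rmul, preCoact_fd, dcoact_x, coactX_x]
  simp only [Finset.op_sum, map_sum, LinearMap.sum_apply, coRight_tmul]

theorem preCoact_eta :
    preCoact 𝕜 q N (∑ k, ∑ l, ((metric q k l : ℝ) : 𝕜) •
        lmul 𝕜 (xgen 𝕜 q k) (fd 𝕜 q (xgen 𝕜 q l)))
      = eta 𝕜 q N ⊗ₜ 1 := by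
  simp only [map_sum, map_smul, preCoact_lmul_fd]
  rw [sum_metric]
  rfl

theorem lmul_sum_smul {M : Type*} [AddCommGroup M] [Module 𝕜 M]
    [Module (Env 𝕜 (Sphere 𝕜 q N)) M] [IsScalarTower 𝕜 (Env 𝕜 (Sphere 𝕜 q N)) M]
    (y : Sphere 𝕜 q N) (v : Fin N → Fin N → M) (c : Fin N → Fin N → 𝕜) :
    ∑ k, ∑ l, c k l • lmul 𝕜 y (v k l) = lmul 𝕜 y (∑ k, ∑ l, c k l • v k l) := by
  simp only [← lact_apply, map_sum, map_smul]

theorem preCoact_cubic (i j : Fin N) :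
    preCoact 𝕜 q N (∑ k, ∑ l, ((metric q k l : ℝ) : 𝕜) •
        lmul 𝕜 (xgen 𝕜 q i * xgen 𝕜 q j * xgen 𝕜 q k) (fd 𝕜 q (xgen 𝕜 q l)))
      = ∑ a, ∑ b, (∑ k, ∑ l, ((metric q k l : ℝ) : 𝕜) •
          lmul 𝕜 (xgen 𝕜 q a * xgen 𝕜 q b * xgen 𝕜 q k) (dif 𝕜 q N (xgen 𝕜 q l))) ⊗ₜ[𝕜]
            (ugen 𝕜 q a i * ugen 𝕜 q b j) := by
  simp only [← lmul_lmul 𝕜 (_ * _) (xgen 𝕜 q _), lmul_sum_smul]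
  rw [← lmul_lmul, preCoact_lmul, preCoact_lmul, preCoact_eta, coactX_x, coactX_x]
  simp only [map_sum, LinearMap.sum_apply, coLeft_tmul, lmul_lmul, mul_one]
  rw [Finset.sum_comm]
  rfl

theorem preCoact_plusDefect (i j : Fin N) :
    preCoact 𝕜 q N (plusDefect 𝕜 q (fd 𝕜 q) i j)
      = ∑ a, ∑ b, plusDefect 𝕜 q (dif 𝕜 q N) a b ⊗ₜ[𝕜] (ugen 𝕜 q a i * ugen 𝕜 q b j) := by
  rw [plusDefect, map_sub, map_add, map_add, map_add, map_smul, map_smul, map_smul,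
    preCoact_cubic, preCoact_rmul_fd, preCoact_lmul_fd]
  simp only [map_sum, map_smul, preCoact_lmul_fd]
  rw [sum_intertwine 𝕜 q (fun k l i j => ((Rinv q k l i j : ℝ) : 𝕜)) (oq_Rinv 𝕜 q),
    sum_intertwine 𝕜 q (fun k l i j => ((Kmat q k l i j : ℝ) : 𝕜)) (oq_K 𝕜 q)]
  simp only [plusDefect, TensorProduct.sub_tmul, TensorProduct.add_tmul,
    Finset.sum_add_distrib, Finset.sum_sub_distrib, Finset.smul_sum, TensorProduct.smul_tmul']

theorem preCoact_rel {t} (ht : t ∈ gammaRel 𝕜 q N) : preCoact 𝕜 q N t = 0 := by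
  rcases ht with ⟨y, z, rfl⟩ | ⟨i, j, rfl⟩
  · rw [map_sub, map_add, preCoact_rmul, preCoact_lmul, preCoact_fd, preCoact_fd, preCoact_fd,
      sub_eq_zero, dcoact, LinearMap.comp_apply, LinearMap.comp_apply, LinearMap.comp_apply,
      AlgHom.toLinearMap_apply, AlgHom.toLinearMap_apply, AlgHom.toLinearMap_apply, map_mul,
      rTensor_dif_mul]
  · rw [preCoact_plusDefect]
    simp only [plusDefect_dif, TensorProduct.zero_tmul, Finset.sum_const_zero]

theorem preCoact_span :
    (Submodule.span (Env 𝕜 (Sphere 𝕜 q N)) (gammaRel 𝕜 q N)).restrictScalars 𝕜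
      ≤ LinearMap.ker (preCoact 𝕜 q N) := by
  intro t ht
  rw [LinearMap.mem_ker]
  rw [Submodule.restrictScalars_mem] at ht
  induction ht using Submodule.span_induction with
  | mem t ht => exact preCoact_rel 𝕜 q ht
  | zero => exact map_zero _
  | add s t _ _ hs ht => rw [map_add, hs, ht, add_zero]
  | smul e t _ ht => rw [preCoact_smul, ht, map_zero]

variable (N) in
/-- The coaction `Φ_R : Γ₊ → Γ₊ ⊗ O_q(N)`. -/
noncomputable def coactGam : Gam 𝕜 q N →ₗ[𝕜] Gam 𝕜 q N ⊗[𝕜] Oq 𝕜 q N :=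
  (Submodule.liftQ _ (preCoact 𝕜 q N) (preCoact_span 𝕜 q)).comp
    (Submodule.Quotient.restrictScalarsEquiv 𝕜
      (Submodule.span (Env 𝕜 (Sphere 𝕜 q N)) (gammaRel 𝕜 q N))).symm.toLinearMap

theorem coactGam_gamMk (t : FreeForms 𝕜 q N) :
    coactGam 𝕜 q N (gamMk 𝕜 q N t) = preCoact 𝕜 q N t := rfl

/-- `Φ_R(dy) = (d ⊗ id)(Δ_R(y))`. -/
theorem coactGam_dif (y : Sphere 𝕜 q N) : coactGam 𝕜 q N (dif 𝕜 q N y)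
    = (dif 𝕜 q N).rTensor (Oq 𝕜 q N) (coactX 𝕜 q y) :=
  preCoact_fd 𝕜 q y

/-- `Φ_R(y ω) = Δ_R(y) Φ_R(ω)`. -/
theorem coactGam_lmul (y : Sphere 𝕜 q N) (w : Gam 𝕜 q N) :
    coactGam 𝕜 q N (lmul 𝕜 y w) = coLeft 𝕜 q _ (coactX 𝕜 q y) (coactGam 𝕜 q N w) := by
  obtain ⟨t, rfl⟩ := Submodule.Quotient.mk_surjective _ w
  exact preCoact_lmul 𝕜 q y t

/-- `Φ_R(ω y) = Φ_R(ω) Δ_R(y)`. -/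
theorem coactGam_rmul (y : Sphere 𝕜 q N) (w : Gam 𝕜 q N) :
    coactGam 𝕜 q N (rmul 𝕜 w y)
      = coRight 𝕜 q _ (MulOpposite.op (coactX 𝕜 q y)) (coactGam 𝕜 q N w) := by
  obtain ⟨t, rfl⟩ := Submodule.Quotient.mk_surjective _ w
  exact preCoact_rmul 𝕜 q y t

variable (N) in
/-- The tensor square `Γ₊ ⊗_X Γ₊`. -/
abbrev Gam₂ : Type _ := BTensor 𝕜 (Sphere 𝕜 q N) (Gam 𝕜 q N) (Gam 𝕜 q N)

variable (N) in
/-- The product `(ω ⊗ a) (η ⊗ b) = (ω ⊗_X η) ⊗ a b`. -/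
noncomputable def tmulO : Gam 𝕜 q N ⊗[𝕜] Oq 𝕜 q N →ₗ[𝕜] Gam 𝕜 q N ⊗[𝕜] Oq 𝕜 q N →ₗ[𝕜]
    Gam₂ 𝕜 q N ⊗[𝕜] Oq 𝕜 q N :=
  TensorProduct.map₂ (bmk 𝕜 (Sphere 𝕜 q N) (Gam 𝕜 q N) (Gam 𝕜 q N)) (LinearMap.mul 𝕜 (Oq 𝕜 q N))

theorem tmulO_tmul (v w : Gam 𝕜 q N) (a b : Oq 𝕜 q N) :
    tmulO 𝕜 q N (v ⊗ₜ a) (w ⊗ₜ b) = btmul 𝕜 (Sphere 𝕜 q N) v w ⊗ₜ (a * b) := rfl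

theorem tmulO_balanced (t : Sphere 𝕜 q N ⊗[𝕜] Oq 𝕜 q N) (v w : Gam 𝕜 q N ⊗[𝕜] Oq 𝕜 q N) :
    tmulO 𝕜 q N (coRight 𝕜 q _ (MulOpposite.op t) v) w = tmulO 𝕜 q N v (coLeft 𝕜 q _ t w) := by
  induction t using TensorProduct.induction_on with
  | zero => simp
  | add s t hs ht =>
    rw [MulOpposite.op_add, map_add, map_add, LinearMap.add_apply, LinearMap.add_apply, map_add,
      map_add, LinearMap.add_apply, hs, ht]
  | tmul y c =>
    induction v using TensorProduct.induction_on with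
    | zero => simp
    | add v v' hv hv' =>
      rw [map_add, map_add, map_add, LinearMap.add_apply, LinearMap.add_apply, hv, hv']
    | tmul v a =>
      induction w using TensorProduct.induction_on with
      | zero => simp
      | add w w' hw hw' => rw [map_add, map_add, map_add, hw, hw']
      | tmul w b =>
        rw [coRight_tmul, coLeft_tmul, tmulO_tmul, tmulO_tmul, rmul_btmul, mul_assoc]

variable (N) in
/-- The coaction `Φ_R ⊗ Φ_R : Γ₊ ⊗_X Γ₊ → (Γ₊ ⊗_X Γ₊) ⊗ O_q(N)`, where the two components in
`O_q(N)` are multiplied. -/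
noncomputable def coactGam₂ : Gam₂ 𝕜 q N →ₗ[𝕜] Gam₂ 𝕜 q N ⊗[𝕜] Oq 𝕜 q N :=
  blift 𝕜 ((tmulO 𝕜 q N).compl₁₂ (coactGam 𝕜 q N) (coactGam 𝕜 q N))
    (fun v y w => by
      rw [LinearMap.compl₁₂_apply, LinearMap.compl₁₂_apply, coactGam_rmul, coactGam_lmul,
        tmulO_balanced])

variable {𝕜 q} in
/-- A bimodule homomorphism `σ` of `Γ₊ ⊗_X Γ₊` is covariant if it intertwines the coaction. -/
def IsCovariant (σ : Gam₂ 𝕜 q N →ₗ[Env 𝕜 (Sphere 𝕜 q N)] Gam₂ 𝕜 q N) : Prop :=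
  coactGam₂ 𝕜 q N ∘ₗ σ.restrictScalars 𝕜
    = (σ.restrictScalars 𝕜).rTensor (Oq 𝕜 q N) ∘ₗ coactGam₂ 𝕜 q N

end Coactions

end QSphere

/-!
Throughout, a tensor of reals with four indices acts on index pairs of families of vectors, so that
tensor identities are identities between operators on functions of two or three indices.

**The R-matrix.** Everything rests on the braid relation for `R` (`Rop_braid`), on the skein
relation (`Rop_Rop`), which identifies `R⁻¹`, and on crossing symmetry (`Rmat_crossing`): rotating
`R` by means of the metric `C` gives `R⁻¹`, so that the metric and the contraction slide over a
strand. The proofs of the first two go from `N` to `N + 2`. If the first and the last index are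
added to the index set, then `R` on the middle indices is the old R-matrix up to one term with a
factor `C`, and on pairs with an outer index it is given by short explicit rules.

**The left basis.** Relations between one-forms are hard to exclude in `Γ₊`, which is given by
generators and relations, so `Γ₊` is mapped to a concrete bimodule. The free left module `X^N` with
basis `e_i` becomes an `X`-bimodule by `e_i x_j = R⁻¹^{kl}_{ij} x_k e_l`; compatibility with the
relations of `X` is the braid relation and the sliding rule (`preRightMatrix_rel`). For
`ω = C^{kl} x_k e_l` a multiple of the inner derivation of `ω` sends `x_i` to `e_i - μ x_i ω`
(`modelD_x`), and these elements satisfy the relations of `Γ₊` (`plusDefect_eq_zero`). This yields a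
bimodule map `toModel` from `Γ₊`. It sends `dx_i + s x_i η` to a combination of `e_i` and `x_i ω`,
which makes these forms left independent for `s ≠ -1` (`eq_zero_of_toModel`); they generate because
the `dx_i` do. In particular `toModel` is injective, and commutation rules may be checked in the
model: `γ⁻_i` is `e_i` and commutes with `X` through `R⁻¹`, while `γ⁺_i` is
`e_i - (1 + q^{N-2}) x_i ω` and commutes with `X` through `R` (`commRule_Rmat`).

**The braiding.** On a left basis the formula for `σ` defines a unique left linear map. Let `S` be
the matrix of the commutation rule, `R` or `R⁻¹`. Right linearity on `γ_i ⊗ γ_j` and a generator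
`x_m` is the identity `R⁻¹₁₂ S₂₃ S₁₂ = S₂₃ S₁₂ R⁻¹₂₃`, a consequence of the braid relation
(`twistMap_rmul`). Both sides of the covariance and of the braid relation for `σ` transform in the
same way under left multiplication, so they may be compared on the `γ_i`: there they say that `R⁻¹`
intertwines the tensor square of the fundamental corepresentation, and that `R⁻¹` satisfies the
braid relation.
-/

namespace QSphere

/-! ### The R-matrix acting on tensors -/

section RMatrixIdentities

variable {M : Type*} [AddCommGroup M] [Module ℝ M] {N : ℕ}

/-- The constants `q^{-ρ_i}`, the nonzero entries of the metric. -/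
noncomputable def cw (q : ℝ) {N : ℕ} (i : Fin N) : ℝ := q ^ (-rho i)

/-- The contraction `C^{kl} f_{kl}`. -/
noncomputable def contr (q : ℝ) (f : Fin N → Fin N → M) : M := ∑ k, cw q k • f k k.rev

/-- The R-matrix acting on the index pair of `f`: `(i, j) ↦ R^{kl}_{ij} f_{kl}`. -/
noncomputable def Rop (q : ℝ) (f : Fin N → Fin N → M) (i j : Fin N) : M :=
  ∑ k, ∑ l, Rmat q k l i j • f k l

/-- The inverse R-matrix acting on the index pair of `f`. -/
noncomputable def Sop (q : ℝ) (f : Fin N → Fin N → M) (i j : Fin N) : M :=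
  ∑ k, ∑ l, Rinv q k l i j • f k l

theorem rho_rev (i : Fin N) : rho i.rev = -rho i := by
  unfold rho
  rw [Fin.val_rev]
  have hi := i.2
  have hc : ((N - ((i : ℕ) + 1) : ℕ) : ℝ) = (N : ℝ) - ((i : ℕ) + 1) := by
    rw [Nat.cast_sub (by omega)]; push_cast; ring
  rw [hc]
  split_ifs <;> first | omega | ring

theorem cw_pos {q : ℝ} (hq : 0 < q) (i : Fin N) : 0 < cw q i := Real.rpow_pos_of_pos hq _

theorem cw_rev {q : ℝ} (hq : 0 < q) (i : Fin N) : cw q i.rev = (cw q i)⁻¹ := by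
  rw [cw, cw, rho_rev, Real.rpow_neg hq.le]

theorem eq_rev_comm (a b : Fin N) : (a = b.rev) = (b = a.rev) := by
  rw [eq_iff_iff]
  constructor <;> (rintro rfl; simp)

theorem metric_eq (q : ℝ) (i j : Fin N) : metric q i j = if j = i.rev then cw q i else 0 := by
  simp only [metric, cw, eq_rev_comm i j]

theorem sum_metric_smul (q : ℝ) (f : Fin N → Fin N → M) :
    ∑ k, ∑ l, metric q k l • f k l = contr q f := by
  simp [metric_eq, contr, ite_smul]

theorem Rop_apply (q : ℝ) (f : Fin N → Fin N → M) (i j : Fin N) :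
    Rop q f i j
      = q ^ ((if i = j then 1 else 0) - (if j = i.rev then 1 else 0) : ℤ) • f j i
        + (if i < j then (q - q⁻¹) • f i j else 0)
        - (if j = i.rev then ((q - q⁻¹) * cw q i) •
            ∑ l, (if i < l then cw q l.rev • f l.rev l else 0) else 0) := by
  unfold Rop
  simp only [Rmat, add_smul, Finset.sum_add_distrib]
  rw [add_sub_assoc]
  congr 1
  · simp [ite_and, ite_smul, eq_comm]
  · simp only [mul_ite, mul_zero, ite_smul, zero_smul, mul_sub, sub_smul]
    rw [Finset.sum_comm]
    have : ∀ l k : Fin N, (if i < l then ((q - q⁻¹) * Imat k l i j) • f k l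
          - ((q - q⁻¹) * Kmat q k l i j) • f k l else 0)
        = (if k = i then (if l = j then (if i < j then (q - q⁻¹) • f i j else 0) else 0) else 0)
          - (if k = l.rev then (if j = i.rev then ((q - q⁻¹) * cw q i) •
            (if i < l then cw q l.rev • f l.rev l else 0) else 0) else 0) := by
      intro l k
      unfold Imat Kmat
      rw [metric_eq q i j, metric_eq q k l]
      simp only [eq_rev_comm l k]
      by_cases h1 : k = l.rev <;> by_cases h2 : j = i.rev <;> by_cases h3 : k = i <;>
        by_cases h4 : l = j <;> by_cases h5 : i < l <;> simp [*, mul_assoc, smul_smul] <;> grind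
    simp only [this, Finset.sum_sub_distrib]
    congr 1
    · simp [sub_smul]
    · simp only [Finset.sum_ite_eq', Finset.mem_univ, if_true]
      split_ifs
      · rw [Finset.smul_sum]
      · simp

end RMatrixIdentities

/-! ### Removing the two outer indices -/

section RMatrixIdentities

variable {M : Type*} [AddCommGroup M] [Module ℝ M] {N : ℕ}

/-- The embedding of the index set `1, …, N` as `2, …, N + 1` into `1, …, N + 2`. It commutes with
`i ↦ i'` and preserves the constants `ρ_i`. -/
def mid (i : Fin N) : Fin (N + 2) := i.succ.castSucc

/-- The last index, `0' = top`. The index set consists of `0`, the middle indices `mid m` and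
`top`. -/
abbrev top : Fin (N + 2) := Fin.last (N + 1)

theorem sum_mid {V : Type*} [AddCommMonoid V] (f : Fin (N + 2) → V) :
    ∑ i, f i = f 0 + ∑ m : Fin N, f (mid m) + f top := by
  rw [Fin.sum_univ_castSucc, Fin.sum_univ_succ]; rfl

theorem mid_cases {p : Fin (N + 2) → Prop} (h0 : p 0) (hm : ∀ m, p (mid m)) (ht : p top)
    (i : Fin (N + 2)) : p i := by
  refine Fin.lastCases ht (fun i => ?_) i
  exact Fin.cases h0 hm i

theorem mid_rev (i : Fin N) : (mid i).rev = mid i.rev := by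
  ext; simp [mid]; omega

theorem rev_zero' : (0 : Fin (N + 2)).rev = top := by simp

theorem mid_lt_mid {i j : Fin N} : mid i < mid j ↔ i < j := Nat.succ_lt_succ_iff

theorem mid_inj {i j : Fin N} : mid i = mid j ↔ i = j := by simp [mid, Fin.ext_iff]

theorem zero_lt_mid (i : Fin N) : 0 < mid i := Nat.succ_pos _

theorem mid_lt_top (i : Fin N) : mid i < top := Nat.succ_lt_succ i.2

theorem zero_lt_top : (0 : Fin (N + 2)) < top := Fin.last_pos

theorem cw_mid (q : ℝ) (i : Fin N) : cw q (mid i) = cw q i := by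
  unfold cw rho mid
  congr 2
  simp only [Fin.val_castSucc, Fin.val_succ]
  push_cast
  split_ifs <;> first | omega | ring

theorem cw_top {q : ℝ} (hq : 0 < q) : cw q (top : Fin (N + 2)) = (cw q (0 : Fin (N + 2)))⁻¹ := by
  rw [← cw_rev hq, rev_zero']

theorem cw_zero_sq {q : ℝ} (hq : 0 < q) : cw q (0 : Fin (N + 2)) ^ 2 = q ^ (-(N : ℤ)) := by
  unfold cw rho
  rw [if_pos (by simp), ← Real.rpow_natCast, ← Real.rpow_mul hq.le, ← Real.rpow_intCast]
  congr 1
  push_cast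
  simp
  ring

/-- The eigenvalue `q^{1-N}` of the R-matrix on the invariant tensor `C`. -/
noncomputable def tau (q : ℝ) (N : ℕ) : ℝ := q ^ (1 - (N : ℤ))

theorem tau_eq {q : ℝ} (hq : 0 < q) : tau q N = q * cw q (0 : Fin (N + 2)) ^ 2 := by
  rw [cw_zero_sq hq, tau, sub_eq_add_neg, zpow_add₀ hq.ne', zpow_one]

theorem tau_add_two {q : ℝ} (hq : 0 < q) :
    tau q (N + 2) = q⁻¹ * cw q (0 : Fin (N + 2)) ^ 2 := by
  rw [cw_zero_sq hq, tau, ← zpow_neg_one, ← zpow_add₀ hq.ne']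
  congr 1
  push_cast
  ring

theorem contr_add_two {q : ℝ} (hq : 0 < q) (f : Fin (N + 2) → Fin (N + 2) → M) :
    contr q f = cw q (0 : Fin (N + 2)) • f 0 top + contr q (fun a b => f (mid a) (mid b))
      + (cw q (0 : Fin (N + 2)))⁻¹ • f top 0 := by
  unfold contr
  rw [sum_mid]
  simp only [mid_rev, cw_mid, rev_zero', cw_top hq, Fin.rev_last]

theorem metric_mid_mid (q : ℝ) (i j : Fin N) : metric q (mid i) (mid j) = metric q i j := by
  simp only [metric_eq, mid_rev, mid_inj, cw_mid]

theorem Rop_zero_zero (q : ℝ) (f : Fin (N + 2) → Fin (N + 2) → M) :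
    Rop q f 0 0 = q • f 0 0 := by
  rw [Rop_apply]
  simp [zero_lt_top.ne]

theorem Rop_top_top (q : ℝ) (f : Fin (N + 2) → Fin (N + 2) → M) :
    Rop q f top top = q • f top top := by
  rw [Rop_apply]
  simp [zero_lt_top.ne']

theorem Rop_zero_mid (q : ℝ) (f : Fin (N + 2) → Fin (N + 2) → M) (m : Fin N) :
    Rop q f 0 (mid m) = f (mid m) 0 + (q - q⁻¹) • f 0 (mid m) := by
  rw [Rop_apply, rev_zero', if_neg (zero_lt_mid m).ne, if_neg (mid_lt_top m).ne,
    if_pos (zero_lt_mid m), if_neg (mid_lt_top m).ne]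
  simp

theorem Rop_mid_zero (q : ℝ) (f : Fin (N + 2) → Fin (N + 2) → M) (m : Fin N) :
    Rop q f (mid m) 0 = f 0 (mid m) := by
  rw [Rop_apply, mid_rev, if_neg (zero_lt_mid m).ne', if_neg (zero_lt_mid _).ne,
    if_neg (zero_lt_mid m).not_gt, if_neg (zero_lt_mid _).ne]
  simp

theorem Rop_mid_top (q : ℝ) (f : Fin (N + 2) → Fin (N + 2) → M) (m : Fin N) :
    Rop q f (mid m) top = f top (mid m) + (q - q⁻¹) • f (mid m) top := by
  rw [Rop_apply, mid_rev, if_neg (mid_lt_top m).ne, if_neg (mid_lt_top _).ne',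
    if_pos (mid_lt_top m), if_neg (mid_lt_top _).ne']
  simp

theorem Rop_top_mid (q : ℝ) (f : Fin (N + 2) → Fin (N + 2) → M) (m : Fin N) :
    Rop q f top (mid m) = f (mid m) top := by
  rw [Rop_apply, Fin.rev_last, if_neg (mid_lt_top m).ne', if_neg (zero_lt_mid _).ne',
    if_neg (mid_lt_top m).not_gt, if_neg (zero_lt_mid _).ne']
  simp

theorem Rop_top_zero (q : ℝ) (f : Fin (N + 2) → Fin (N + 2) → M) :
    Rop q f top 0 = q⁻¹ • f 0 top := by
  rw [Rop_apply, Fin.rev_last, if_neg zero_lt_top.ne', if_pos rfl,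
    if_neg zero_lt_top.not_gt, if_pos rfl, sum_mid]
  simp [(mid_lt_top _).not_gt]

theorem sum_rev_contr (q : ℝ) (f : Fin N → Fin N → M) :
    ∑ l : Fin N, cw q l.rev • f l.rev l = contr q f := by
  unfold contr
  rw [← Equiv.sum_comp Fin.revPerm]
  simp

theorem Rop_zero_top {q : ℝ} (f : Fin (N + 2) → Fin (N + 2) → M) :
    Rop q f 0 top = q⁻¹ • f top 0
      + ((q - q⁻¹) * (1 - cw q (0 : Fin (N + 2)) ^ 2)) • f 0 top
      - ((q - q⁻¹) * cw q (0 : Fin (N + 2))) • contr q (fun a b => f (mid a) (mid b)) := by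
  rw [Rop_apply, rev_zero', if_neg zero_lt_top.ne, if_pos rfl,
    if_pos zero_lt_top, if_pos rfl, sum_mid]
  simp only [zero_lt_mid, if_true, zero_lt_top, mid_rev, cw_mid, lt_self_iff_false, if_false,
    Fin.rev_last]
  rw [sum_rev_contr q (fun a b => f (mid a) (mid b))]
  simp only [zero_add, smul_add, smul_smul, zero_sub, zpow_neg_one]
  module

theorem Rop_mid_mid (q : ℝ) (f : Fin (N + 2) → Fin (N + 2) → M) (i j : Fin N) :
    Rop q f (mid i) (mid j) = Rop q (fun a b => f (mid a) (mid b)) i j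
      - ((q - q⁻¹) * cw q (0 : Fin (N + 2)) * metric q i j) • f 0 top := by
  rw [Rop_apply, Rop_apply, sum_mid, metric_eq]
  simp only [mid_rev, mid_inj, mid_lt_mid, mid_lt_top, if_true, cw_mid, Fin.rev_last,
    (zero_lt_mid _).not_gt, if_false, zero_add]
  split_ifs <;> module

end RMatrixIdentities

/-! ### Skein relation, inverse and crossing symmetry of the R-matrix -/

section RMatrixIdentities

variable {M : Type*} [AddCommGroup M] [Module ℝ M] {N : ℕ}

theorem Rop_add (q : ℝ) (f g : Fin N → Fin N → M) (i j : Fin N) :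
    Rop q (fun a b => f a b + g a b) i j = Rop q f i j + Rop q g i j := by
  simp only [Rop, smul_add, Finset.sum_add_distrib]

theorem Rop_sub (q : ℝ) (f g : Fin N → Fin N → M) (i j : Fin N) :
    Rop q (fun a b => f a b - g a b) i j = Rop q f i j - Rop q g i j := by
  simp only [Rop, smul_sub, Finset.sum_sub_distrib]

theorem Rop_smul (q c : ℝ) (f : Fin N → Fin N → M) (i j : Fin N) :
    Rop q (fun a b => c • f a b) i j = c • Rop q f i j := by
  simp only [Rop, Finset.smul_sum, smul_comm c]

theorem contr_add (q : ℝ) (f g : Fin N → Fin N → M) :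
    contr q (fun a b => f a b + g a b) = contr q f + contr q g := by
  simp only [contr, smul_add, Finset.sum_add_distrib]

theorem contr_sub (q : ℝ) (f g : Fin N → Fin N → M) :
    contr q (fun a b => f a b - g a b) = contr q f - contr q g := by
  simp only [contr, smul_sub, Finset.sum_sub_distrib]

theorem contr_smul (q c : ℝ) (f : Fin N → Fin N → M) :
    contr q (fun a b => c • f a b) = c • contr q f := by
  simp only [contr, Finset.smul_sum, smul_comm c]

/-- The quantum dimension `C^{kl} C_{kl}`. -/
noncomputable def qdim (q : ℝ) (N : ℕ) : ℝ := ∑ k : Fin N, cw q k ^ 2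

theorem contr_metric (q : ℝ) (m : M) :
    contr q (fun a b : Fin N => metric q a b • m) = qdim q N • m := by
  simp [contr, metric_eq, qdim, Finset.sum_smul, smul_smul, pow_two]

/-- The quantum dimension is `1 + (q^{N-1} - q^{1-N}) / (q - q⁻¹)`, here without denominators. -/
theorem qdim_eq {q : ℝ} (hq : 0 < q) (N : ℕ) :
    (q - q⁻¹) * qdim q N = (q - q⁻¹) + (tau q N)⁻¹ - tau q N := by
  induction N using Nat.twoStepInduction with
  | zero => simp [qdim, tau]
  | one => simp [qdim, tau, cw, rho]
  | more N ih _ =>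
    have hc := (cw_pos hq (0 : Fin (N + 2))).ne'
    have hq0 := hq.ne'
    rw [tau_eq hq] at ih
    rw [tau_add_two hq, qdim, sum_mid]
    simp only [cw_mid, cw_top hq]
    rw [← qdim]
    generalize cw q (0 : Fin (N + 2)) = c at *
    have : (q - q⁻¹) * (c ^ 2 + qdim q N + c⁻¹ ^ 2)
      = (q - q⁻¹) * (c ^ 2 + c⁻¹ ^ 2) + (q - q⁻¹) * qdim q N := by ring
    rw [this, ih]
    field_simp
    ring

/-- `C_{ij}` is an eigenvector of the R-matrix with eigenvalue `q^{1-N}`. -/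
theorem contr_Rop {q : ℝ} (hq : 0 < q) (f : Fin N → Fin N → M) :
    contr q (Rop q f) = tau q N • contr q f := by
  induction N using Nat.twoStepInduction with
  | zero => simp [contr]
  | one => simp [contr, Rop_apply, tau]
  | more N ih _ =>
    have hc := (cw_pos hq (0 : Fin (N + 2))).ne'
    have hq0 := hq.ne'
    have hd := qdim_eq hq N
    have e := ih (fun a b => f (mid a) (mid b))
    rw [tau_eq hq] at hd e
    rw [tau_add_two hq, contr_add_two hq, contr_add_two hq, Rop_zero_top, Rop_top_zero]
    simp only [Rop_mid_mid, contr_sub, mul_smul, contr_smul, contr_metric]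
    change _ + (contr q (Rop q fun a b => f (mid a) (mid b)) - _) + _ = _
    rw [e, smul_smul _ (qdim q N), smul_smul (q - q⁻¹) (_ * _),
      show (q - q⁻¹) * (cw q (0 : Fin (N + 2)) * qdim q N)
        = cw q (0 : Fin (N + 2)) * ((q - q⁻¹) * qdim q N) by ring, hd]
    generalize cw q (0 : Fin (N + 2)) = c at *
    match_scalars <;> field_simp <;> ring

theorem metric_zero_top (q : ℝ) : metric q (0 : Fin (N + 2)) top = cw q (0 : Fin (N + 2)) := by
  simp [metric_eq]

theorem metric_top_zero {q : ℝ} (hq : 0 < q) :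
    metric q (top : Fin (N + 2)) 0 = (cw q (0 : Fin (N + 2)))⁻¹ := by
  simp [metric_eq, cw_top hq]

theorem metric_zero_mid (q : ℝ) (m : Fin N) : metric q 0 (mid m) = 0 := by
  rw [metric_eq, rev_zero', if_neg (mid_lt_top m).ne]

theorem metric_mid_zero (q : ℝ) (m : Fin N) : metric q (mid m) 0 = 0 := by
  rw [metric_eq, mid_rev, if_neg (zero_lt_mid _).ne]

theorem metric_mid_top (q : ℝ) (m : Fin N) : metric q (mid m) top = 0 := by
  rw [metric_eq, mid_rev, if_neg (mid_lt_top _).ne']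

theorem metric_top_mid (q : ℝ) (m : Fin N) : metric q top (mid m) = 0 := by
  rw [metric_eq, Fin.rev_last, if_neg (zero_lt_mid m).ne']

theorem metric_zero_zero (q : ℝ) : metric q (0 : Fin (N + 2)) 0 = 0 := by
  rw [metric_eq, rev_zero', if_neg zero_lt_top.ne]

theorem metric_top_top (q : ℝ) : metric q (top : Fin (N + 2)) top = 0 := by
  rw [metric_eq, Fin.rev_last, if_neg zero_lt_top.ne']

theorem Rop_metric {q : ℝ} (hq : 0 < q) (m : M) (i j : Fin N) :
    Rop q (fun a b => metric q a b • m) i j = tau q N • metric q i j • m := by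
  induction N using Nat.twoStepInduction with
  | zero => exact i.elim0
  | one => simp [Rop_apply, tau, Subsingleton.elim i j, metric_eq, Subsingleton.elim j.rev j]
  | more N ih _ =>
    have hc := (cw_pos hq (0 : Fin (N + 2))).ne'
    have hq0 := hq.ne'
    have hd := qdim_eq hq N
    rw [tau_eq hq] at hd ih
    rw [tau_add_two hq]
    induction i using mid_cases <;> induction j using mid_cases <;>
    simp only [Rop_zero_zero, Rop_zero_mid, Rop_zero_top, Rop_mid_zero, Rop_mid_mid,
      Rop_mid_top, Rop_top_zero, Rop_top_mid, Rop_top_top, metric_zero_top, metric_top_zero hq,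
      metric_zero_mid, metric_mid_zero, metric_mid_top, metric_top_mid, metric_zero_zero,
      metric_top_top, zero_smul, smul_zero, add_zero, metric_mid_mid, ih, contr_metric]
    · rw [smul_smul _ (qdim q N)]
      rw [show (q - q⁻¹) * cw q (0 : Fin (N + 2)) * qdim q N
        = cw q (0 : Fin (N + 2)) * ((q - q⁻¹) * qdim q N) by ring, hd]
      generalize cw q (0 : Fin (N + 2)) = c at *
      match_scalars; field_simp; ring
    · generalize cw q (0 : Fin (N + 2)) = c at *
      match_scalars; field_simp; ring
    · generalize cw q (0 : Fin (N + 2)) = c at *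
      match_scalars; field_simp

/-- The skein relation `R² = I + (q - q⁻¹) R - (q - q⁻¹) q^{1-N} K`. It says that
`R - (q - q⁻¹) I + (q - q⁻¹) K` is the inverse of `R`. -/
theorem Rop_Rop {q : ℝ} (hq : 0 < q) (f : Fin N → Fin N → M) (i j : Fin N) :
    Rop q (Rop q f) i j = f i j + (q - q⁻¹) • Rop q f i j
      - ((q - q⁻¹) * tau q N) • metric q i j • contr q f := by
  induction N using Nat.twoStepInduction with
  | zero => exact i.elim0
  | one =>
    obtain rfl := Subsingleton.elim i j
    simp [Rop_apply, tau, metric_eq, contr, Subsingleton.elim i 0, cw, rho]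
  | more N ih _ =>
    have hc := (cw_pos hq (0 : Fin (N + 2))).ne'
    have hq0 := hq.ne'
    have ht := contr_Rop hq (fun a b => f (mid a) (mid b))
    have hd := qdim_eq hq N
    rw [tau_eq hq] at ht ih hd
    rw [tau_add_two hq]
    induction i using mid_cases <;> induction j using mid_cases <;>
    simp only [Rop_zero_zero, Rop_zero_mid, Rop_zero_top, Rop_mid_zero, Rop_mid_mid,
      Rop_mid_top, Rop_top_zero, Rop_top_mid, Rop_top_top, metric_zero_top, metric_top_zero hq,
      metric_zero_mid, metric_mid_zero, metric_mid_top, metric_top_mid, metric_zero_zero,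
      metric_top_top, zero_smul, smul_zero, metric_mid_mid, ih, contr_metric,
      contr_add_two hq, Rop_sub, Rop_smul, mul_smul, Rop_metric hq, contr_sub, contr_smul]
    · match_scalars; field_simp; ring
    · match_scalars <;> field_simp
    · rw [ht, smul_comm (q - q⁻¹) _ (qdim q N • _), smul_smul (q - q⁻¹) (qdim q N), hd]
      match_scalars <;> field_simp <;> ring
    · match_scalars <;> field_simp
    · rw [tau_eq hq]
      match_scalars <;> field_simp <;> ring
    · match_scalars <;> field_simp
    · match_scalars <;> field_simp; ring
    · match_scalars <;> field_simp
    · match_scalars; field_simp; ring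

theorem sum_Imat_smul (f : Fin N → Fin N → M) (i j : Fin N) :
    ∑ k, ∑ l, Imat k l i j • f k l = f i j := by
  simp [Imat, ite_and, ite_smul]

theorem sum_Kmat_smul (q : ℝ) (f : Fin N → Fin N → M) (i j : Fin N) :
    ∑ k, ∑ l, Kmat q k l i j • f k l = metric q i j • contr q f := by
  simp only [Kmat, mul_smul, ← Finset.smul_sum, sum_metric_smul]

theorem Sop_eq (q : ℝ) (f : Fin N → Fin N → M) (i j : Fin N) :
    Sop q f i j = Rop q f i j - (q - q⁻¹) • f i j
      + (q - q⁻¹) • metric q i j • contr q f := by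
  simp only [Sop, Rinv, add_smul, sub_smul (Rmat q _ _ _ _), mul_smul, Finset.sum_add_distrib,
    Finset.sum_sub_distrib, ← Finset.smul_sum, sum_Imat_smul, sum_Kmat_smul]
  rfl

theorem Rop_Sop {q : ℝ} (hq : 0 < q) (f : Fin N → Fin N → M) (i j : Fin N) :
    Rop q (Sop q f) i j = f i j := by
  have : Sop q f = fun i j => _ := funext fun i => funext fun j => Sop_eq q f i j
  rw [this]
  simp only [Rop_add, Rop_sub, Rop_smul, Rop_metric hq]
  rw [Rop_Rop hq]
  module

theorem Sop_Rop {q : ℝ} (hq : 0 < q) (f : Fin N → Fin N → M) (i j : Fin N) :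
    Sop q (Rop q f) i j = f i j := by
  rw [Sop_eq, contr_Rop hq, Rop_Rop hq]
  module

/-- Crossing symmetry: rotating the R-matrix by means of the metric gives its inverse. -/
theorem Rmat_crossing {q : ℝ} (hq : 0 < q) (k m p j : Fin N) :
    cw q k * Rmat q m p.rev k.rev j = Rinv q k m j p * cw q p := by
  have hq0 := hq.ne'
  have hk := (cw_pos hq k).ne'
  have hm := (cw_pos hq m).ne'
  unfold Rinv Rmat Kmat Imat
  simp only [metric_eq, Fin.rev_inj, Fin.rev_rev, Fin.rev_lt_rev, cw_rev hq]
  simp only [eq_rev_comm p j, eq_rev_comm k m, eq_comm (a := p.rev) (b := j)]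
  by_cases h1 : k = p
  · subst h1
    by_cases h2 : j = m
    · subst h2
      by_cases h3 : j = k
      · subst h3
        by_cases h4 : j = j.rev
        · have h5 := cw_rev hq j
          rw [← h4] at h5
          have h6 : cw q j * cw q j = 1 := by
            nth_rw 1 [h5]
            exact inv_mul_cancel₀ hk
          simp [← h4]
          linear_combination (-(q - q⁻¹) * cw q j) * h6
        · simp [h4]
          ring
      · by_cases h4 : j = k.rev
        · simp [h4, cw_rev hq, hk, mt (Eq.trans h4) h3, Ne.symm (mt (Eq.trans h4) h3)]
          ring
        · simp [h3, h4, Ne.symm h3]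
    · have h3 : ¬ (k = j ∧ m = k) := fun h => h2 (h.1.symm.trans h.2.symm)
      have h4 : ¬ (j = k.rev ∧ m = k.rev) := fun h => h2 (h.1.trans h.2.symm)
      simp only [ite_zero_mul_ite_zero, h2, h3, h4]
      simp
  · have h0 : ¬ p = k := Ne.symm h1
    simp only [ite_zero_mul_ite_zero, h1, h0, false_and, and_false, if_false, zero_add]
    by_cases h2 : m = k.rev ∧ j = p.rev
    · obtain ⟨rfl, rfl⟩ := h2
      have hp := (cw_pos hq p).ne'
      simp only [and_self, if_true, Fin.rev_lt_rev, cw_rev hq]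
      by_cases h3 : k = p.rev
      · subst h3
        rcases lt_or_gt_of_ne h1 with h5 | h5
        · simp [h5, h5.not_gt, cw_rev hq]
          field_simp
          simp
        · simp [h5, h5.not_gt, cw_rev hq]
          field_simp
          ring
      · have h4 : ¬ p.rev = k := fun h => h3 h.symm
        have h4' : ¬ p = k.rev := fun h => h3 (by rw [h, Fin.rev_rev])
        have h4'' : ¬ k.rev = p := fun h => h4' h.symm
        rcases lt_or_gt_of_ne h1 with h5 | h5
        · simp [h5, h5.not_gt, h3, h4'']
        · simp [h5, h5.not_gt, h3, h4, h4', h4'']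
          field_simp
    · have h2' := mt And.symm h2
      by_cases h3 : j = k ∧ p = m
      · obtain ⟨rfl, rfl⟩ := h3
        simp only [h2, h2', if_false]
        rcases lt_or_gt_of_ne h1 with h5 | h5
        · simp [h5, h5.not_gt]
        · simp [h5, h5.not_gt]
          field_simp
          ring
      · have h3' : ¬ (k = j ∧ m = p) := fun h => h3 ⟨h.1.symm, h.2.symm⟩
        simp [h2, h2', h3, h3']

/-- Crossing symmetry with the roles of the R-matrix and its inverse exchanged. It follows from
`Rmat_crossing`, because the rotation exchanges `I` and `K`. -/
theorem Rinv_crossing {q : ℝ} (hq : 0 < q) (k m p j : Fin N) :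
    cw q k * Rinv q m p.rev k.rev j = Rmat q k m j p * cw q p := by
  have h := Rmat_crossing hq k m p j
  rw [Rinv, mul_add, mul_sub, h, Rinv]
  unfold Kmat Imat
  simp only [metric_eq, Fin.rev_inj, Fin.rev_rev, cw_rev hq]
  have hk := (cw_pos hq k).ne'
  simp only [eq_rev_comm p j, ite_zero_mul_ite_zero, eq_comm (a := p.rev) (b := j)]
  simp only [eq_comm (a := j), eq_comm (a := p) (b := m), and_comm (a := p.rev = j)]
  have h1 : (if m = k.rev ∧ p.rev = j then cw q j * cw q k else 0) * cw q p
      = if m = k.rev ∧ p.rev = j then cw q k else 0 := by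
    split_ifs with hh
    · have hp := (cw_pos hq p).ne'
      rw [← hh.2, cw_rev hq]
      field_simp
    · rw [zero_mul]
  have h2 : cw q k * (if k = j ∧ m = p then (cw q k)⁻¹ * cw q m else 0)
      = (if k = j ∧ m = p then 1 else 0) * cw q p := by
    split_ifs with hh
    · rw [hh.2]
      field_simp
    · simp
  have h3 : cw q k * (if m = k.rev ∧ p.rev = j then 1 else 0)
      = if m = k.rev ∧ p.rev = j then cw q k else 0 := by split_ifs <;> simp
  linear_combination (q - q⁻¹) * (h1 + h2 - h3)

end RMatrixIdentities

/-! ### The braid relation for the R-matrix -/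

section RMatrixIdentities

variable {M : Type*} [AddCommGroup M] [Module ℝ M] {N : ℕ}

theorem Kmat_symm (q : ℝ) (k l i j : Fin N) : Kmat q k l i j = Kmat q i j k l := mul_comm _ _

theorem Imat_symm (k l i j : Fin N) : Imat k l i j = Imat i j k l := by
  simp only [Imat, eq_comm]

theorem Rmat_symm (q : ℝ) (k l i j : Fin N) : Rmat q k l i j = Rmat q i j k l := by
  have h1 : (if i < l then Imat k l i j - Kmat q k l i j else 0)
      = if k < j then Imat i j k l - Kmat q i j k l else 0 := by
    rw [Kmat_symm, Imat_symm]
    by_cases hI : i = k ∧ j = l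
    · rw [hI.1, hI.2]
    · rw [Imat, if_neg hI]
      by_cases hK : j = i.rev ∧ l = k.rev
      · rw [hK.1, hK.2]
        have : i < k.rev ↔ k < i.rev := by
          rw [← Fin.rev_lt_rev, Fin.rev_rev]
        simp only [this]
      · have : Kmat q i j k l = 0 := by
          rw [Kmat, metric_eq, metric_eq, ite_zero_mul_ite_zero, if_neg fun h => hK h.symm]
        simp [this]
  rw [Rmat, Rmat, h1]
  congr 1
  by_cases h : i = l ∧ j = k
  · obtain ⟨rfl, rfl⟩ := h
    simp only [and_self, if_true, eq_rev_comm j i, eq_comm (a := j) (b := i)]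
  · rw [if_neg h, if_neg fun h' => h ⟨h'.2.symm, h'.1.symm⟩]

theorem Rinv_symm (q : ℝ) (k l i j : Fin N) : Rinv q k l i j = Rinv q i j k l := by
  rw [Rinv, Rmat_symm, Kmat_symm, Imat_symm, Rinv]

/-- Crossing symmetry lets a matrix `T` next to a contraction pass to the other side, where it
becomes `T'`. -/
theorem crossing_contr {q : ℝ} {T T' : Fin N → Fin N → Fin N → Fin N → ℝ}
    (h : ∀ k m p j, cw q k * T m p.rev k.rev j = T' k m j p * cw q p)
    (f : Fin N → Fin N → Fin N → M) (m : Fin N) :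
    contr q (fun a b => ∑ k, ∑ l, T k l b m • f a k l)
      = contr q (fun b c => ∑ k, ∑ l, T' k l m b • f k l c) := by
  simp only [contr, Finset.smul_sum, smul_smul]
  rw [Finset.sum_comm (γ := Fin N) (s := Finset.univ) (t := Finset.univ)
    (f := fun b k => ∑ l, (cw q b * T' k l m b) • f k l b.rev)]
  refine Finset.sum_congr rfl fun i _ => ?_
  rw [Finset.sum_comm (f := fun b l => (cw q b * T' i l m b) • f i l b.rev)]
  refine Finset.sum_congr rfl fun k _ => ?_
  rw [← Equiv.sum_comp Fin.revPerm]
  refine Finset.sum_congr rfl fun l _ => ?_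
  rw [Fin.revPerm_apply, h, mul_comm]

/-- Crossing symmetry lets a matrix `T` next to the metric pass to the other side, where it
becomes `T'`. -/
theorem crossing_metric {q : ℝ} {T T' : Fin N → Fin N → Fin N → Fin N → ℝ}
    (h : ∀ k m p j, cw q k * T m p.rev k.rev j = T' k m j p * cw q p)
    (hT : ∀ k l i j, T k l i j = T i j k l) (hT' : ∀ k l i j, T' k l i j = T' i j k l)
    (g : Fin N → M) (i j m : Fin N) :
    ∑ k, ∑ l, T k l j m • metric q i k • g l = ∑ k, ∑ l, T' k l i j • metric q l m • g k := by
  rw [Finset.sum_comm]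
  refine Finset.sum_congr rfl fun l _ => ?_
  simp only [metric_eq, eq_rev_comm m, ite_smul, zero_smul, smul_ite, smul_zero, Finset.sum_ite_eq',
    Finset.mem_univ, if_true, smul_smul]
  have := h i j m.rev l
  rw [Fin.rev_rev, hT, hT'] at this
  rw [mul_comm, this]

theorem contr_Sop_right {q : ℝ} (hq : 0 < q) (f : Fin N → Fin N → Fin N → M) (m : Fin N) :
    contr q (fun a b => Sop q (fun b c => f a b c) b m)
      = contr q (fun b c => Rop q (fun a b => f a b c) m b) :=
  crossing_contr (Rinv_crossing hq) f m

theorem contr_Rop_right {q : ℝ} (hq : 0 < q) (f : Fin N → Fin N → Fin N → M) (m : Fin N) :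
    contr q (fun a b => Rop q (fun b c => f a b c) b m)
      = contr q (fun b c => Sop q (fun a b => f a b c) m b) :=
  crossing_contr (Rmat_crossing hq) f m

theorem Sop_metric_left {q : ℝ} (hq : 0 < q) (g : Fin N → M) (i j m : Fin N) :
    Sop q (fun b c => metric q i b • g c) j m = Rop q (fun a b => metric q b m • g a) i j :=
  crossing_metric (Rinv_crossing hq) (Rinv_symm q) (Rmat_symm q) g i j m

theorem Rop_metric_left {q : ℝ} (hq : 0 < q) (g : Fin N → M) (i j m : Fin N) :
    Rop q (fun b c => metric q i b • g c) j m = Sop q (fun a b => metric q b m • g a) i j :=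
  crossing_metric (Rmat_crossing hq) (Rmat_symm q) (Rinv_symm q) g i j m

/-- `C^{ab} R_{23} R_{12} = C^{bc}`: the contraction slides over a strand. -/
theorem contr_Rop_Rop {q : ℝ} (hq : 0 < q) (f : Fin N → Fin N → Fin N → M) (m : Fin N) :
    contr q (fun a b => Rop q (fun b c => Rop q (fun a b => f a b c) a b) b m)
      = contr q (fun b c => f m b c) := by
  rw [contr_Rop_right hq (fun a b c => Rop q (fun a b => f a b c) a b)]
  exact congrArg (contr q) (funext fun b => funext fun c => Sop_Rop hq (fun a b => f a b c) m b)

/-- `C^{bc} R_{12} R_{23} = C^{ab}`: the contraction slides over a strand. -/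
theorem contr_Rop_Rop' {q : ℝ} (hq : 0 < q) (f : Fin N → Fin N → Fin N → M) (m : Fin N) :
    contr q (fun b c => Rop q (fun a b => Rop q (fun b c => f a b c) b c) m b)
      = contr q (fun a b => f a b m) := by
  rw [← contr_Sop_right hq (fun a b c => Rop q (fun b c => f a b c) b c)]
  exact congrArg (contr q) (funext fun b => funext fun c => Sop_Rop hq (fun b c => f _ b c) c m)

theorem Rop_Rop_metric {q : ℝ} (hq : 0 < q) (g : Fin N → M) (i j m : Fin N) :
    Rop q (fun a b => Rop q (fun b c => metric q a b • g c) b m) i j = metric q j m • g i := by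
  simp only [Rop_metric_left hq]
  exact Rop_Sop hq (fun a b => metric q b m • g a) i j

theorem Rop_Rop_metric' {q : ℝ} (hq : 0 < q) (g : Fin N → M) (i j m : Fin N) :
    Rop q (fun b c => Rop q (fun a b => metric q b c • g a) i b) j m = metric q i j • g m := by
  simp only [← Sop_metric_left hq]
  exact Rop_Sop hq (fun b c => metric q i b • g c) j m

theorem contr_metric_left {q : ℝ} (hq : 0 < q) (g : Fin N → M) (m : Fin N) :
    contr q (fun a b => metric q m a • g b) = g m := by
  simp [contr, metric_eq, ite_smul, smul_smul, cw_rev hq, (cw_pos hq m).ne']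

theorem contr_metric_right {q : ℝ} (hq : 0 < q) (g : Fin N → M) (m : Fin N) :
    contr q (fun a b => metric q b m • g a) = g m := by
  simp [contr, metric_eq, ite_smul, smul_smul, cw_rev hq, (cw_pos hq m).ne']

/-- `contr_Rop_right` with `R⁻¹` written out, so that only the R-matrix and contractions
occur. -/
theorem contr_Rop_right_eq {q : ℝ} (hq : 0 < q) (f : Fin N → Fin N → Fin N → M) (m : Fin N) :
    contr q (fun a b => Rop q (fun b c => f a b c) b m)
      = contr q (fun b c => Rop q (fun a b => f a b c) m b) - (q - q⁻¹) • contr q (fun b c => f m b c)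
        + (q - q⁻¹) • contr q (fun a b => f a b m) := by
  rw [contr_Rop_right hq]
  simp only [Sop_eq, contr_add, contr_sub, contr_smul, contr_metric_left hq]

theorem contr_Rop_metric {q : ℝ} (hq : 0 < q) (g : Fin N → M) (m : Fin N) :
    contr q (fun b c => Rop q (fun a b => metric q b c • g a) m b)
      = tau q N • g m + ((q - q⁻¹) * qdim q N) • g m - (q - q⁻¹) • g m := by
  have h := contr_Rop_right_eq hq (fun a b c => metric q b c • g a) m
  simp only [Rop_metric hq, contr_metric_right hq, contr_metric, contr_smul] at h
  rw [mul_smul, h]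
  module

theorem contr_Rop_metric_left {q : ℝ} (hq : 0 < q) (g : Fin N → M) (m : Fin N) :
    contr q (fun a b => Rop q (fun b c => metric q a b • g c) b m)
      = tau q N • g m + ((q - q⁻¹) * qdim q N) • g m - (q - q⁻¹) • g m := by
  have h := contr_Rop_right_eq hq (fun a b c => metric q a b • g c) m
  simp only [Rop_metric hq, contr_metric_left hq, contr_metric, contr_smul] at h
  rw [mul_smul, h]
  module

theorem Rop_metric_left_eq {q : ℝ} (hq : 0 < q) (g : Fin N → M) (i j m : Fin N) :
    Rop q (fun b c => metric q i b • g c) j m = Rop q (fun a b => metric q b m • g a) i j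
      - (q - q⁻¹) • metric q j m • g i + (q - q⁻¹) • metric q i j • g m := by
  rw [Rop_metric_left hq, Sop_eq, contr_metric_right hq]

/-- The braid relation for the R-matrix, by induction from `N` to `N + 2`. For three middle indices
it is the induction hypothesis up to terms with a factor `C`; if an outer index occurs, it reduces
to the skein relation and to the sliding rules for the contraction and the metric over the middle
indices. -/
theorem Rop_braid {q : ℝ} (hq : 0 < q) (f : Fin N → Fin N → Fin N → M) (i j k : Fin N) :
    Rop q (fun a b => Rop q (fun b c => Rop q (fun a b => f a b c) a b) b k) i j
      = Rop q (fun b c => Rop q (fun a b => Rop q (fun b c => f a b c) b c) i b) j k := by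
  induction N using Nat.twoStepInduction with
  | zero => exact i.elim0
  | one =>
    obtain rfl := Subsingleton.elim i j
    obtain rfl := Subsingleton.elim i k
    simp [Rop_apply]
  | more N ih _ =>
    have hc := (cw_pos hq (0 : Fin (N + 2))).ne'
    have hq0 := hq.ne'
    have hd := qdim_eq hq N
    rw [tau_eq hq] at hd
    -- The quantum dimension enters only through the multiple `(q - q⁻¹) qdim`, a polynomial in
    -- `q`, the outer metric coefficient and their inverses.
    have hd' : ∀ x : M, (q - q⁻¹) • cw q (0 : Fin (N + 2)) • qdim q N • x
        = cw q (0 : Fin (N + 2)) • ((q - q⁻¹) + (q * cw q (0 : Fin (N + 2)) ^ 2)⁻¹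
          - q * cw q (0 : Fin (N + 2)) ^ 2) • x := fun x => by
      rw [smul_comm (q - q⁻¹), smul_smul (q - q⁻¹), hd]
    induction i using mid_cases <;> induction j using mid_cases <;>
    induction k using mid_cases <;>
    simp only [Rop_zero_zero, Rop_zero_mid, Rop_zero_top, Rop_mid_zero, Rop_mid_mid,
      Rop_mid_top, Rop_top_zero, Rop_top_mid, Rop_top_top, ih, Rop_add, Rop_sub, Rop_smul,
      contr_add, contr_sub, contr_smul, mul_smul, contr_Rop hq, Rop_metric hq, contr_metric,
      contr_Rop_Rop hq, contr_Rop_Rop' hq, Rop_Rop_metric hq, Rop_Rop_metric' hq, tau_eq hq,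
      contr_Rop_metric_left hq, contr_Rop_metric hq, hd]
    all_goals try (match_scalars <;> field_simp; done)
    all_goals try (match_scalars <;> field_simp <;> ring; done)
    all_goals simp only [hd', Rop_Rop hq, tau_eq hq, Rop_metric_left_eq hq, contr_Rop_right_eq hq,
      contr_metric_left hq, contr_metric_right hq]
    all_goals (match_scalars <;> field_simp <;> ring)

end RMatrixIdentities

/-! ### Braid relations with the inverse R-matrix -/

section ThreeIndices

variable {M : Type*} [AddCommGroup M] [Module ℝ M] {N : ℕ}

theorem Sop_braid {q : ℝ} (hq : 0 < q) (f : Fin N → Fin N → Fin N → M) (i j k : Fin N) :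
    Sop q (fun a b => Sop q (fun b c => Sop q (fun a b => f a b c) a b) b k) i j
      = Sop q (fun b c => Sop q (fun a b => Sop q (fun b c => f a b c) b c) i b) j k := by
  let R₁ : (Fin N → Fin N → Fin N → M) → Fin N → Fin N → Fin N → M :=
    fun f a b c => Rop q (fun a b => f a b c) a b
  let R₂ : (Fin N → Fin N → Fin N → M) → Fin N → Fin N → Fin N → M :=
    fun f a b c => Rop q (fun b c => f a b c) b c
  let S₁ : (Fin N → Fin N → Fin N → M) → Fin N → Fin N → Fin N → M :=
    fun f a b c => Sop q (fun a b => f a b c) a b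
  let S₂ : (Fin N → Fin N → Fin N → M) → Fin N → Fin N → Fin N → M :=
    fun f a b c => Sop q (fun b c => f a b c) b c
  have h₁ : ∀ f, R₁ (S₁ f) = f := fun f => by ext a b c; exact Rop_Sop hq _ a b
  have h₂ : ∀ f, R₂ (S₂ f) = f := fun f => by ext a b c; exact Rop_Sop hq _ b c
  have h₁' : ∀ f, S₁ (R₁ f) = f := fun f => by ext a b c; exact Sop_Rop hq _ a b
  have h₂' : ∀ f, S₂ (R₂ f) = f := fun f => by ext a b c; exact Sop_Rop hq _ b c
  have hb : ∀ f, R₁ (R₂ (R₁ f)) = R₂ (R₁ (R₂ f)) := fun f => by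
    ext a b c; exact Rop_braid hq f a b c
  have key : S₁ (S₂ (S₁ f)) = S₂ (S₁ (S₂ f)) := by
    have h := hb (S₂ (S₁ (S₂ f)))
    rw [h₂, h₁, h₂] at h
    have h' := congrArg (fun f => S₁ (S₂ (S₁ f))) h
    simpa only [h₁', h₂'] using h'.symm
  exact congrFun (congrFun (congrFun key i) j) k

/-- The mixed braid relation: the braid relation, composed with `R⁻¹` on both sides. -/
theorem Sop_Rop_Rop_braid {q : ℝ} (hq : 0 < q) (f : Fin N → Fin N → Fin N → M) (i j k : Fin N) :
    Sop q (fun a b => Rop q (fun b c => Rop q (fun a b => f a b c) a b) b k) i j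
      = Rop q (fun b c => Rop q (fun a b => Sop q (fun b c => f a b c) b c) i b) j k := by
  have h : ∀ a b k, Rop q (fun b c => Rop q (fun a b => f a b c) a b) b k
      = Rop q (fun a b => Rop q (fun b c => Rop q (fun a b => Sop q (fun b c => f a b c) b c)
          a b) b k) a b := fun a b k => by
    rw [Rop_braid hq]
    simp only [Rop_Sop hq]
  simp only [h]
  exact Sop_Rop hq _ i j

/-- `C^{bc} R⁻¹_{12} R⁻¹_{23} = C^{ab}`. -/
theorem contr_Sop_Sop {q : ℝ} (hq : 0 < q) (f : Fin N → Fin N → Fin N → M) (m : Fin N) :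
    contr q (fun b c => Sop q (fun a b => Sop q (fun b c => f a b c) b c) m b)
      = contr q (fun a b => f a b m) := by
  rw [← contr_Rop_right hq (fun a b c => Sop q (fun b c => f a b c) b c)]
  exact congrArg (contr q) (funext fun b => funext fun c => Rop_Sop hq (fun b c => f _ b c) c m)

theorem Sop_Sop_metric {q : ℝ} (hq : 0 < q) (g : Fin N → M) (i j m : Fin N) :
    Sop q (fun a b => Sop q (fun b c => metric q a b • g c) b m) i j = metric q j m • g i := by
  simp only [Sop_metric_left hq]
  exact Sop_Rop hq (fun a b => metric q b m • g a) i j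

end ThreeIndices

/-! ### Real tensors acting on vectors over `𝕜` -/

section Scalars

variable (𝕜 : Type*) [RCLike 𝕜] {M : Type*} [AddCommGroup M] [Module 𝕜 M] {N : ℕ}

/-- A real tensor `T` acting on the index pair of `f`: `(i, j) ↦ T^{kl}_{ij} f_{kl}`. -/
noncomputable def tact (T : Fin N → Fin N → Fin N → Fin N → ℝ) (f : Fin N → Fin N → M)
    (i j : Fin N) : M := ∑ k, ∑ l, ((T k l i j : ℝ) : 𝕜) • f k l

/-- The contraction `C^{kl} f_{kl}` over `𝕜`. -/
noncomputable def mcontr (q : ℝ) (f : Fin N → Fin N → M) : M :=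
  ∑ k, ∑ l, ((metric q k l : ℝ) : 𝕜) • f k l

theorem map_tact {M' F : Type*} [AddCommGroup M'] [Module 𝕜 M'] [FunLike F M M']
    [LinearMapClass F 𝕜 M M'] (φ : F) (T : Fin N → Fin N → Fin N → Fin N → ℝ)
    (f : Fin N → Fin N → M) (i j : Fin N) :
    φ (tact 𝕜 T f i j) = tact 𝕜 T (fun a b => φ (f a b)) i j := by
  simp only [tact, map_sum, map_smul]

theorem map_mcontr {M' F : Type*} [AddCommGroup M'] [Module 𝕜 M'] [FunLike F M M']
    [LinearMapClass F 𝕜 M M'] (φ : F) (q : ℝ) (f : Fin N → Fin N → M) :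
    φ (mcontr 𝕜 q f) = mcontr 𝕜 q (fun a b => φ (f a b)) := by
  simp only [mcontr, map_sum, map_smul]

theorem tact_add (T : Fin N → Fin N → Fin N → Fin N → ℝ) (f g : Fin N → Fin N → M)
    (i j : Fin N) : tact 𝕜 T (fun a b => f a b + g a b) i j = tact 𝕜 T f i j + tact 𝕜 T g i j := by
  simp only [tact, smul_add, Finset.sum_add_distrib]

theorem tact_smul (T : Fin N → Fin N → Fin N → Fin N → ℝ) (c : 𝕜) (f : Fin N → Fin N → M)
    (i j : Fin N) : tact 𝕜 T (fun a b => c • f a b) i j = c • tact 𝕜 T f i j := by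
  simp only [tact, Finset.smul_sum, smul_comm c]

theorem mcontr_add (q : ℝ) (f g : Fin N → Fin N → M) :
    mcontr 𝕜 q (fun a b => f a b + g a b) = mcontr 𝕜 q f + mcontr 𝕜 q g := by
  simp only [mcontr, smul_add, Finset.sum_add_distrib]

theorem mcontr_smul (q : ℝ) (c : 𝕜) (f : Fin N → Fin N → M) :
    mcontr 𝕜 q (fun a b => c • f a b) = c • mcontr 𝕜 q f := by
  simp only [mcontr, Finset.smul_sum, smul_comm c]

/-- The real vector space underlying a vector space over `𝕜`, through which identities for real
tensors carry over to `𝕜`. It is not an instance, since for `𝕜 = ℝ` it would compete with the given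
structure. -/
abbrev realModule (M : Type*) [AddCommGroup M] [Module 𝕜 M] : Module ℝ M :=
  Module.compHom M (algebraMap ℝ 𝕜)

theorem contr_eq_mcontr (q : ℝ) (f : Fin N → Fin N → M) :
    @contr M _ (realModule 𝕜 M) N q f = mcontr 𝕜 q f :=
  (@sum_metric_smul M _ (realModule 𝕜 M) N q f).symm

theorem tact_Rmat (q : ℝ) (f : Fin N → Fin N → M) (i j : Fin N) :
    tact 𝕜 (Rmat q) f i j = tact 𝕜 (Rinv q) f i j + ((q - q⁻¹ : ℝ) : 𝕜) • f i j
      - ((q - q⁻¹ : ℝ) : 𝕜) • ((metric q i j : ℝ) : 𝕜) • mcontr 𝕜 q f := by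
  have h := @Sop_eq M _ (realModule 𝕜 M) N q f i j
  rw [contr_eq_mcontr] at h
  change tact 𝕜 (Rinv q) f i j = tact 𝕜 (Rmat q) f i j - ((q - q⁻¹ : ℝ) : 𝕜) • f i j
    + ((q - q⁻¹ : ℝ) : 𝕜) • ((metric q i j : ℝ) : 𝕜) • mcontr 𝕜 q f at h
  rw [h]
  abel

/-- The braid relation for `R⁻¹`. -/
theorem tact_braid {q : ℝ} (hq : 0 < q) (f : Fin N → Fin N → Fin N → M) (i j k : Fin N) :
    tact 𝕜 (Rinv q) (fun a b => tact 𝕜 (Rinv q) (fun b c =>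
        tact 𝕜 (Rinv q) (fun a b => f a b c) a b) b k) i j
      = tact 𝕜 (Rinv q) (fun b c => tact 𝕜 (Rinv q) (fun a b =>
        tact 𝕜 (Rinv q) (fun b c => f a b c) b c) i b) j k :=
  @Sop_braid M _ (realModule 𝕜 M) N q hq f i j k

/-- The mixed braid relation. -/
theorem tact_mixed_braid {q : ℝ} (hq : 0 < q) (f : Fin N → Fin N → Fin N → M) (i j k : Fin N) :
    tact 𝕜 (Rinv q) (fun a b => tact 𝕜 (Rmat q) (fun b c =>
        tact 𝕜 (Rmat q) (fun a b => f a b c) a b) b k) i j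
      = tact 𝕜 (Rmat q) (fun b c => tact 𝕜 (Rmat q) (fun a b =>
        tact 𝕜 (Rinv q) (fun b c => f a b c) b c) i b) j k :=
  @Sop_Rop_Rop_braid M _ (realModule 𝕜 M) N q hq f i j k

theorem mcontr_Rinv_Rinv {q : ℝ} (hq : 0 < q) (f : Fin N → Fin N → Fin N → M) (m : Fin N) :
    mcontr 𝕜 q (fun b c => tact 𝕜 (Rinv q) (fun a b =>
        tact 𝕜 (Rinv q) (fun b c => f a b c) b c) m b) = mcontr 𝕜 q (fun a b => f a b m) := by
  have h := @contr_Sop_Sop M _ (realModule 𝕜 M) N q hq f m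
  rwa [contr_eq_mcontr, contr_eq_mcontr] at h

theorem tact_tact_metric {q : ℝ} (hq : 0 < q) (g : Fin N → M) (i j m : Fin N) :
    tact 𝕜 (Rinv q) (fun a b => tact 𝕜 (Rinv q) (fun b c =>
      ((metric q a b : ℝ) : 𝕜) • g c) b m) i j = ((metric q j m : ℝ) : 𝕜) • g i :=
  @Sop_Sop_metric M _ (realModule 𝕜 M) N q hq g i j m

theorem mcontr_tact_Rinv {q : ℝ} (hq : 0 < q) (f : Fin N → Fin N → Fin N → M) (m : Fin N) :
    mcontr 𝕜 q (fun a b => tact 𝕜 (Rinv q) (fun b c => f a b c) b m)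
      = mcontr 𝕜 q (fun b c => tact 𝕜 (Rmat q) (fun a b => f a b c) m b) := by
  have h := @contr_Sop_right M _ (realModule 𝕜 M) N q hq f m
  rwa [contr_eq_mcontr, contr_eq_mcontr] at h

theorem mcontr_metric_left {q : ℝ} (hq : 0 < q) (g : Fin N → M) (m : Fin N) :
    mcontr 𝕜 q (fun a b => ((metric q m a : ℝ) : 𝕜) • g b) = g m := by
  have h := @contr_metric_left M _ (realModule 𝕜 M) N q hq g m
  rwa [contr_eq_mcontr] at h

end Scalars

/-! ### The right action on the model -/

section Model

variable (𝕜 : Type*) [RCLike 𝕜] (q : ℝ) {N : ℕ}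

theorem tact_Kmat {M : Type*} [AddCommGroup M] [Module 𝕜 M] (f : Fin N → Fin N → M)
    (i j : Fin N) :
    ∑ k, ∑ l, ((Kmat q k l i j : ℝ) : 𝕜) • f k l
      = ((metric q i j : ℝ) : 𝕜) • mcontr 𝕜 q f := by
  simp only [Kmat, RCLike.ofReal_mul, mul_smul, mcontr, Finset.smul_sum]

/-- The coefficient `(q^{N-1} - q^{N-3}) / (1 + q^{N-2})` in the relations of the sphere. -/
noncomputable def sphereCoeff (N : ℕ) : ℝ :=
  (q ^ ((N : ℤ) - 1) - q ^ ((N : ℤ) - 3)) / (1 + q ^ ((N : ℤ) - 2))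

theorem mcontr_xx : mcontr 𝕜 q (fun k l : Fin N => xgen 𝕜 q k * xgen 𝕜 q l) = 1 :=
  sphere_sphere 𝕜 q

theorem tact_xx (i j : Fin N) :
    tact 𝕜 (Rinv q) (fun k l => xgen 𝕜 q k * xgen 𝕜 q l) i j
      = ((q⁻¹ : ℝ) : 𝕜) • (xgen 𝕜 q i * xgen 𝕜 q j)
        + ((metric q i j : ℝ) : 𝕜) • ((sphereCoeff q N : ℝ) : 𝕜) • (1 : Sphere 𝕜 q N) := by
  have h := sphere_comm 𝕜 q i j
  rw [tact_Kmat, mcontr_xx, smul_comm] at h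
  exact h

/-- The matrix of the right multiplication by `y ∈ X` on the left basis `γ⁻`, on generators:
`γ⁻_i x_j = R⁻¹^{kl}_{ij} x_k γ⁻_l`. -/
noncomputable def preRightMatrix : FreeAlgebra 𝕜 (Fin N) →ₐ[𝕜] Matrix (Fin N) (Fin N) (Sphere 𝕜 q N) :=
  FreeAlgebra.lift 𝕜 fun j => Matrix.of fun i l =>
    ∑ k, ((Rinv q k l i j : ℝ) : 𝕜) • xgen 𝕜 q k

theorem preRightMatrix_mul (j m i e : Fin N) : preRightMatrix 𝕜 q (fx 𝕜 j * fx 𝕜 m) i e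
    = tact 𝕜 (Rinv q) (fun a b => tact 𝕜 (Rinv q) (fun b c =>
        if c = e then xgen 𝕜 q a * xgen 𝕜 q b else 0) b m) i j := by
  rw [map_mul, preRightMatrix, fx, fx, FreeAlgebra.lift_ι_apply, FreeAlgebra.lift_ι_apply,
    Matrix.mul_apply]
  simp only [Matrix.of_apply, tact, smul_ite, smul_zero, Finset.sum_ite_eq', Finset.mem_univ,
    if_true, Finset.sum_mul_sum, smul_mul_smul_comm, Finset.smul_sum, smul_smul]
  rw [Finset.sum_comm]

/-- The assignment `preRightMatrix` respects the relations of the sphere. The braid relation moves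
the product `x_a x_b` through the third index, and for the sphere relation the contraction slides
over a strand. -/
theorem preRightMatrix_rel (hq : 0 < q) {a b} (h : SphereRel 𝕜 q N a b) :
    preRightMatrix 𝕜 q a = preRightMatrix 𝕜 q b := by
  have hs : ∀ i e : Fin N, mcontr 𝕜 q (fun k l => preRightMatrix 𝕜 q (fx 𝕜 k * fx 𝕜 l) i e)
      = if i = e then 1 else 0 := by
    intro i e
    simp only [preRightMatrix_mul]
    rw [mcontr_Rinv_Rinv 𝕜 hq (fun a b c => if c = e then xgen 𝕜 q a * xgen 𝕜 q b else 0)]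
    split_ifs
    · exact mcontr_xx 𝕜 q
    · simp [mcontr]
  cases h with
  | comm j m =>
    ext i e
    rw [tact_Kmat]
    simp only [map_sum, map_smul, map_add, map_mcontr, Matrix.add_apply, Matrix.smul_apply,
      Matrix.sum_apply]
    have h1 : (mcontr 𝕜 q fun a b : Fin N => preRightMatrix 𝕜 q (fx 𝕜 a * fx 𝕜 b)) i e
        = if i = e then 1 else 0 := by
      rw [← hs i e]
      simp only [mcontr, Matrix.smul_apply, Matrix.sum_apply]
    rw [h1]
    change tact 𝕜 (Rinv q) (fun k l => preRightMatrix 𝕜 q (fx 𝕜 k * fx 𝕜 l) i e) j m = _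
    simp only [preRightMatrix_mul]
    rw [← tact_braid 𝕜 hq (fun a b c => if c = e then xgen 𝕜 q a * xgen 𝕜 q b else 0)]
    have h2 : ∀ a b c : Fin N, tact 𝕜 (Rinv q)
        (fun a b => if c = e then xgen 𝕜 q a * xgen 𝕜 q b else 0) a b
        = ((q⁻¹ : ℝ) : 𝕜) • (if c = e then xgen 𝕜 q a * xgen 𝕜 q b else 0)
          + ((metric q a b : ℝ) : 𝕜) •
            (if c = e then ((sphereCoeff q N : ℝ) : 𝕜) • (1 : Sphere 𝕜 q N) else 0) := by
      intro a b c
      split_ifs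
      · exact tact_xx 𝕜 q a b
      · simp [tact]
    simp only [h2, tact_add, tact_smul]
    rw [tact_tact_metric 𝕜 hq
      (fun c => if c = e then ((sphereCoeff q N : ℝ) : 𝕜) • (1 : Sphere 𝕜 q N) else 0)]
    rw [smul_comm, ← sphereCoeff]
    simp only [smul_ite, smul_zero]
  | sphere =>
    ext i e
    have h1 : (mcontr 𝕜 q fun a b : Fin N => preRightMatrix 𝕜 q (fx 𝕜 a * fx 𝕜 b)) i e
        = if i = e then 1 else 0 := by
      rw [← hs i e]
      simp only [mcontr, Matrix.smul_apply, Matrix.sum_apply]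
    rw [map_one, Matrix.one_apply, ← h1]
    change preRightMatrix 𝕜 q (mcontr 𝕜 q _) i e = _
    rw [map_mcontr]

end Model

/-! ### Bimodules -/

section BimoduleLemmas

variable (𝕜 : Type*) [Field 𝕜] {A : Type*} [Ring A] [Algebra 𝕜 A]
variable {M : Type*} [AddCommGroup M] [Module 𝕜 M] [Module (Env 𝕜 A) M]
  [IsScalarTower 𝕜 (Env 𝕜 A) M]

theorem add_lmul (a b : A) (m : M) : lmul 𝕜 (a + b) m = lmul 𝕜 a m + lmul 𝕜 b m :=
  LinearMap.congr_fun (map_add (lact 𝕜 A M) a b) m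

theorem zero_lmul (m : M) : lmul 𝕜 (0 : A) m = 0 :=
  LinearMap.congr_fun (map_zero (lact 𝕜 A M)) m

theorem smul_lmul (c : 𝕜) (a : A) (m : M) : lmul 𝕜 (c • a) m = c • lmul 𝕜 a m :=
  LinearMap.congr_fun (map_smul (lact 𝕜 A M) c a) m

theorem lmul_smul (c : 𝕜) (a : A) (m : M) : lmul 𝕜 a (c • m) = c • lmul 𝕜 a m :=
  map_smul (lact 𝕜 A M a) c m

theorem lmul_sub (a : A) (m n : M) : lmul 𝕜 a (m - n) = lmul 𝕜 a m - lmul 𝕜 a n :=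
  map_sub (lact 𝕜 A M a) m n

theorem lmul_sum {ι : Type*} (s : Finset ι) (a : A) (m : ι → M) :
    lmul 𝕜 a (∑ i ∈ s, m i) = ∑ i ∈ s, lmul 𝕜 a (m i) :=
  map_sum (lact 𝕜 A M a) m s

theorem rmul_add (m : M) (a b : A) : rmul 𝕜 m (a + b) = rmul 𝕜 m a + rmul 𝕜 m b :=
  LinearMap.congr_fun (map_add (ract 𝕜 A M) (MulOpposite.op a) (MulOpposite.op b)) m

theorem rmul_zero (m : M) : rmul 𝕜 m (0 : A) = 0 :=
  LinearMap.congr_fun (map_zero (ract 𝕜 A M)) m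

theorem rmul_smul (c : 𝕜) (m : M) (a : A) : rmul 𝕜 m (c • a) = c • rmul 𝕜 m a :=
  LinearMap.congr_fun (map_smul (ract 𝕜 A M) c (MulOpposite.op a)) m

theorem smul_rmul (c : 𝕜) (m : M) (a : A) : rmul 𝕜 (c • m) a = c • rmul 𝕜 m a :=
  map_smul (ract 𝕜 A M (MulOpposite.op a)) c m

theorem sub_rmul (m n : M) (a : A) : rmul 𝕜 (m - n) a = rmul 𝕜 m a - rmul 𝕜 n a :=
  map_sub (ract 𝕜 A M (MulOpposite.op a)) m n

theorem sum_rmul {ι : Type*} (s : Finset ι) (m : ι → M) (a : A) :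
    rmul 𝕜 (∑ i ∈ s, m i) a = ∑ i ∈ s, rmul 𝕜 (m i) a :=
  map_sum (ract 𝕜 A M (MulOpposite.op a)) m s

end BimoduleLemmas

section BimoduleHom

variable {𝕜 A M M' : Type*} [Field 𝕜] [Ring A] [Algebra 𝕜 A] [AddCommGroup M]
  [Module (Env 𝕜 A) M] [AddCommGroup M'] [Module (Env 𝕜 A) M']

theorem map_lmul (φ : M →ₗ[Env 𝕜 A] M') (a : A) (m : M) : φ (lmul 𝕜 a m) = lmul 𝕜 a (φ m) :=
  map_smul φ _ m

theorem map_rmul (φ : M →ₗ[Env 𝕜 A] M') (m : M) (a : A) : φ (rmul 𝕜 m a) = rmul 𝕜 (φ m) a :=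
  map_smul φ _ m

end BimoduleHom

/-! ### Forms that commute with `X` through the R-matrix -/

section OneForms

variable (𝕜 : Type*) [RCLike 𝕜] {q : ℝ} {N : ℕ}
variable {M : Type*} [AddCommGroup M] [Module 𝕜 M] [Module (Env 𝕜 (Sphere 𝕜 q N)) M]
  [IsScalarTower 𝕜 (Env 𝕜 (Sphere 𝕜 q N)) M]

theorem lmul_tact (y : Sphere 𝕜 q N) (T : Fin N → Fin N → Fin N → Fin N → ℝ)
    (f : Fin N → Fin N → M) (i j : Fin N) :
    lmul 𝕜 y (tact 𝕜 T f i j) = tact 𝕜 T (fun a b => lmul 𝕜 y (f a b)) i j :=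
  map_tact 𝕜 (lact 𝕜 (Sphere 𝕜 q N) M y) T f i j

theorem lmul_mcontr (y : Sphere 𝕜 q N) (f : Fin N → Fin N → M) :
    lmul 𝕜 y (mcontr 𝕜 q f) = mcontr 𝕜 q (fun a b => lmul 𝕜 y (f a b)) :=
  map_mcontr 𝕜 (lact 𝕜 (Sphere 𝕜 q N) M y) q f

theorem mcontr_rmul (y : Sphere 𝕜 q N) (f : Fin N → Fin N → M) :
    rmul 𝕜 (mcontr 𝕜 q f) y = mcontr 𝕜 q (fun a b => rmul 𝕜 (f a b) y) :=
  map_mcontr 𝕜 (ract 𝕜 (Sphere 𝕜 q N) M (MulOpposite.op y)) q f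

theorem tact_lmul_xx (m : M) (i j : Fin N) :
    tact 𝕜 (Rinv q) (fun k l => lmul 𝕜 (xgen 𝕜 q k * xgen 𝕜 q l) m) i j
      = ((q⁻¹ : ℝ) : 𝕜) • lmul 𝕜 (xgen 𝕜 q i * xgen 𝕜 q j) m
        + ((metric q i j : ℝ) : 𝕜) • ((sphereCoeff q N : ℝ) : 𝕜) • m := by
  have h := congrArg ((lact 𝕜 (Sphere 𝕜 q N) M).toLinearMap.flip m) (tact_xx 𝕜 q i j)
  rw [map_tact] at h
  refine h.trans ?_
  rw [map_add, map_smul, map_smul, map_smul]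
  change _ + _ • _ • lmul 𝕜 (1 : Sphere 𝕜 q N) m = _
  rw [one_lmul]
  rfl

theorem mcontr_lmul_xx (m : M) :
    mcontr 𝕜 q (fun k l : Fin N => lmul 𝕜 (xgen 𝕜 q k * xgen 𝕜 q l) m) = m := by
  have h := congrArg ((lact 𝕜 (Sphere 𝕜 q N) M).toLinearMap.flip m) (mcontr_xx 𝕜 q (N := N))
  rw [map_mcontr] at h
  exact h.trans (one_lmul 𝕜 m)

variable (q) in
/-- The form `C^{kl} x_k e_l` attached to a family `e` in a bimodule. -/
noncomputable def contrForm (e : Fin N → M) : M :=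
  mcontr 𝕜 q (fun k l => lmul 𝕜 (xgen 𝕜 q k) (e l))

variable (q) in
/-- The commutation rule `e_i x_j = S^{kl}_{ij} x_k e_l`. -/
def CommRule (S : Fin N → Fin N → Fin N → Fin N → ℝ) (e : Fin N → M) : Prop :=
  ∀ i j, rmul 𝕜 (e i) (xgen 𝕜 q j) = tact 𝕜 S (fun k l => lmul 𝕜 (xgen 𝕜 q k) (e l)) i j

variable {𝕜}

/-- The commutation rule `ω x_j = q x_j ω + c e_j` of `ω = C^{kl} x_k e_l`. Hence
the inner derivation of `ω` takes the value `(q - 1) x_j ω + c e_j` on `x_j`. -/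
theorem contrForm_rmul (hq : 0 < q) {e : Fin N → M} (he : CommRule 𝕜 q (Rinv q) e) (j : Fin N) :
    rmul 𝕜 (contrForm 𝕜 q e) (xgen 𝕜 q j)
      = (q : 𝕜) • lmul 𝕜 (xgen 𝕜 q j) (contrForm 𝕜 q e)
        + ((sphereCoeff q N - (q - q⁻¹) : ℝ) : 𝕜) • e j := by
  rw [contrForm, mcontr_rmul]
  simp only [← lmul_rmul, he _ j, lmul_tact, lmul_lmul]
  rw [mcontr_tact_Rinv 𝕜 hq (fun a b c => lmul 𝕜 (xgen 𝕜 q a * xgen 𝕜 q b) (e c))]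
  simp only [tact_Rmat, tact_lmul_xx, mcontr_lmul_xx]
  have h : ∀ b c : Fin N, ((q⁻¹ : ℝ) : 𝕜) • lmul 𝕜 (xgen 𝕜 q j * xgen 𝕜 q b) (e c)
      + ((metric q j b : ℝ) : 𝕜) • ((sphereCoeff q N : ℝ) : 𝕜) • e c
      + ((q - q⁻¹ : ℝ) : 𝕜) • lmul 𝕜 (xgen 𝕜 q j * xgen 𝕜 q b) (e c)
      - ((q - q⁻¹ : ℝ) : 𝕜) • ((metric q j b : ℝ) : 𝕜) • e c
      = (q : 𝕜) • lmul 𝕜 (xgen 𝕜 q j) (lmul 𝕜 (xgen 𝕜 q b) (e c))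
        + ((sphereCoeff q N - (q - q⁻¹) : ℝ) : 𝕜) • ((metric q j b : ℝ) : 𝕜) • e c := by
    intro b c
    rw [lmul_lmul]
    push_cast
    module
  simp only [h, mcontr_add, mcontr_smul, mcontr_metric_left 𝕜 hq, ← lmul_mcontr]

theorem zpow_succ_of_two (hq : 0 < q) (N : ℕ) :
    q ^ ((N : ℤ) - 1) = q * q ^ ((N : ℤ) - 2) ∧ q ^ ((N : ℤ) - 3) = q ^ ((N : ℤ) - 2) / q ∧
      q ^ (N : ℤ) = q ^ 2 * q ^ ((N : ℤ) - 2) := by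
  have h0 := hq.ne'
  refine ⟨?_, ?_, ?_⟩
  · rw [mul_comm, ← zpow_add_one₀ h0]; congr 1; ring
  · rw [div_eq_mul_inv, ← zpow_sub_one₀ h0]; congr 1; ring
  · rw [mul_comm, ← zpow_natCast, ← zpow_add₀ h0]; congr 1; push_cast; ring

theorem sphereCoeff_sub (hq : 0 < q) (N : ℕ) :
    sphereCoeff q N - (q - q⁻¹) = -((q - q⁻¹) / (1 + q ^ ((N : ℤ) - 2))) := by
  have hp : 0 < q ^ ((N : ℤ) - 2) := zpow_pos hq _
  obtain ⟨h1, h2, -⟩ := zpow_succ_of_two hq N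
  rw [sphereCoeff, h1, h2]
  generalize q ^ ((N : ℤ) - 2) = p at *
  have := hq.ne'
  field_simp
  ring

theorem one_sub_zpow_ne (hq : 0 < q) (hq1 : q ≠ 1) (hN : 3 ≤ N) :
    1 - q * q ^ ((N : ℤ) - 2) ≠ 0 := by
  rw [← (zpow_succ_of_two hq N).1, sub_ne_zero]
  intro h
  have h3 : ((N : ℤ) - 1) = ((N - 1 : ℕ) : ℤ) := by omega
  rw [h3, zpow_natCast] at h
  exact hq1 ((pow_eq_one_iff_of_nonneg hq.le (by omega)).1 h.symm)

/-- `μ = q (1 + q^{N-2}) / (1 + q)`, the constant for which `dx_i = e_i - μ x_i ω` when the `e_i`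
commute with `X` through `R⁻¹` and `ω = C^{kl} x_k e_l`. -/
noncomputable def muConst (q : ℝ) (N : ℕ) : ℝ := q * (1 + q ^ ((N : ℤ) - 2)) / (1 + q)

/-- If the `e_i` commute with `X` through `R⁻¹`, then the forms `e_i - μ x_i ω` satisfy the
commutation relations of the differentials in `Γ₊`. -/
theorem plusDefect_eq_zero (hq : 0 < q) (hq1 : q ≠ 1) (hN : 3 ≤ N) {e : Fin N → M}
    (he : CommRule 𝕜 q (Rinv q) e) {δ : Sphere 𝕜 q N → M}
    (hδ : ∀ i, δ (xgen 𝕜 q i) = e i - ((muConst q N : ℝ) : 𝕜) •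
      lmul 𝕜 (xgen 𝕜 q i) (contrForm 𝕜 q e)) (i j : Fin N) :
    plusDefect 𝕜 q δ i j = 0 := by
  have hxδ : ∀ k l : Fin N, lmul 𝕜 (xgen 𝕜 q k) (δ (xgen 𝕜 q l)) = lmul 𝕜 (xgen 𝕜 q k) (e l)
      + (-((muConst q N : ℝ) : 𝕜)) • lmul 𝕜 (xgen 𝕜 q k * xgen 𝕜 q l) (contrForm 𝕜 q e) := by
    intro k l
    rw [hδ, lmul_sub, lmul_smul, lmul_lmul]
    module
  have hη : mcontr 𝕜 q (fun k l => lmul 𝕜 (xgen 𝕜 q k) (δ (xgen 𝕜 q l)))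
      = (1 - ((muConst q N : ℝ) : 𝕜)) • contrForm 𝕜 q e := by
    simp only [hxδ, mcontr_add, mcontr_smul, mcontr_lmul_xx]
    rw [← contrForm]
    module
  have hcub : mcontr 𝕜 q (fun k l =>
      lmul 𝕜 (xgen 𝕜 q i * xgen 𝕜 q j * xgen 𝕜 q k) (δ (xgen 𝕜 q l)))
      = (1 - ((muConst q N : ℝ) : 𝕜)) • lmul 𝕜 (xgen 𝕜 q i * xgen 𝕜 q j) (contrForm 𝕜 q e) := by
    rw [← lmul_smul, ← hη, lmul_mcontr]
    simp only [lmul_lmul]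
  have hR : tact 𝕜 (Rinv q) (fun k l => lmul 𝕜 (xgen 𝕜 q k) (δ (xgen 𝕜 q l))) i j
      = tact 𝕜 (Rinv q) (fun k l => lmul 𝕜 (xgen 𝕜 q k) (e l)) i j
        + (-((muConst q N : ℝ) : 𝕜)) •
          (((q⁻¹ : ℝ) : 𝕜) • lmul 𝕜 (xgen 𝕜 q i * xgen 𝕜 q j) (contrForm 𝕜 q e)
            + ((metric q i j : ℝ) : 𝕜) • ((sphereCoeff q N : ℝ) : 𝕜) • contrForm 𝕜 q e) := by
    simp only [hxδ, tact_add, tact_smul, tact_lmul_xx]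
  rw [plusDefect, sub_eq_zero, tact_Kmat, hη]
  change _ = tact 𝕜 (Rinv q) _ i j + _ + _ + _ • mcontr 𝕜 q _
  rw [hcub, hR, hδ i, hδ j, sub_rmul, smul_rmul, he i j, ← lmul_rmul, contrForm_rmul hq he,
    lmul_sub, lmul_smul, lmul_lmul, lmul_add, lmul_smul, lmul_smul, lmul_lmul, sphereCoeff_sub hq]
  have hp : 0 < q ^ ((N : ℤ) - 2) := zpow_pos hq _
  have hp1 := one_sub_zpow_ne hq hq1 hN
  obtain ⟨h1, h2, h3⟩ := zpow_succ_of_two hq N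
  rw [sphereCoeff, muConst, h1, h2, h3]
  generalize q ^ ((N : ℤ) - 2) = p at *
  have e1 : (q : 𝕜) ≠ 0 := by exact_mod_cast hq.ne'
  have e2 : (1 + p : 𝕜) ≠ 0 := by exact_mod_cast (by positivity : (1 + p : ℝ) ≠ 0)
  have e3 : (1 + q : 𝕜) ≠ 0 := by exact_mod_cast (by positivity : (1 + q : ℝ) ≠ 0)
  have e4 : (1 - q * p : 𝕜) ≠ 0 := by exact_mod_cast hp1
  push_cast
  match_scalars <;> field_simp <;> ring

end OneForms

/-! ### A model of the calculus on `X^N` -/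

section ModelBimodule

variable (𝕜 : Type*) [RCLike 𝕜] {q : ℝ} {N : ℕ}

/-- The algebra homomorphism `X → Mat_N(X)` describing right multiplication on `γ⁻`. -/
noncomputable def rightMatrix (hq : 0 < q) :
    Sphere 𝕜 q N →ₐ[𝕜] Matrix (Fin N) (Fin N) (Sphere 𝕜 q N) :=
  RingQuot.liftAlgHom 𝕜 ⟨preRightMatrix 𝕜 q, fun _ _ h => preRightMatrix_rel 𝕜 q hq h⟩

theorem rightMatrix_x (hq : 0 < q) (i j l : Fin N) :
    rightMatrix 𝕜 hq (xgen 𝕜 q j) i l = ∑ k, ((Rinv q k l i j : ℝ) : 𝕜) • xgen 𝕜 q k := by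
  have h : rightMatrix 𝕜 hq (xgen 𝕜 q j) = preRightMatrix 𝕜 q (fx 𝕜 j) :=
    RingQuot.liftAlgHom_mkAlgHom_apply _ _ _ _
  rw [h, preRightMatrix, fx, FreeAlgebra.lift_ι_apply]
  rfl

/-- Right multiplication by `y` on row vectors. -/
noncomputable def modelRight (hq : 0 < q) :
    (Sphere 𝕜 q N)ᵐᵒᵖ →ₐ[𝕜] Module.End 𝕜 (Fin N → Sphere 𝕜 q N) :=
  AlgHom.ofLinearMap
    { toFun := fun y =>
        { toFun := fun v => Matrix.vecMul v (rightMatrix 𝕜 hq y.unop)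
          map_add' := fun v w => Matrix.add_vecMul _ _ _
          map_smul' := fun c v => Matrix.smul_vecMul _ _ _ }
      map_add' := fun y z => LinearMap.ext fun v => by
        simp [Matrix.vecMul_add]
      map_smul' := fun c y => LinearMap.ext fun v => by
        simp [Matrix.vecMul_smul] }
    (LinearMap.ext fun v => by simp)
    (fun y z => LinearMap.ext fun v => by simp [Matrix.vecMul_vecMul])

/-- The bimodule structure on row vectors over `X`. -/
noncomputable def modelAct (hq : 0 < q) :
    Env 𝕜 (Sphere 𝕜 q N) →ₐ[𝕜] Module.End 𝕜 (Fin N → Sphere 𝕜 q N) :=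
  Algebra.TensorProduct.lift
    (Algebra.lsmul 𝕜 𝕜 (Fin N → Sphere 𝕜 q N))
    (modelRight 𝕜 hq)
    (fun y z => (commute_iff_eq _ _).2 (LinearMap.ext fun v =>
      (Matrix.smul_vecMul y v (rightMatrix 𝕜 hq z.unop)).symm))

variable (N) in
/-- The free left `X`-module `X^N` with the bimodule structure in which the standard basis
satisfies the commutation rule of `γ⁻`. -/
def FormModel (_ : 0 < q) : Type _ := Fin N → Sphere 𝕜 q N

noncomputable instance (hq : 0 < q) : AddCommGroup (FormModel 𝕜 N hq) :=
  inferInstanceAs (AddCommGroup (Fin N → Sphere 𝕜 q N))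

noncomputable instance (hq : 0 < q) : Module 𝕜 (FormModel 𝕜 N hq) :=
  inferInstanceAs (Module 𝕜 (Fin N → Sphere 𝕜 q N))

noncomputable instance (hq : 0 < q) : Module (Env 𝕜 (Sphere 𝕜 q N)) (FormModel 𝕜 N hq) :=
  Module.compHom (Fin N → Sphere 𝕜 q N) (modelAct 𝕜 hq).toRingHom

instance (hq : 0 < q) : IsScalarTower 𝕜 (Env 𝕜 (Sphere 𝕜 q N)) (FormModel 𝕜 N hq) where
  smul_assoc c e t := by
    change modelAct 𝕜 hq (c • e) _ = c • modelAct 𝕜 hq e _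
    rw [map_smul]
    rfl

theorem model_lmul (hq : 0 < q) (y : Sphere 𝕜 q N) (v : FormModel 𝕜 N hq) (i : Fin N) :
    lmul 𝕜 y v i = y * v i := by
  change modelAct 𝕜 hq (y ⊗ₜ 1) v i = _
  rw [modelAct, Algebra.TensorProduct.lift_tmul, map_one, mul_one]
  rfl

theorem model_rmul (hq : 0 < q) (y : Sphere 𝕜 q N) (v : FormModel 𝕜 N hq) :
    rmul 𝕜 v y = Matrix.vecMul v (rightMatrix 𝕜 hq y) := by
  change modelAct 𝕜 hq (1 ⊗ₜ MulOpposite.op y) v = _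
  rw [modelAct, Algebra.TensorProduct.lift_tmul, map_one, one_mul]
  rfl

theorem model_sum (hq : 0 < q) {ι : Type*} (s : Finset ι) (v : ι → FormModel 𝕜 N hq)
    (i : Fin N) : (∑ k ∈ s, v k) i = ∑ k ∈ s, v k i :=
  Finset.sum_apply i s v

/-- The standard basis of `X^N`. -/
noncomputable def modelBasis (hq : 0 < q) (i : Fin N) : FormModel 𝕜 N hq :=
  (Pi.single i 1 : Fin N → Sphere 𝕜 q N)

theorem modelBasis_apply (hq : 0 < q) (i l : Fin N) :
    modelBasis 𝕜 hq i l = if l = i then 1 else 0 :=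
  Pi.single_apply _ _ _

theorem modelBasis_commRule (hq : 0 < q) : CommRule 𝕜 q (Rinv q) (modelBasis 𝕜 hq (N := N)) := by
  intro i j
  rw [model_rmul]
  funext l
  have h : (tact 𝕜 (Rinv q) (fun k l => lmul 𝕜 (xgen 𝕜 q k) (modelBasis 𝕜 hq l)) i j) l
      = tact 𝕜 (Rinv q) (fun k l' => (lmul 𝕜 (xgen 𝕜 q k) (modelBasis 𝕜 hq l')) l) i j :=
    map_tact 𝕜 (LinearMap.proj l : (Fin N → Sphere 𝕜 q N) →ₗ[𝕜] Sphere 𝕜 q N) _ _ _ _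
  rw [h]
  change Matrix.vecMul (Pi.single i 1) _ l = _
  rw [Matrix.single_one_vecMul]
  change rightMatrix 𝕜 hq (xgen 𝕜 q j) i l = _
  rw [rightMatrix_x]
  simp [tact, model_lmul, modelBasis_apply]

/-- The inner derivation `y ↦ ν (ω y - y ω)` of `X^N`, where `ω = C^{kl} x_k e_l` and
`ν = q (1 + q^{N-2}) / ((1 - q) (1 + q))`. -/
noncomputable def modelD (hq : 0 < q) : Sphere 𝕜 q N →ₗ[𝕜] FormModel 𝕜 N hq where
  toFun y := ((muConst q N / (1 - q) : ℝ) : 𝕜) •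
    (rmul 𝕜 (contrForm 𝕜 q (modelBasis 𝕜 hq)) y - lmul 𝕜 y (contrForm 𝕜 q (modelBasis 𝕜 hq)))
  map_add' y z := by
    rw [rmul_add, add_lmul]
    module
  map_smul' c y := by
    rw [rmul_smul, smul_lmul, RingHom.id_apply]
    module

theorem modelD_mul (hq : 0 < q) (y z : Sphere 𝕜 q N) :
    modelD 𝕜 hq (y * z) = rmul 𝕜 (modelD 𝕜 hq y) z + lmul 𝕜 y (modelD 𝕜 hq z) := by
  simp only [modelD, LinearMap.coe_mk, AddHom.coe_mk]
  rw [smul_rmul, lmul_smul, sub_rmul, lmul_sub, rmul_rmul, lmul_lmul, lmul_rmul]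
  module

theorem modelD_x (hq : 0 < q) (hq1 : q ≠ 1) (i : Fin N) : modelD 𝕜 hq (xgen 𝕜 q i)
    = modelBasis 𝕜 hq i - ((muConst q N : ℝ) : 𝕜) •
      lmul 𝕜 (xgen 𝕜 q i) (contrForm 𝕜 q (modelBasis 𝕜 hq)) := by
  simp only [modelD, LinearMap.coe_mk, AddHom.coe_mk]
  rw [contrForm_rmul hq (modelBasis_commRule 𝕜 hq), sphereCoeff_sub hq, muConst]
  have hp : 0 < q ^ ((N : ℤ) - 2) := zpow_pos hq _
  generalize q ^ ((N : ℤ) - 2) = p at *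
  have e1 : (q : 𝕜) ≠ 0 := by exact_mod_cast hq.ne'
  have e2 : (1 + p : 𝕜) ≠ 0 := by exact_mod_cast (by positivity : (1 + p : ℝ) ≠ 0)
  have e3 : (1 + q : 𝕜) ≠ 0 := by exact_mod_cast (by positivity : (1 + q : ℝ) ≠ 0)
  have e4 : (1 - q : 𝕜) ≠ 0 := by exact_mod_cast sub_ne_zero.2 hq1.symm
  push_cast
  match_scalars <;> field_simp <;> ring

/-- The bimodule map from the free bimodule of forms to the model. -/
noncomputable def preModel (hq : 0 < q) :
    FreeForms 𝕜 q N →ₗ[Env 𝕜 (Sphere 𝕜 q N)] FormModel 𝕜 N hq :=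
  TensorProduct.AlgebraTensorModule.lift
    (LinearMap.toSpanSingleton (Env 𝕜 (Sphere 𝕜 q N)) _ (modelD 𝕜 hq))

theorem preModel_fd (hq : 0 < q) (y : Sphere 𝕜 q N) :
    preModel 𝕜 hq (fd 𝕜 q y) = modelD 𝕜 hq y := by
  change (1 : Env 𝕜 (Sphere 𝕜 q N)) • modelD 𝕜 hq y = _
  rw [one_smul]

theorem preModel_rel (hq : 0 < q) (hq1 : q ≠ 1) (hN : 3 ≤ N) {t} (ht : t ∈ gammaRel 𝕜 q N) :
    preModel 𝕜 hq t = 0 := by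
  rcases ht with ⟨y, z, rfl⟩ | ⟨i, j, rfl⟩
  · rw [map_sub, map_add, map_rmul, map_lmul, preModel_fd, preModel_fd, preModel_fd, modelD_mul,
      sub_self]
  · rw [← plusDefect_eq_zero hq hq1 hN (modelBasis_commRule 𝕜 hq) (modelD_x 𝕜 hq hq1) i j]
    have hs : ∀ (c : 𝕜) t, preModel 𝕜 hq (c • t : FreeForms 𝕜 q N) = c • preModel 𝕜 hq t :=
      ((preModel 𝕜 hq).restrictScalars 𝕜).map_smul
    simp only [plusDefect, map_sub, map_add, map_sum, hs, map_rmul, map_lmul, preModel_fd]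

/-- The bimodule map from `Γ₊` to the model. -/
noncomputable def toModel (hq : 0 < q) (hq1 : q ≠ 1) (hN : 3 ≤ N) :
    Gam 𝕜 q N →ₗ[Env 𝕜 (Sphere 𝕜 q N)] FormModel 𝕜 N hq :=
  Submodule.liftQ _ (preModel 𝕜 hq) (Submodule.span_le.2 fun _ ht =>
    LinearMap.mem_ker.2 (preModel_rel 𝕜 hq hq1 hN ht))

theorem toModel_dif (hq : 0 < q) (hq1 : q ≠ 1) (hN : 3 ≤ N) (y : Sphere 𝕜 q N) :
    toModel 𝕜 hq hq1 hN (dif 𝕜 q N y) = modelD 𝕜 hq y :=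
  preModel_fd 𝕜 hq y

end ModelBimodule

/-! ### Left linear combinations -/

section LeftCombinations

variable (𝕜 : Type*) [Field 𝕜] {A : Type*} [Ring A] [Algebra 𝕜 A]
variable {M : Type*} [AddCommGroup M] [Module 𝕜 M] [Module (Env 𝕜 A) M]
  [IsScalarTower 𝕜 (Env 𝕜 A) M]

variable (A) in
/-- The left linear combinations `c ↦ ∑ c_i γ_i` of a family `γ`. -/
noncomputable def lcomb {ι : Type*} [Fintype ι] (γ : ι → M) : (ι → A) →ₗ[𝕜] M where
  toFun c := ∑ i, lmul 𝕜 (c i) (γ i)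
  map_add' c d := by simp only [Pi.add_apply, add_lmul, Finset.sum_add_distrib]
  map_smul' a c := by
    simp only [Pi.smul_apply, smul_lmul, ← Finset.smul_sum, RingHom.id_apply]

theorem lcomb_apply {ι : Type*} [Fintype ι] (γ : ι → M) (c : ι → A) :
    lcomb 𝕜 A γ c = ∑ i, lmul 𝕜 (c i) (γ i) := rfl

theorem lmul_lcomb {ι : Type*} [Fintype ι] (γ : ι → M) (y : A)
    (c : ι → A) : lmul 𝕜 y (lcomb 𝕜 A γ c) = lcomb 𝕜 A γ (y • c) := by
  simp only [lcomb_apply, lmul_sum, lmul_lmul, Pi.smul_apply, smul_eq_mul]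

theorem lmul_mem_range {ι : Type*} [Fintype ι] {γ : ι → M} (y : A) {w : M}
    (hw : w ∈ LinearMap.range (lcomb 𝕜 A γ)) : lmul 𝕜 y w ∈ LinearMap.range (lcomb 𝕜 A γ) := by
  obtain ⟨c, rfl⟩ := hw
  exact ⟨y • c, (lmul_lcomb 𝕜 γ y c).symm⟩

theorem lcomb_single {ι : Type*} [Fintype ι] [DecidableEq ι] (γ : ι → M) (i : ι) :
    lcomb 𝕜 A γ (Pi.single i 1) = γ i := by
  rw [lcomb_apply, Finset.sum_eq_single i]
  · rw [Pi.single_eq_same, one_lmul]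
  · intro j _ hj
    rw [Pi.single_eq_of_ne hj, zero_lmul]
  · simp

theorem mem_range_lcomb {ι : Type*} [Fintype ι] (γ : ι → M) (i : ι) :
    γ i ∈ LinearMap.range (lcomb 𝕜 A γ : (ι → A) →ₗ[𝕜] M) := by
  classical
  exact ⟨Pi.single i 1, lcomb_single 𝕜 γ i⟩

end LeftCombinations

/-! ### Bimodules over the sphere -/

section SphereBimodules

variable (𝕜 : Type*) [RCLike 𝕜] {q : ℝ} {N : ℕ}

section Membership

variable {M : Type*} [AddCommGroup M] [Module 𝕜 M]

theorem tact_mem {P : Submodule 𝕜 M} {f : Fin N → Fin N → M} (hf : ∀ k l, f k l ∈ P)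
    (T : Fin N → Fin N → Fin N → Fin N → ℝ) (i j : Fin N) : tact 𝕜 T f i j ∈ P :=
  P.sum_mem fun k _ => P.sum_mem fun l _ => P.smul_mem _ (hf k l)

theorem mcontr_mem {P : Submodule 𝕜 M} {f : Fin N → Fin N → M} (hf : ∀ k l, f k l ∈ P) :
    mcontr 𝕜 q f ∈ P :=
  P.sum_mem fun k _ => P.sum_mem fun l _ => P.smul_mem _ (hf k l)

end Membership

variable {M : Type*} [AddCommGroup M] [Module 𝕜 M] [Module (Env 𝕜 (Sphere 𝕜 q N)) M]
  [IsScalarTower 𝕜 (Env 𝕜 (Sphere 𝕜 q N)) M]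

theorem sphere_induction {p : Sphere 𝕜 q N → Prop} (h1 : p 1) (hx : ∀ i, p (xgen 𝕜 q i))
    (hmul : ∀ y z, p y → p z → p (y * z)) (hadd : ∀ y z, p y → p z → p (y + z))
    (hsmul : ∀ (c : 𝕜) y, p y → p (c • y)) (y : Sphere 𝕜 q N) : p y := by
  obtain ⟨a, rfl⟩ := RingQuot.mkAlgHom_surjective 𝕜 (SphereRel 𝕜 q N) y
  induction a using FreeAlgebra.induction with
  | grade0 c =>
    rw [AlgHom.commutes, Algebra.algebraMap_eq_smul_one]
    exact hsmul c 1 h1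
  | grade1 i => exact hx i
  | mul a b ha hb => rw [map_mul]; exact hmul _ _ ha hb
  | add a b ha hb => rw [map_add]; exact hadd _ _ ha hb

theorem commRule_of_injective {M' : Type*} [AddCommGroup M'] [Module 𝕜 M']
    [Module (Env 𝕜 (Sphere 𝕜 q N)) M'] [IsScalarTower 𝕜 (Env 𝕜 (Sphere 𝕜 q N)) M']
    (φ : M →ₗ[Env 𝕜 (Sphere 𝕜 q N)] M') (hφ : Function.Injective φ)
    {S : Fin N → Fin N → Fin N → Fin N → ℝ} {γ : Fin N → M}
    (h : CommRule 𝕜 q S (fun i => φ (γ i))) : CommRule 𝕜 q S γ := by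
  intro i j
  apply hφ
  rw [map_rmul, h i j]
  have := map_tact 𝕜 (φ.restrictScalars 𝕜) S (fun k l => lmul 𝕜 (xgen 𝕜 q k) (γ l)) i j
  simp only [LinearMap.restrictScalars_apply, map_lmul] at this
  exact this.symm

/-- If the `e_i` commute with `X` through `R⁻¹`, then the `e_i - (1 + q^{N-2}) x_i ω` commute with
`X` through `R`. -/
theorem commRule_Rmat (hq : 0 < q) {e : Fin N → M} (he : CommRule 𝕜 q (Rinv q) e) :
    CommRule 𝕜 q (Rmat q) (fun i => e i - ((1 + q ^ ((N : ℤ) - 2) : ℝ) : 𝕜) •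
      lmul 𝕜 (xgen 𝕜 q i) (contrForm 𝕜 q e)) := by
  intro i j
  have h : ∀ k l : Fin N, lmul 𝕜 (xgen 𝕜 q k) (e l - ((1 + q ^ ((N : ℤ) - 2) : ℝ) : 𝕜) •
      lmul 𝕜 (xgen 𝕜 q l) (contrForm 𝕜 q e)) = lmul 𝕜 (xgen 𝕜 q k) (e l)
        + (-((1 + q ^ ((N : ℤ) - 2) : ℝ) : 𝕜)) •
          lmul 𝕜 (xgen 𝕜 q k * xgen 𝕜 q l) (contrForm 𝕜 q e) := by
    intro k l
    rw [lmul_sub, lmul_smul, lmul_lmul]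
    module
  simp only [h, tact_add, tact_smul, tact_Rmat, mcontr_lmul_xx, tact_lmul_xx]
  have hs := sphereCoeff_sub hq N
  have hs' : sphereCoeff q N = (q - q⁻¹) - ((q - q⁻¹) / (1 + q ^ ((N : ℤ) - 2))) := by
    linear_combination hs
  rw [sub_rmul, smul_rmul, he i j, ← lmul_rmul, contrForm_rmul hq he, lmul_add, lmul_smul,
    lmul_smul, lmul_lmul, hs, hs', ← contrForm]
  have hp : 0 < q ^ ((N : ℤ) - 2) := zpow_pos hq _
  generalize q ^ ((N : ℤ) - 2) = p at *
  have e1 : (q : 𝕜) ≠ 0 := by exact_mod_cast hq.ne'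
  have e2 : (1 + p : 𝕜) ≠ 0 := by exact_mod_cast (by positivity : (1 + p : ℝ) ≠ 0)
  push_cast
  match_scalars <;> field_simp <;> ring

end SphereBimodules

/-! ### The left basis and its commutation rules -/

section Basis

variable (𝕜 : Type*) [RCLike 𝕜] {q : ℝ} {N : ℕ}

theorem dif_one : dif 𝕜 q N 1 = 0 := by
  have h := dif_mul 𝕜 q (1 : Sphere 𝕜 q N) 1
  rw [mul_one, rmul_one, one_lmul] at h
  exact left_eq_add.1 h

/-- The differentials `dx_i` generate `Γ₊` as a left module. -/
theorem range_lcomb_dif :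
    LinearMap.range (lcomb 𝕜 (Sphere 𝕜 q N) (fun i : Fin N => dif 𝕜 q N (xgen 𝕜 q i))) = ⊤ := by
  set L := LinearMap.range (lcomb 𝕜 (Sphere 𝕜 q N) (fun i : Fin N => dif 𝕜 q N (xgen 𝕜 q i)))
  have hl : ∀ (y : Sphere 𝕜 q N) {w}, w ∈ L → lmul 𝕜 y w ∈ L := fun y _ => lmul_mem_range 𝕜 y
  have hd : ∀ i : Fin N, dif 𝕜 q N (xgen 𝕜 q i) ∈ L := fun i =>
    mem_range_lcomb 𝕜 (fun i : Fin N => dif 𝕜 q N (xgen 𝕜 q i)) i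
  have hr : ∀ (y : Sphere 𝕜 q N), ∀ w ∈ L, rmul 𝕜 w y ∈ L := by
    intro y
    induction y using sphere_induction with
    | h1 => intro w hw; rwa [rmul_one]
    | hx j =>
      rintro _ ⟨c, rfl⟩
      rw [lcomb_apply, sum_rmul]
      refine L.sum_mem fun i _ => ?_
      rw [← lmul_rmul]
      refine hl _ ?_
      have h := plusDefect_dif 𝕜 q i j
      rw [plusDefect, sub_eq_zero] at h
      rw [h]
      refine L.add_mem (L.add_mem (L.add_mem ?_ ?_) ?_) ?_
      · exact tact_mem 𝕜 (fun k l => hl _ (hd l)) _ _ _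
      · exact L.smul_mem _ (hl _ (hd j))
      · exact L.smul_mem _ (tact_mem 𝕜 (fun k l => hl _ (hd l)) _ _ _)
      · exact L.smul_mem _ (mcontr_mem 𝕜 fun k l => hl _ (hd l))
    | hmul y z hy hz => intro w hw; rw [← rmul_rmul]; exact hz _ (hy _ hw)
    | hadd y z hy hz => intro w hw; rw [rmul_add]; exact L.add_mem (hy _ hw) (hz _ hw)
    | hsmul c y hy => intro w hw; rw [rmul_smul]; exact L.smul_mem _ (hy _ hw)
  have hdif : ∀ y : Sphere 𝕜 q N, dif 𝕜 q N y ∈ L := by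
    intro y
    induction y using sphere_induction with
    | h1 => rw [dif_one]; exact L.zero_mem
    | hx j => exact hd j
    | hmul y z hy hz => rw [dif_mul]; exact L.add_mem (hr _ _ hy) (hl _ hz)
    | hadd y z hy hz => rw [map_add]; exact L.add_mem hy hz
    | hsmul c y hy => rw [map_smul]; exact L.smul_mem _ hy
  rw [Submodule.eq_top_iff']
  intro w
  obtain ⟨t, rfl⟩ := Submodule.Quotient.mk_surjective _ w
  change gamMk 𝕜 q N t ∈ L
  induction t using freeForms_induction with
  | h0 => rw [map_zero]; exact L.zero_mem
  | h1 f y =>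
    rw [map_smul, gamMk_fd]
    induction f using TensorProduct.induction_on with
    | zero =>
      rw [← TensorProduct.zero_tmul (Sphere 𝕜 q N) (MulOpposite.op (0 : Sphere 𝕜 q N)),
        env_smul_eq]
      exact hl _ (hr _ _ (hdif y))
    | add f g hf hg => rw [add_smul]; exact L.add_mem hf hg
    | tmul a b =>
      obtain ⟨b, rfl⟩ := MulOpposite.op_surjective b
      rw [env_smul_eq]
      exact hl _ (hr _ _ (hdif y))
  | h2 s t hs ht => rw [map_add]; exact L.add_mem hs ht

/-- The forms `dx_i + s x_i η`. -/
noncomputable def gammaForm (q : ℝ) {N : ℕ} (s : ℝ) (i : Fin N) : Gam 𝕜 q N :=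
  dif 𝕜 q N (xgen 𝕜 q i) + (s : 𝕜) • lmul 𝕜 (xgen 𝕜 q i) (eta 𝕜 q N)

theorem contrForm_gammaForm (s : ℝ) :
    contrForm 𝕜 q (gammaForm 𝕜 q s) = ((1 + s : ℝ) : 𝕜) • eta 𝕜 q N := by
  simp only [contrForm, gammaForm, lmul_add, lmul_smul, mcontr_add, mcontr_smul, lmul_lmul,
    mcontr_lmul_xx]
  push_cast
  rw [add_smul, one_smul]
  rfl

/-- The forms `dx_i + s x_i η` generate `Γ₊` as a left module if `s ≠ -1`. -/
theorem range_lcomb_gammaForm {s : ℝ} (hs : 1 + s ≠ 0) :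
    LinearMap.range (lcomb 𝕜 (Sphere 𝕜 q N) (gammaForm 𝕜 q s (N := N))) = ⊤ := by
  have hs' : ((1 + s : ℝ) : 𝕜) ≠ 0 := by exact_mod_cast hs
  have hη : eta 𝕜 q N ∈ LinearMap.range (lcomb 𝕜 (Sphere 𝕜 q N) (gammaForm 𝕜 q s (N := N))) := by
    rw [← inv_smul_smul₀ hs' (eta 𝕜 q N), ← contrForm_gammaForm]
    exact Submodule.smul_mem _ _ (mcontr_mem 𝕜 fun k l =>
      lmul_mem_range 𝕜 _ (mem_range_lcomb 𝕜 (gammaForm 𝕜 q s) l))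
  rw [eq_top_iff, ← range_lcomb_dif]
  rintro _ ⟨c, rfl⟩
  rw [lcomb_apply]
  refine Submodule.sum_mem _ fun i _ => lmul_mem_range 𝕜 _ ?_
  have : dif 𝕜 q N (xgen 𝕜 q i)
      = gammaForm 𝕜 q s i - (s : 𝕜) • lmul 𝕜 (xgen 𝕜 q i) (eta 𝕜 q N) := by
    rw [gammaForm]; abel
  rw [this]
  exact Submodule.sub_mem _ (mem_range_lcomb 𝕜 _ i)
    (Submodule.smul_mem _ _ (lmul_mem_range 𝕜 _ hη))

/-- The image of `dx_i + s x_i η` in the model. -/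
theorem toModel_gammaForm (hq : 0 < q) (hq1 : q ≠ 1) (hN : 3 ≤ N) (s : ℝ) (i : Fin N) :
    toModel 𝕜 hq hq1 hN (gammaForm 𝕜 q s i) = modelBasis 𝕜 hq i
      - ((1 - (1 + s) * (1 - muConst q N) : ℝ) : 𝕜) •
        lmul 𝕜 (xgen 𝕜 q i) (contrForm 𝕜 q (modelBasis 𝕜 hq)) := by
  have hsm : ∀ (c : 𝕜) w, toModel 𝕜 hq hq1 hN (c • w) = c • toModel 𝕜 hq hq1 hN w :=
    ((toModel 𝕜 hq hq1 hN).restrictScalars 𝕜).map_smul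
  have hη : toModel 𝕜 hq hq1 hN (eta 𝕜 q N)
      = ((1 - muConst q N : ℝ) : 𝕜) • contrForm 𝕜 q (modelBasis 𝕜 hq) := by
    have h := map_mcontr 𝕜 ((toModel 𝕜 hq hq1 hN).restrictScalars 𝕜) q
      (fun k l => lmul 𝕜 (xgen 𝕜 q k) (dif 𝕜 q N (xgen 𝕜 q l)))
    simp only [LinearMap.restrictScalars_apply, map_lmul, toModel_dif, modelD_x 𝕜 hq hq1,
      lmul_sub, lmul_smul, lmul_lmul] at h
    refine h.trans ?_
    simp only [sub_eq_add_neg, ← neg_smul, mcontr_add, mcontr_smul, mcontr_lmul_xx]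
    rw [← contrForm]
    push_cast
    module
  rw [gammaForm, map_add, hsm, map_lmul, hη, toModel_dif, modelD_x 𝕜 hq hq1, lmul_smul]
  push_cast
  module

theorem contrForm_modelBasis (hq : 0 < q) (j : Fin N) :
    contrForm 𝕜 q (modelBasis 𝕜 hq) j = ∑ k, ((metric q k j : ℝ) : 𝕜) • xgen 𝕜 q k := by
  have h := map_mcontr 𝕜 (LinearMap.proj j : (Fin N → Sphere 𝕜 q N) →ₗ[𝕜] Sphere 𝕜 q N) q
    (fun k l => lmul 𝕜 (xgen 𝕜 q k) (modelBasis 𝕜 hq l))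
  refine h.trans ?_
  change mcontr 𝕜 q (fun k l => lmul 𝕜 (xgen 𝕜 q k) (modelBasis 𝕜 hq l) j) = _
  simp [mcontr, model_lmul, modelBasis_apply]

/-- The coordinates `ω_j` of `ω = C^{kl} x_k e_l` satisfy `∑ ω_j x_j = 1`, which is the equation of
the sphere. -/
theorem sum_contrForm_modelBasis (hq : 0 < q) :
    ∑ j : Fin N, contrForm 𝕜 q (modelBasis 𝕜 hq) j * xgen 𝕜 q j = 1 := by
  simp only [contrForm_modelBasis, Finset.sum_mul, smul_mul_assoc]
  rw [Finset.sum_comm]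
  exact mcontr_xx 𝕜 q

/-- A left combination `∑ a_i (dx_i + s x_i η)` that vanishes in the model is trivial: the
coordinates in the model express the `a_j` through `b = ∑ a_i x_i`, and contraction with the `x_j`
gives `b = t b` with `t ≠ 1`. -/
theorem eq_zero_of_toModel (hq : 0 < q) (hq1 : q ≠ 1) (hN : 3 ≤ N) {s : ℝ} (hs : 1 + s ≠ 0)
    {a : Fin N → Sphere 𝕜 q N}
    (ha : toModel 𝕜 hq hq1 hN (lcomb 𝕜 (Sphere 𝕜 q N) (gammaForm 𝕜 q s) a) = 0) : a = 0 := by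
  set t : ℝ := 1 - (1 + s) * (1 - muConst q N) with ht
  set b : Sphere 𝕜 q N := ∑ i, a i * xgen 𝕜 q i with hb
  have h1 : ∀ j, a j = (t : 𝕜) • (b * contrForm 𝕜 q (modelBasis 𝕜 hq) j) := by
    intro j
    have h := congrFun ha j
    rw [lcomb_apply, map_sum] at h
    simp only [map_lmul, toModel_gammaForm, lmul_sub, lmul_smul, lmul_lmul] at h
    rw [Finset.sum_sub_distrib] at h
    change (∑ i, lmul 𝕜 (a i) (modelBasis 𝕜 hq i)) j - (∑ i, (t : 𝕜) • lmul 𝕜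
      (a i * xgen 𝕜 q i) (contrForm 𝕜 q (modelBasis 𝕜 hq))) j = 0 at h
    rw [model_sum, model_sum] at h
    simp only [model_lmul, modelBasis_apply, mul_ite, mul_one, mul_zero, Finset.sum_ite_eq,
      Finset.mem_univ, if_true] at h
    rw [sub_eq_zero] at h
    rw [h, hb, Finset.sum_mul, Finset.smul_sum]
    refine Finset.sum_congr rfl fun i _ => ?_
    change (t : 𝕜) • (lmul 𝕜 (a i * xgen 𝕜 q i) (contrForm 𝕜 q (modelBasis 𝕜 hq))) j = _
    rw [model_lmul]
  have h2 : b = (t : 𝕜) • b := by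
    conv_lhs => rw [hb]
    simp only [h1, smul_mul_assoc, mul_assoc]
    rw [← Finset.smul_sum, ← Finset.mul_sum, sum_contrForm_modelBasis, mul_one]
  have h3 : 1 - muConst q N ≠ 0 := by
    have h4 := one_sub_zpow_ne hq hq1 hN
    have h5 : 1 - muConst q N = (1 - q * q ^ ((N : ℤ) - 2)) / (1 + q) := by
      rw [muConst]; field_simp; ring
    rw [h5]
    exact div_ne_zero h4 (by positivity)
  have h4 : ((1 - t : ℝ) : 𝕜) ≠ 0 := by
    rw [ht, sub_sub_cancel]
    exact_mod_cast mul_ne_zero hs h3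
  have h5 : b = 0 := by
    refine (smul_eq_zero.1 ?_).resolve_left h4
    rw [RCLike.ofReal_sub, RCLike.ofReal_one, sub_smul, one_smul, ← h2, sub_self]
  funext j
  rw [h1 j, h5, zero_mul, smul_zero, Pi.zero_apply]

theorem lcomb_gammaForm_bijective (hq : 0 < q) (hq1 : q ≠ 1) (hN : 3 ≤ N) {s : ℝ}
    (hs : 1 + s ≠ 0) : Function.Bijective (lcomb 𝕜 (Sphere 𝕜 q N) (gammaForm 𝕜 q s (N := N))) := by
  refine ⟨?_, LinearMap.range_eq_top.1 (range_lcomb_gammaForm 𝕜 hs)⟩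
  rw [← LinearMap.ker_eq_bot, LinearMap.ker_eq_bot']
  intro a ha
  refine eq_zero_of_toModel 𝕜 hq hq1 hN hs ?_
  rw [ha, map_zero]

theorem toModel_injective (hq : 0 < q) (hq1 : q ≠ 1) (hN : 3 ≤ N) :
    Function.Injective (toModel 𝕜 hq hq1 hN) := by
  rw [injective_iff_map_eq_zero]
  intro w hw
  obtain ⟨a, rfl⟩ := (lcomb_gammaForm_bijective 𝕜 hq hq1 hN (s := 0) (by norm_num)).2 w
  rw [eq_zero_of_toModel 𝕜 hq hq1 hN (by norm_num) hw, map_zero]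

theorem commRule_gammaForm_Rinv (hq : 0 < q) (hq1 : q ≠ 1) (hN : 3 ≤ N) {s : ℝ}
    (hs : (1 + s) * (1 - muConst q N) = 1) :
    CommRule 𝕜 q (Rinv q) (gammaForm 𝕜 q s (N := N)) := by
  refine commRule_of_injective 𝕜 _ (toModel_injective 𝕜 hq hq1 hN) ?_
  simp only [toModel_gammaForm, hs, sub_self, RCLike.ofReal_zero, zero_smul, sub_zero]
  exact modelBasis_commRule 𝕜 hq

theorem commRule_gammaForm_Rmat (hq : 0 < q) (hq1 : q ≠ 1) (hN : 3 ≤ N) {s : ℝ}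
    (hs : (1 + s) * (1 - muConst q N) = -q ^ ((N : ℤ) - 2)) :
    CommRule 𝕜 q (Rmat q) (gammaForm 𝕜 q s (N := N)) := by
  refine commRule_of_injective 𝕜 _ (toModel_injective 𝕜 hq hq1 hN) ?_
  simp only [toModel_gammaForm, hs, sub_neg_eq_add]
  exact commRule_Rmat 𝕜 hq (modelBasis_commRule 𝕜 hq)

theorem coactGam_gammaForm (s : ℝ) (i : Fin N) :
    coactGam 𝕜 q N (gammaForm 𝕜 q s i) = ∑ a, gammaForm 𝕜 q s a ⊗ₜ[𝕜] ugen 𝕜 q a i := by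
  have hη : coactGam 𝕜 q N (eta 𝕜 q N) = eta 𝕜 q N ⊗ₜ 1 := by
    rw [← preCoact_eta, ← coactGam_gamMk]
    congr 1
    simp only [map_sum, gamMk_smul, gamMk_lmul, gamMk_fd]
    rfl
  rw [gammaForm, map_add, map_smul, coactGam_lmul, hη, coactGam_dif, coactX_x]
  simp only [map_sum, LinearMap.sum_apply, LinearMap.rTensor_tmul, coLeft_tmul, mul_one,
    Finset.smul_sum, ← Finset.sum_add_distrib, gammaForm, TensorProduct.add_tmul,
    TensorProduct.smul_tmul']

end Basis

/-! ### Maps defined on a left basis -/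

section LeftBases

variable {𝕜 : Type*} [Field 𝕜] {A : Type*} [Ring A] [Algebra 𝕜 A]
variable {M : Type*} [AddCommGroup M] [Module 𝕜 M] [Module (Env 𝕜 A) M]
  [IsScalarTower 𝕜 (Env 𝕜 A) M]
variable {M' : Type*} [AddCommGroup M'] [Module 𝕜 M'] [Module (Env 𝕜 A) M']
  [IsScalarTower 𝕜 (Env 𝕜 A) M']
variable {ι κ : Type*} [Fintype ι] [Fintype κ]

/-- Two linear maps that transform in the same way under left multiplication and agree on a
family of left generators are equal. -/
theorem ext_of_left_generators {γ : ι → M} (hγ : Function.Surjective (lcomb 𝕜 A γ))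
    {Q : Type*} [AddCommGroup Q] [Module 𝕜 Q] {f g : M →ₗ[𝕜] Q} (T : A → Q → Q)
    (hf : ∀ a m, f (lmul 𝕜 a m) = T a (f m)) (hg : ∀ a m, g (lmul 𝕜 a m) = T a (g m))
    (h : ∀ i, f (γ i) = g (γ i)) : f = g := by
  refine LinearMap.ext fun m => ?_
  obtain ⟨c, rfl⟩ := hγ m
  simp only [lcomb_apply, map_sum, hf, hg, h]

theorem btmul_sum_left {ι : Type*} (s : Finset ι) (m : ι → M) (n : M') :
    btmul 𝕜 A (∑ i ∈ s, m i) n = ∑ i ∈ s, btmul 𝕜 A (m i) n :=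
  map_sum ((bmk 𝕜 A M M').flip n) m s

theorem btmul_sum_right {ι : Type*} (s : Finset ι) (m : M) (n : ι → M') :
    btmul 𝕜 A m (∑ i ∈ s, n i) = ∑ i ∈ s, btmul 𝕜 A m (n i) :=
  map_sum (bmk 𝕜 A M M' m) n s

/-- Left generators of two bimodules give left generators of their tensor product. -/
theorem lcomb_btmul_surjective {γ : ι → M} (hγ : Function.Surjective (lcomb 𝕜 A γ))
    {γ' : κ → M'} (hγ' : Function.Surjective (lcomb 𝕜 A γ')) :
    Function.Surjective (lcomb 𝕜 A (fun p : ι × κ => btmul 𝕜 A (γ p.1) (γ' p.2))) := by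
  rw [← LinearMap.range_eq_top, Submodule.eq_top_iff']
  set L := LinearMap.range (lcomb 𝕜 A (fun p : ι × κ => btmul 𝕜 A (γ p.1) (γ' p.2)))
  have h1 : ∀ v j, btmul 𝕜 A v (γ' j) ∈ L := by
    intro v j
    obtain ⟨c, rfl⟩ := hγ v
    rw [lcomb_apply, btmul_sum_left]
    refine L.sum_mem fun i _ => ?_
    rw [← lmul_btmul]
    exact lmul_mem_range 𝕜 _
      (mem_range_lcomb 𝕜 (fun p : ι × κ => btmul 𝕜 A (γ p.1) (γ' p.2)) (i, j))
  intro t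
  induction t using bTensor_induction with
  | h0 => exact L.zero_mem
  | h1 v w =>
    obtain ⟨c, rfl⟩ := hγ' w
    rw [lcomb_apply, btmul_sum_right]
    refine L.sum_mem fun j _ => ?_
    rw [← rmul_btmul]
    exact h1 _ j
  | h2 s t hs ht => exact L.add_mem hs ht

/-- A linear map that respects left and right multiplication, as a bimodule homomorphism. -/
def bimoduleHom (f : M →ₗ[𝕜] M') (hl : ∀ (a : A) m, f (lmul 𝕜 a m) = lmul 𝕜 a (f m))
    (hr : ∀ m (a : A), f (rmul 𝕜 m a) = rmul 𝕜 (f m) a) : M →ₗ[Env 𝕜 A] M' where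
  toFun := f
  map_add' := map_add f
  map_smul' e m := by
    rw [RingHom.id_apply]
    induction e using TensorProduct.induction_on with
    | zero =>
      rw [← TensorProduct.zero_tmul A (MulOpposite.op (0 : A)), env_smul_eq, env_smul_eq, hl, hr]
    | add e e' h h' => rw [add_smul, add_smul, map_add, h, h']
    | tmul a b =>
      obtain ⟨b, rfl⟩ := MulOpposite.op_surjective b
      rw [env_smul_eq, env_smul_eq, hl, hr]

/-- The coordinates with respect to a left basis. -/
noncomputable def coords {γ : ι → M} (hγ : Function.Bijective (lcomb 𝕜 A γ)) :
    M ≃ₗ[𝕜] (ι → A) :=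
  (LinearEquiv.ofBijective (lcomb 𝕜 A γ) hγ).symm

theorem coords_lcomb {γ : ι → M} (hγ : Function.Bijective (lcomb 𝕜 A γ)) (c : ι → A) :
    coords hγ (lcomb 𝕜 A γ c) = c :=
  (LinearEquiv.ofBijective (lcomb 𝕜 A γ) hγ).symm_apply_apply c

theorem coords_lmul {γ : ι → M} (hγ : Function.Bijective (lcomb 𝕜 A γ)) (a : A) (m : M) :
    coords hγ (lmul 𝕜 a m) = a • coords hγ m := by
  obtain ⟨c, rfl⟩ := hγ.2 m
  rw [lmul_lcomb, coords_lcomb, coords_lcomb]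

theorem coords_self [DecidableEq ι] {γ : ι → M} (hγ : Function.Bijective (lcomb 𝕜 A γ)) (i : ι) :
    coords hγ (γ i) = Pi.single i 1 := by
  conv_lhs => rw [← lcomb_single 𝕜 (A := A) γ i]
  rw [coords_lcomb]

/-- The left linear map `M → M'` with prescribed values on a left basis. -/
noncomputable def basisMap {γ : ι → M} (hγ : Function.Bijective (lcomb 𝕜 A γ)) (τ : ι → M') :
    M →ₗ[𝕜] M' := (lcomb 𝕜 A τ).comp (coords hγ).toLinearMap

theorem basisMap_lmul {γ : ι → M} (hγ : Function.Bijective (lcomb 𝕜 A γ)) (τ : ι → M') (a : A)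
    (m : M) : basisMap hγ τ (lmul 𝕜 a m) = lmul 𝕜 a (basisMap hγ τ m) := by
  change lcomb 𝕜 A τ (coords hγ _) = lmul 𝕜 a (lcomb 𝕜 A τ (coords hγ m))
  rw [coords_lmul, lmul_lcomb]

theorem basisMap_self {γ : ι → M} (hγ : Function.Bijective (lcomb 𝕜 A γ)) (τ : ι → M') (i : ι) :
    basisMap hγ τ (γ i) = τ i := by
  classical
  change lcomb 𝕜 A τ (coords hγ _) = _
  rw [coords_self, lcomb_single]

/-- The bilinear map `(v, w) ↦ ∑_j g_j (v w_j)`, where `w = ∑_j w_j γ_j` and `g_j` is the left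
linear map with values `g_j (γ_i) = τ_{ij}`. -/
noncomputable def basisMap₂Aux {γ : ι → M} (hγ : Function.Bijective (lcomb 𝕜 A γ))
    (τ : ι → ι → M') : M →ₗ[𝕜] M →ₗ[𝕜] M' :=
  LinearMap.mk₂ 𝕜
    (fun v w => ∑ j, basisMap hγ (fun i => τ i j) (rmul 𝕜 v (coords hγ w j)))
    (fun v v' w => by simp only [add_rmul, map_add, Finset.sum_add_distrib])
    (fun c v w => by simp only [smul_rmul, map_smul, Finset.smul_sum])
    (fun v w w' => by simp only [map_add, Pi.add_apply, rmul_add, Finset.sum_add_distrib])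
    (fun c v w => by simp only [map_smul, Pi.smul_apply, rmul_smul, Finset.smul_sum])

/-- The left linear map on `M ⊗_A M` with prescribed values on the tensors `γ_i ⊗ γ_j` of a left
basis of `M`. -/
noncomputable def basisMap₂ {γ : ι → M} (hγ : Function.Bijective (lcomb 𝕜 A γ))
    (τ : ι → ι → M') : BTensor 𝕜 A M M →ₗ[𝕜] M' :=
  blift 𝕜 (basisMap₂Aux hγ τ) (fun v a w => by
    simp only [basisMap₂Aux, LinearMap.mk₂_apply, coords_lmul, rmul_rmul, Pi.smul_apply,
      smul_eq_mul])

theorem basisMap₂_btmul {γ : ι → M} (hγ : Function.Bijective (lcomb 𝕜 A γ))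
    (τ : ι → ι → M') (v w : M) : basisMap₂ hγ τ (btmul 𝕜 A v w)
      = ∑ j, basisMap hγ (fun i => τ i j) (rmul 𝕜 v (coords hγ w j)) := rfl

theorem basisMap₂_self {γ : ι → M} (hγ : Function.Bijective (lcomb 𝕜 A γ))
    (τ : ι → ι → M') (i j : ι) : basisMap₂ hγ τ (btmul 𝕜 A (γ i) (γ j)) = τ i j := by
  classical
  rw [basisMap₂_btmul, coords_self, Finset.sum_eq_single j]
  · rw [Pi.single_eq_same, rmul_one, basisMap_self]
  · intro k _ hk
    rw [Pi.single_eq_of_ne hk, rmul_zero, map_zero]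
  · simp

theorem basisMap₂_lmul {γ : ι → M} (hγ : Function.Bijective (lcomb 𝕜 A γ))
    (τ : ι → ι → M') (a : A) (t : BTensor 𝕜 A M M) :
    basisMap₂ hγ τ (lmul 𝕜 a t) = lmul 𝕜 a (basisMap₂ hγ τ t) := by
  induction t using bTensor_induction with
  | h0 => rw [lmul_zero, map_zero, lmul_zero]
  | h1 v w =>
    rw [lmul_btmul, basisMap₂_btmul, basisMap₂_btmul, lmul_sum]
    simp only [← lmul_rmul, basisMap_lmul]
  | h2 s t hs ht => rw [lmul_add, map_add, hs, ht, map_add, lmul_add]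

theorem bmap_lmul {P P' : Type*} [AddCommGroup P] [Module 𝕜 P] [Module (Env 𝕜 A) P]
    [IsScalarTower 𝕜 (Env 𝕜 A) P] [AddCommGroup P'] [Module 𝕜 P'] [Module (Env 𝕜 A) P']
    [IsScalarTower 𝕜 (Env 𝕜 A) P'] (f : M →ₗ[Env 𝕜 A] M') (g : P →ₗ[Env 𝕜 A] P') (a : A)
    (t : BTensor 𝕜 A M P) : bmap 𝕜 f g (lmul 𝕜 a t) = lmul 𝕜 a (bmap 𝕜 f g t) := by
  induction t using bTensor_induction with
  | h0 => rw [lmul_zero, map_zero, lmul_zero]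
  | h1 v w => rw [lmul_btmul, bmap_btmul, bmap_btmul, lmul_btmul, map_lmul]
  | h2 s t hs ht => rw [lmul_add, map_add, hs, ht, map_add, lmul_add]

theorem bassoc_lmul {P : Type*} [AddCommGroup P] [Module 𝕜 P] [Module (Env 𝕜 A) P]
    [IsScalarTower 𝕜 (Env 𝕜 A) P] (a : A) (t : BTensor 𝕜 A (BTensor 𝕜 A M M') P) :
    bassoc 𝕜 A M M' P (lmul 𝕜 a t) = lmul 𝕜 a (bassoc 𝕜 A M M' P t) := by
  induction t using bTensor_induction with
  | h0 => rw [lmul_zero, map_zero, lmul_zero]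
  | h1 v w =>
    induction v using bTensor_induction with
    | h0 => rw [zero_btmul, lmul_zero, map_zero, lmul_zero]
    | h1 u v =>
      rw [lmul_btmul, lmul_btmul, bassoc_btmul, bassoc_btmul, lmul_btmul]
    | h2 s t hs ht => rw [btmul_add_left, lmul_add, map_add, hs, ht, map_add, lmul_add]
  | h2 s t hs ht => rw [lmul_add, map_add, hs, ht, map_add, lmul_add]

theorem bassoc_symm_lmul {P : Type*} [AddCommGroup P] [Module 𝕜 P] [Module (Env 𝕜 A) P]
    [IsScalarTower 𝕜 (Env 𝕜 A) P] (a : A) (t : BTensor 𝕜 A M (BTensor 𝕜 A M' P)) :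
    (bassoc 𝕜 A M M' P).symm (lmul 𝕜 a t) = lmul 𝕜 a ((bassoc 𝕜 A M M' P).symm t) := by
  rw [LinearEquiv.symm_apply_eq, bassoc_lmul, LinearEquiv.apply_symm_apply]

end LeftBases

/-! ### The braiding -/

section Braiding

variable (𝕜 : Type*) [RCLike 𝕜] {q : ℝ} {N : ℕ}
variable {M : Type*} [AddCommGroup M] [Module 𝕜 M] [Module (Env 𝕜 (Sphere 𝕜 q N)) M]
  [IsScalarTower 𝕜 (Env 𝕜 (Sphere 𝕜 q N)) M]

/-- The mixed braid relation `R⁻¹₁₂ S₂₃ S₁₂ = S₂₃ S₁₂ R⁻¹₂₃` on tensors with values in `V`. -/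
def MixedBraid (V : Type*) [AddCommGroup V] [Module 𝕜 V] (q : ℝ)
    (S : Fin N → Fin N → Fin N → Fin N → ℝ) : Prop :=
  ∀ (f : Fin N → Fin N → Fin N → V) (i j k : Fin N),
    tact 𝕜 (Rinv q) (fun a b => tact 𝕜 S (fun b c => tact 𝕜 S (fun a b => f a b c) a b) b k) i j
      = tact 𝕜 S (fun b c => tact 𝕜 S (fun a b =>
        tact 𝕜 (Rinv q) (fun b c => f a b c) b c) i b) j k

/-- A generator `x_m` moves to the left through `γ_i ⊗ γ_j` by `S` in the last two and then in the
first two places. -/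
theorem btmul_rmul_xgen {S : Fin N → Fin N → Fin N → Fin N → ℝ} {γ : Fin N → M}
    (h : CommRule 𝕜 q S γ) (i j m : Fin N) :
    rmul 𝕜 (btmul 𝕜 (Sphere 𝕜 q N) (γ i) (γ j)) (xgen 𝕜 q m)
      = tact 𝕜 S (fun b c => tact 𝕜 S (fun a b =>
          lmul 𝕜 (xgen 𝕜 q a) (btmul 𝕜 (Sphere 𝕜 q N) (γ b) (γ c))) i b) j m := by
  rw [btmul_rmul, h j m]
  have h1 := map_tact 𝕜 (bmk 𝕜 (Sphere 𝕜 q N) M M (γ i)) S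
    (fun k l => lmul 𝕜 (xgen 𝕜 q k) (γ l)) j m
  refine h1.trans ?_
  congr 1
  funext b c
  change btmul 𝕜 (Sphere 𝕜 q N) (γ i) (lmul 𝕜 (xgen 𝕜 q b) (γ c)) = _
  rw [← rmul_btmul, h i b]
  have h2 := map_tact 𝕜 ((bmk 𝕜 (Sphere 𝕜 q N) M M).flip (γ c)) S
    (fun k l => lmul 𝕜 (xgen 𝕜 q k) (γ l)) i b
  refine h2.trans ?_
  congr 1
  funext a d
  exact (lmul_btmul 𝕜 _ _ _).symm

/-- The left linear map on `M ⊗_X M` with `γ_i ⊗ γ_j ↦ α R⁻¹^{kl}_{ij} γ_k ⊗ γ_l`. -/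
noncomputable def twistMap {γ : Fin N → M}
    (hγ : Function.Bijective (lcomb 𝕜 (Sphere 𝕜 q N) γ)) (α : 𝕜) :
    BTensor 𝕜 (Sphere 𝕜 q N) M M →ₗ[𝕜] BTensor 𝕜 (Sphere 𝕜 q N) M M :=
  basisMap₂ hγ fun i j =>
    α • tact 𝕜 (Rinv q) (fun k l => btmul 𝕜 (Sphere 𝕜 q N) (γ k) (γ l)) i j

variable {γ : Fin N → M} (hγ : Function.Bijective (lcomb 𝕜 (Sphere 𝕜 q N) γ)) (α : 𝕜)

theorem twistMap_self (i j : Fin N) : twistMap 𝕜 hγ α (btmul 𝕜 (Sphere 𝕜 q N) (γ i) (γ j))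
    = α • tact 𝕜 (Rinv q) (fun k l => btmul 𝕜 (Sphere 𝕜 q N) (γ k) (γ l)) i j :=
  basisMap₂_self hγ _ i j

theorem twistMap_lmul (y : Sphere 𝕜 q N) (t : BTensor 𝕜 (Sphere 𝕜 q N) M M) :
    twistMap 𝕜 hγ α (lmul 𝕜 y t) = lmul 𝕜 y (twistMap 𝕜 hγ α t) :=
  basisMap₂_lmul hγ _ y t

/-- The map `twistMap` is right linear: on `γ_i ⊗ γ_j` and a generator `x_m` this is the mixed
braid relation for the commutation rule of the `γ_i`. -/
theorem twistMap_rmul {S : Fin N → Fin N → Fin N → Fin N → ℝ} (h : CommRule 𝕜 q S γ)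
    (hS : MixedBraid 𝕜 (BTensor 𝕜 (Sphere 𝕜 q N) M M) q S) (t : BTensor 𝕜 (Sphere 𝕜 q N) M M)
    (y : Sphere 𝕜 q N) : twistMap 𝕜 hγ α (rmul 𝕜 t y) = rmul 𝕜 (twistMap 𝕜 hγ α t) y := by
  induction y using sphere_induction generalizing t with
  | h1 => rw [rmul_one, rmul_one]
  | hx m =>
    let r : BTensor 𝕜 (Sphere 𝕜 q N) M M →ₗ[𝕜] BTensor 𝕜 (Sphere 𝕜 q N) M M :=
      ract 𝕜 (Sphere 𝕜 q N) _ (MulOpposite.op (xgen 𝕜 q m))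
    have key : twistMap 𝕜 hγ α ∘ₗ r = r ∘ₗ twistMap 𝕜 hγ α := by
      refine ext_of_left_generators (lcomb_btmul_surjective hγ.2 hγ.2)
        (fun (a : Sphere 𝕜 q N) t => lmul 𝕜 a t) ?_ ?_ ?_
      · intro a t
        change twistMap 𝕜 hγ α (rmul 𝕜 (lmul 𝕜 a t) (xgen 𝕜 q m))
          = lmul 𝕜 a (twistMap 𝕜 hγ α (rmul 𝕜 t (xgen 𝕜 q m)))
        rw [← lmul_rmul, twistMap_lmul]
      · intro a t
        change rmul 𝕜 (twistMap 𝕜 hγ α (lmul 𝕜 a t)) (xgen 𝕜 q m)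
          = lmul 𝕜 a (rmul 𝕜 (twistMap 𝕜 hγ α t) (xgen 𝕜 q m))
        rw [twistMap_lmul, lmul_rmul]
      · rintro ⟨i, j⟩
        change twistMap 𝕜 hγ α (rmul 𝕜 (btmul 𝕜 (Sphere 𝕜 q N) (γ i) (γ j)) (xgen 𝕜 q m))
          = r (twistMap 𝕜 hγ α (btmul 𝕜 (Sphere 𝕜 q N) (γ i) (γ j)))
        rw [btmul_rmul_xgen 𝕜 h, twistMap_self, map_smul, map_tact]
        simp only [map_tact, twistMap_lmul, twistMap_self, lmul_smul, lmul_tact, tact_smul]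
        rw [← hS]
        congr 2
        funext a b
        exact (btmul_rmul_xgen 𝕜 h a b m).symm
    exact LinearMap.congr_fun key t
  | hmul y z hy hz => rw [← rmul_rmul, hz, hy, rmul_rmul]
  | hadd y z hy hz => rw [rmul_add, map_add, hy, hz, rmul_add]
  | hsmul c y hy => rw [rmul_smul, map_smul, hy, rmul_smul]

/-- Bimodule maps `γ_i ⊗ γ_j ↦ α R⁻¹^{kl}_{ij} γ_k ⊗ γ_l` inherit the braid relation from
`R⁻¹`. -/
theorem isBraiding_of_left_generators (hq : 0 < q)
    (hγ : Function.Surjective (lcomb 𝕜 (Sphere 𝕜 q N) γ))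
    {σ : BTensor 𝕜 (Sphere 𝕜 q N) M M →ₗ[Env 𝕜 (Sphere 𝕜 q N)] BTensor 𝕜 (Sphere 𝕜 q N) M M}
    (hσ : ∀ i j, σ (btmul 𝕜 (Sphere 𝕜 q N) (γ i) (γ j))
      = α • tact 𝕜 (Rinv q) (fun k l => btmul 𝕜 (Sphere 𝕜 q N) (γ k) (γ l)) i j) :
    IsBraiding 𝕜 σ := by
  unfold IsBraiding
  intro σ₁ σ₂
  let G : Fin N → Fin N → Fin N → BTensor 𝕜 (Sphere 𝕜 q N) (BTensor 𝕜 (Sphere 𝕜 q N) M M) M :=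
    fun i j k => btmul 𝕜 (Sphere 𝕜 q N) (btmul 𝕜 (Sphere 𝕜 q N) (γ i) (γ j)) (γ k)
  have l₁ : ∀ y t, σ₁ (lmul 𝕜 y t) = lmul 𝕜 y (σ₁ t) := fun y t => bmap_lmul _ _ y t
  have l₂ : ∀ y t, σ₂ (lmul 𝕜 y t) = lmul 𝕜 y (σ₂ t) := fun y t => by
    change (bassoc 𝕜 (Sphere 𝕜 q N) M M M).symm (bmap 𝕜 _ _ (bassoc 𝕜 (Sphere 𝕜 q N) M M M _)) = _
    rw [bassoc_lmul, bmap_lmul, bassoc_symm_lmul]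
    rfl
  have h₁ : ∀ i j k, σ₁ (G i j k) = α • tact 𝕜 (Rinv q) (fun a b => G a b k) i j := by
    intro i j k
    change btmul 𝕜 (Sphere 𝕜 q N) (σ _) (γ k) = _
    rw [hσ]
    change (bmk 𝕜 (Sphere 𝕜 q N) (BTensor 𝕜 (Sphere 𝕜 q N) M M) M).flip (γ k) _ = _
    rw [map_smul, map_tact]
    rfl
  have h₂ : ∀ i j k, σ₂ (G i j k) = α • tact 𝕜 (Rinv q) (fun b c => G i b c) j k := by
    intro i j k
    change (bassoc 𝕜 (Sphere 𝕜 q N) M M M).symm (bmk 𝕜 (Sphere 𝕜 q N) M _ (γ i)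
      (σ (btmul 𝕜 (Sphere 𝕜 q N) (γ j) (γ k)))) = _
    rw [hσ, map_smul, map_smul, map_tact, map_tact]
    rfl
  refine ext_of_left_generators (lcomb_btmul_surjective (lcomb_btmul_surjective hγ hγ) hγ)
    (fun (y : Sphere 𝕜 q N) t => lmul 𝕜 y t) ?_ ?_ ?_
  · intro y t
    simp only [LinearMap.comp_apply, l₁, l₂]
  · intro y t
    simp only [LinearMap.comp_apply, l₁, l₂]
  · rintro ⟨⟨i, j⟩, k⟩
    change σ₁ (σ₂ (σ₁ (G i j k))) = σ₂ (σ₁ (σ₂ (G i j k)))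
    simp only [h₁, h₂, map_smul, map_tact, tact_smul, tact_braid 𝕜 hq]

end Braiding

/-! ### Covariance -/

section Covariance

variable (𝕜 : Type*) [RCLike 𝕜] {q : ℝ} {N : ℕ}

theorem tmulO_coLeft (s : Sphere 𝕜 q N ⊗[𝕜] Oq 𝕜 q N) (v w : Gam 𝕜 q N ⊗[𝕜] Oq 𝕜 q N) :
    tmulO 𝕜 q N (coLeft 𝕜 q _ s v) w = coLeft 𝕜 q _ s (tmulO 𝕜 q N v w) := by
  induction s using TensorProduct.induction_on with
  | zero => simp
  | add s t hs ht => simp only [map_add, LinearMap.add_apply, hs, ht]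
  | tmul y c =>
    induction v using TensorProduct.induction_on with
    | zero => simp
    | add v v' hv hv' => simp only [map_add, LinearMap.add_apply, hv, hv']
    | tmul v a =>
      induction w using TensorProduct.induction_on with
      | zero => simp
      | add w w' hw hw' => simp only [map_add, hw, hw']
      | tmul w b =>
        rw [coLeft_tmul, tmulO_tmul, tmulO_tmul, coLeft_tmul, lmul_btmul, mul_assoc]

theorem coactGam₂_lmul (y : Sphere 𝕜 q N) (t : Gam₂ 𝕜 q N) :
    coactGam₂ 𝕜 q N (lmul 𝕜 y t) = coLeft 𝕜 q _ (coactX 𝕜 q y) (coactGam₂ 𝕜 q N t) := by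
  induction t using bTensor_induction with
  | h0 => rw [lmul_zero, map_zero, map_zero]
  | h1 v w =>
    rw [lmul_btmul]
    change tmulO 𝕜 q N (coactGam 𝕜 q N _) (coactGam 𝕜 q N w)
      = coLeft 𝕜 q _ _ (tmulO 𝕜 q N (coactGam 𝕜 q N v) (coactGam 𝕜 q N w))
    rw [coactGam_lmul, tmulO_coLeft]
  | h2 s t hs ht => rw [lmul_add, map_add, map_add, hs, ht, map_add]

theorem rTensor_coLeft {M : Type*} [AddCommGroup M] [Module 𝕜 M]
    [Module (Env 𝕜 (Sphere 𝕜 q N)) M] [IsScalarTower 𝕜 (Env 𝕜 (Sphere 𝕜 q N)) M]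
    (σ : M →ₗ[Env 𝕜 (Sphere 𝕜 q N)] M) (s : Sphere 𝕜 q N ⊗[𝕜] Oq 𝕜 q N)
    (t : M ⊗[𝕜] Oq 𝕜 q N) :
    (σ.restrictScalars 𝕜).rTensor (Oq 𝕜 q N) (coLeft 𝕜 q M s t)
      = coLeft 𝕜 q M s ((σ.restrictScalars 𝕜).rTensor (Oq 𝕜 q N) t) := by
  induction s using TensorProduct.induction_on with
  | zero => simp
  | add s s' hs hs' => simp only [map_add, LinearMap.add_apply, hs, hs']
  | tmul y c =>
    induction t using TensorProduct.induction_on with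
    | zero => simp
    | add t t' ht ht' => simp only [map_add, ht, ht']
    | tmul m a =>
      rw [coLeft_tmul, LinearMap.rTensor_tmul, LinearMap.rTensor_tmul, coLeft_tmul,
        LinearMap.restrictScalars_apply, LinearMap.restrictScalars_apply, map_lmul]

theorem coactGam₂_btmul {γ : Fin N → Gam 𝕜 q N}
    (hγ : ∀ i, coactGam 𝕜 q N (γ i) = ∑ a, γ a ⊗ₜ[𝕜] ugen 𝕜 q a i) (i j : Fin N) :
    coactGam₂ 𝕜 q N (btmul 𝕜 (Sphere 𝕜 q N) (γ i) (γ j))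
      = ∑ a, ∑ b, btmul 𝕜 (Sphere 𝕜 q N) (γ a) (γ b) ⊗ₜ[𝕜] (ugen 𝕜 q a i * ugen 𝕜 q b j) := by
  change tmulO 𝕜 q N (coactGam 𝕜 q N (γ i)) (coactGam 𝕜 q N (γ j)) = _
  rw [hγ, hγ]
  simp only [map_sum, LinearMap.sum_apply, tmulO_tmul]
  exact Finset.sum_comm

/-- Bimodule maps `γ_i ⊗ γ_j ↦ α R⁻¹^{kl}_{ij} γ_k ⊗ γ_l` are covariant when the `γ_i` transform
by the fundamental corepresentation, because `R⁻¹` intertwines its tensor square. -/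
theorem isCovariant_of_left_generators {γ : Fin N → Gam 𝕜 q N}
    (hγ : Function.Surjective (lcomb 𝕜 (Sphere 𝕜 q N) γ))
    (hco : ∀ i, coactGam 𝕜 q N (γ i) = ∑ a, γ a ⊗ₜ[𝕜] ugen 𝕜 q a i) (α : 𝕜)
    {σ : Gam₂ 𝕜 q N →ₗ[Env 𝕜 (Sphere 𝕜 q N)] Gam₂ 𝕜 q N}
    (hσ : ∀ i j, σ (btmul 𝕜 (Sphere 𝕜 q N) (γ i) (γ j))
      = α • tact 𝕜 (Rinv q) (fun k l => btmul 𝕜 (Sphere 𝕜 q N) (γ k) (γ l)) i j) :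
    IsCovariant σ := by
  refine ext_of_left_generators (lcomb_btmul_surjective hγ hγ)
    (fun y t => coLeft 𝕜 q _ (coactX 𝕜 q y) t) ?_ ?_ ?_
  · intro y t
    simp only [LinearMap.comp_apply, LinearMap.restrictScalars_apply]
    rw [map_lmul, coactGam₂_lmul]
  · intro y t
    simp only [LinearMap.comp_apply]
    rw [coactGam₂_lmul, rTensor_coLeft]
  · rintro ⟨i, j⟩
    simp only [LinearMap.comp_apply, LinearMap.restrictScalars_apply]
    rw [hσ, map_smul, map_tact]
    simp only [coactGam₂_btmul 𝕜 hco, map_sum, LinearMap.rTensor_tmul,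
      LinearMap.restrictScalars_apply, hσ]
    rw [tact, sum_intertwine 𝕜 q (fun k l i j => ((Rinv q k l i j : ℝ) : 𝕜)) (oq_Rinv 𝕜 q)]
    simp only [tact, Finset.smul_sum, TensorProduct.smul_tmul']

end Covariance

/-! ### The braidings of `γ⁺` and `γ⁻` -/

/-- The common form of both cases: a left basis that obeys a commutation rule compatible with
`R⁻¹` and transforms by the fundamental corepresentation. -/
theorem exists_braiding (𝕜 : Type*) [RCLike 𝕜] {q : ℝ} (hq : 0 < q) {N : ℕ}
    {γ : Fin N → Gam 𝕜 q N} (hγ : Function.Bijective (lcomb 𝕜 (Sphere 𝕜 q N) γ))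
    {S : Fin N → Fin N → Fin N → Fin N → ℝ} (h : CommRule 𝕜 q S γ)
    (hS : MixedBraid 𝕜 (Gam₂ 𝕜 q N) q S)
    (hco : ∀ i, coactGam 𝕜 q N (γ i) = ∑ a, γ a ⊗ₜ[𝕜] ugen 𝕜 q a i) (α : 𝕜) :
    ∃ σ : Gam₂ 𝕜 q N →ₗ[Env 𝕜 (Sphere 𝕜 q N)] Gam₂ 𝕜 q N,
      (∀ i j, σ (btmul 𝕜 (Sphere 𝕜 q N) (γ i) (γ j))
        = α • tact 𝕜 (Rinv q) (fun k l => btmul 𝕜 (Sphere 𝕜 q N) (γ k) (γ l)) i j) ∧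
      (∀ τ : Gam₂ 𝕜 q N →ₗ[Env 𝕜 (Sphere 𝕜 q N)] Gam₂ 𝕜 q N,
        (∀ i j, τ (btmul 𝕜 (Sphere 𝕜 q N) (γ i) (γ j))
          = α • tact 𝕜 (Rinv q) (fun k l => btmul 𝕜 (Sphere 𝕜 q N) (γ k) (γ l)) i j) → τ = σ) ∧
      IsCovariant σ ∧ IsBraiding 𝕜 σ := by
  let σ : Gam₂ 𝕜 q N →ₗ[Env 𝕜 (Sphere 𝕜 q N)] Gam₂ 𝕜 q N :=
    bimoduleHom (twistMap 𝕜 hγ α) (twistMap_lmul 𝕜 hγ α) (twistMap_rmul 𝕜 hγ α h hS)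
  have hσ : ∀ i j, σ (btmul 𝕜 (Sphere 𝕜 q N) (γ i) (γ j))
      = α • tact 𝕜 (Rinv q) (fun k l => btmul 𝕜 (Sphere 𝕜 q N) (γ k) (γ l)) i j :=
    twistMap_self 𝕜 hγ α
  refine ⟨σ, hσ, fun τ hτ => ?_, isCovariant_of_left_generators 𝕜 hγ.2 hco α hσ,
    isBraiding_of_left_generators 𝕜 α hq hγ.2 hσ⟩
  have key : τ.restrictScalars 𝕜 = σ.restrictScalars 𝕜 :=
    ext_of_left_generators (lcomb_btmul_surjective hγ.2 hγ.2) (fun (y : Sphere 𝕜 q N) t => lmul 𝕜 y t)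
      (fun y t => map_lmul τ y t) (fun y t => map_lmul σ y t)
      (fun p => (hτ p.1 p.2).trans (hσ p.1 p.2).symm)
  exact LinearMap.ext fun t => LinearMap.congr_fun key t

/-- Both families are left bases that transform by the fundamental corepresentation; `γ⁺` commutes
with `X` through `R` and `γ⁻` through `R⁻¹`. -/
theorem exists_commRule (𝕜 : Type*) [RCLike 𝕜] {q : ℝ} (hq : 0 < q) (hq1 : q ≠ 1)
    {N : ℕ} (hN : 3 ≤ N) {γ : Fin N → Gam 𝕜 q N} (hγ : γ = gammaPlus 𝕜 q ∨ γ = gammaMinus 𝕜 q) :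
    Function.Bijective (lcomb 𝕜 (Sphere 𝕜 q N) γ) ∧
      (∀ i, coactGam 𝕜 q N (γ i) = ∑ a, γ a ⊗ₜ[𝕜] ugen 𝕜 q a i) ∧
      ∃ S, CommRule 𝕜 q S γ ∧ MixedBraid 𝕜 (Gam₂ 𝕜 q N) q S := by
  have hp : 0 < q ^ ((N : ℤ) - 2) := zpow_pos hq _
  have hd := one_sub_zpow_ne hq hq1 hN
  have h1q : 1 + q ≠ 0 := by positivity
  rcases hγ with rfl | rfl
  · set s : ℝ := -((1 + q ^ ((N : ℤ) - 2)) / (1 - q ^ ((N : ℤ) - 1))) with hs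
    -- In the model `γ⁺_i` becomes `e_i - (1 + q^{N-2}) x_i ω`.
    have hprod : (1 + s) * (1 - muConst q N) = -q ^ ((N : ℤ) - 2) := by
      rw [hs, muConst, (zpow_succ_of_two hq N).1]
      generalize q ^ ((N : ℤ) - 2) = p at *
      rw [mul_comm q p] at hd ⊢
      field_simp
      ring
    have hs1 : 1 + s ≠ 0 := left_ne_zero_of_mul (hprod ▸ neg_ne_zero.2 hp.ne')
    exact ⟨lcomb_gammaForm_bijective 𝕜 hq hq1 hN hs1, coactGam_gammaForm 𝕜 s, Rmat q,
      commRule_gammaForm_Rmat 𝕜 hq hq1 hN hprod, tact_mixed_braid 𝕜 hq⟩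
  · set s : ℝ := q * ((1 + q ^ ((N : ℤ) - 2)) / (1 - q ^ ((N : ℤ) - 1))) with hs
    -- In the model `γ⁻_i` becomes `e_i`.
    have hprod : (1 + s) * (1 - muConst q N) = 1 := by
      rw [hs, muConst, (zpow_succ_of_two hq N).1]
      generalize q ^ ((N : ℤ) - 2) = p at *
      field_simp
      ring
    have hs1 : 1 + s ≠ 0 := left_ne_zero_of_mul (hprod ▸ one_ne_zero)
    exact ⟨lcomb_gammaForm_bijective 𝕜 hq hq1 hN hs1, coactGam_gammaForm 𝕜 s, Rinv q,
      commRule_gammaForm_Rinv 𝕜 hq hq1 hN hprod, tact_braid 𝕜 hq⟩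

end QSphere

open QSphere in
theorem mainTheorem3 {𝕜 : Type*} [RCLike 𝕜] (q : ℝ) (hq : 0 < q) (hq1 : q ≠ 1)
    (N : ℕ) (hN : 3 ≤ N) (γ : Fin N → Gam 𝕜 q N)
    (hγ : γ = gammaPlus 𝕜 q ∨ γ = gammaMinus 𝕜 q) (α : ℝ) :
    (∀ ω : Gam 𝕜 q N, ∃! c : Fin N → Sphere 𝕜 q N, ω = ∑ i, lmul 𝕜 (c i) (γ i)) ∧
    ∃ σ : Gam₂ 𝕜 q N →ₗ[Env 𝕜 (Sphere 𝕜 q N)] Gam₂ 𝕜 q N,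
      (∀ i j, σ (btmul 𝕜 (Sphere 𝕜 q N) (γ i) (γ j))
        = (α : 𝕜) • ∑ k, ∑ l, ((Rinv q k l i j : ℝ) : 𝕜) •
            btmul 𝕜 (Sphere 𝕜 q N) (γ k) (γ l)) ∧
      (∀ τ : Gam₂ 𝕜 q N →ₗ[Env 𝕜 (Sphere 𝕜 q N)] Gam₂ 𝕜 q N,
        (∀ i j, τ (btmul 𝕜 (Sphere 𝕜 q N) (γ i) (γ j))
          = (α : 𝕜) • ∑ k, ∑ l, ((Rinv q k l i j : ℝ) : 𝕜) •
              btmul 𝕜 (Sphere 𝕜 q N) (γ k) (γ l)) → τ = σ) ∧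
      IsCovariant σ ∧ IsBraiding 𝕜 σ := by
  obtain ⟨hbij, hco, S, hS, hmix⟩ := exists_commRule 𝕜 hq hq1 hN hγ
  refine ⟨fun ω => ?_, exists_braiding 𝕜 hq hbij hS hmix hco (α : 𝕜)⟩
  obtain ⟨c, hc, huniq⟩ := hbij.existsUnique ω
  exact ⟨c, hc.symm, fun c' hc' => huniq c' hc'.symm⟩
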